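/- **Definitions.** Let $PSL(2,\mathbb C)=SL(2,\mathbb C)/\{\pm1\}$ act on $\widehat{\mathbb C}=\mathbb C\cup\{\infty\}$ by Möbius transformations and on the upper half-space $\mathbb H$ by their isometric extensions. A subgroup is *elementary* if it has a finite orbit in $\mathbb H\cup\widehat{\mathbb C}$. A hyperbolic line is given by its two ends on $\widehat{\mathbb C}$; it is *improper* if the ends coincide. The *axis* of $A\neq1$ is the line whose ends are the fixed points of $A$ on $\widehat{\mathbb C}$ (improper if $A$ is parabolic). For $x\ne y$, $H_{[x,y]}$ is the half-turn about the line $[x,y]$, the element of order two fixing $x$ and $y$. A proper line is perpendicular to an improper line $[u,u]$ if $u$ is one of its ends. If $\langle A,B\rangle$ is non-elementary, the axes of $A$ and $B$ have a common perpendicular $[n,n']$ with $n\neq n'$, and there are unique lines $[a,a']$, $[b,b']$ with $A=H_{[a,a']}H_{[n,n']}$, $B=H_{[b,b']}H_{[n,n']}$; the six-tuple $(a,a',n,n',b,b')$ is the *ortho-end* of $(A,B)$. The pair $(A,B)$ is *marked nsdc* if $\langle A,B\rangle$ is non-elementary and there are pairwise disjoint or tangent circles $C_A$, $C_N$, $C_B$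 on $\widehat{\mathbb C}$ (Euclidean circles, or lines together with $\infty$) passing through $a,a'$, through $n,n'$, and through $b,b'$ respectively, such that none of the three separates the other two. A subgroup $G\subset PSL(2,\mathbb C)$ is a *non-separating disjoint circle (nsdc) group* if $G=\langle A,B\rangle$ for some marked nsdc pair $(A,B)$. For $\lambda\in\mathbb C$ let $G_\lambda\subset PSL(2,\mathbb C)$ be the subgroup generated by the classes of $$S=\begin{pmatrix}1&0\\1&1\end{pmatrix},\qquad T_\lambda=\begin{pmatrix}1&2\lambda\\0&1\end{pmatrix}.$$ **Statement.** 1. For all $\lambda\in\mathbb C$ and $\omega\in\mathbb R$ with $\lambda=|\lambda|e^{i\omega}$, the group $G_\lambda$ is an nsdc group if and only if $|\lambda|\,(1+|\cos\omega|)\ge4$. 2. The topological boundary in $\mathbb C$ of $\{\lambda\in\mathbb C: G_\lambda\text{ is an nsdc group}\}$ is the set of all $\lambda=|\lambda|e^{i\omega}$ with $|\lambda|(1+|\cos\omega|)=4$; it is also the set of all $\lambda=x+iy$ with $y^2=16-8|x|$. 3. Let $S,T\in SL(2,\mathbb C)$ with $\operatorname{tr}S=\operatorname{tr}T=2$, and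 let $G\subset PSL(2,\mathbb C)$ be the subgroup generated by their classes. Then $G$ is an nsdc group if and only if $$|\operatorname{tr}(ST)-2|+|\operatorname{Re}(\operatorname{tr}(ST)-2)|\ge8,$$ and if this inequality holds, then $G$ is discrete. -/

import Mathlib

noncomputable section

namespace TwoParabolic

/-! ### Möbius transformations of the Riemann sphere -/

abbrev SL2C : Type := Matrix.SpecialLinearGroup (Fin 2) ℂ

abbrev PSL2C : Type := Matrix.ProjectiveSpecialLinearGroup (Fin 2) ℂ

/-- The class of a matrix in `PSL(2, ℂ) = SL(2, ℂ) / {± 1}`. -/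
def toPSL : SL2C →* PSL2C := QuotientGroup.mk' (Subgroup.center SL2C)

/-- The quotient topology on `PSL(2, ℂ)`. -/
instance instTopPSL2C : TopologicalSpace PSL2C :=
  inferInstanceAs (TopologicalSpace (SL2C ⧸ Subgroup.center SL2C))

/-- The Riemann sphere `ℂ ∪ {∞}`. -/
abbrev Sphere : Type := OnePoint ℂ

/-- `PSL(2, ℂ)` acts on the Riemann sphere by Möbius transformations: the action on the complex
projective line, transported along the identification of that line with `ℂ ∪ {∞}`. -/
instance instActPSL2C : MulAction PSL2C Sphere :=
  (OnePoint.equivProjectivization ℂ).mulAction PSL2C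

/-- The action is the usual one, the one which Mathlib has for `GL(2, ℂ)`. -/
theorem toPSL_smul (g : SL2C) (z : Sphere) :
    toPSL g • z = (g : Matrix.GeneralLinearGroup (Fin 2) ℂ) • z := rfl

/-- It sends `z` to `(a z + b) / (c z + d)`, and to `∞` where the denominator vanishes. -/
theorem toPSL_smul_coe (g : SL2C) (z : ℂ) :
    toPSL g • (z : Sphere) =
      if g 1 0 * z + g 1 1 = 0 then OnePoint.infty
      else (((g 0 0 * z + g 0 1) / (g 1 0 * z + g 1 1) : ℂ) : Sphere) := by
  rw [toPSL_smul, OnePoint.smul_some_eq_ite]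
  rfl

theorem toPSL_smul_infty (g : SL2C) :
    toPSL g • (OnePoint.infty : Sphere) =
      if g 1 0 = 0 then OnePoint.infty else ((g 0 0 / g 1 0 : ℂ) : Sphere) := by
  rw [toPSL_smul, OnePoint.smul_infty_eq_ite]
  rfl

/-! ### Elementary groups -/

/-- The extension of the Möbius transformation of a matrix in `SL(2, ℂ)` to the upper half-space
`{(z, t) | z ∈ ℂ, t > 0}`, the isometry with `g` as its action on the boundary. -/
def halfSpaceMap (g : SL2C) (p : ℂ × ℝ) : ℂ × ℝ :=
  let N : ℝ := ‖g 1 0 * p.1 + g 1 1‖ ^ 2 + ‖g 1 0‖ ^ 2 * p.2 ^ 2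
  (((g 0 0 * p.1 + g 0 1) * star (g 1 0 * p.1 + g 1 1)
      + g 0 0 * star (g 1 0) * ((p.2 : ℂ)) ^ 2) / (N : ℂ),
    p.2 / N)

/-- A subgroup of `PSL(2, ℂ)` is elementary if it has a finite orbit in the closed hyperbolic space,
that is, either on the sphere at infinity or in the upper half-space. -/
def IsElementary (G : Subgroup PSL2C) : Prop :=
  (∃ z : Sphere, {w : Sphere | ∃ g ∈ G, w = g • z}.Finite) ∨
  (∃ p : ℂ × ℝ, 0 < p.2 ∧ {q : ℂ × ℝ | ∃ g : SL2C, toPSL g ∈ G ∧ q = halfSpaceMap g p}.Finite)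

/-! ### Half-turns, axes, perpendiculars and ortho-ends

A hyperbolic line is given by its ends on the sphere; a line whose two ends coincide is improper. -/

/-- `h` is the half-turn about the proper line with ends `x` and `y`, the transformation
of order two which fixes `x` and `y`. -/
def IsHalfTurn (h : PSL2C) (x y : Sphere) : Prop :=
  x ≠ y ∧ h ≠ 1 ∧ h * h = 1 ∧ h • x = x ∧ h • y = y

/-- The line with ends `u`, `v` is the axis of `A`: its ends are the fixed points of `A`. It is
improper, `u = v`, when `A` is parabolic, and does not exist when `A = 1`. -/
def IsAxis (A : PSL2C) (u v : Sphere) : Prop :=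
  {z : Sphere | A • z = z} = {u, v}

/-- The proper line with ends `x`, `y` is perpendicular to the line with ends `u`, `v`: the half-turn
about the first reverses the second. When `u ≠ v` this says that the lines meet at a right angle;
when `u = v` it says that `u` is one of the ends `x`, `y`, which is what perpendicularity to an
improper line means. -/
def IsPerp (x y u v : Sphere) : Prop :=
  ∃ h : PSL2C, IsHalfTurn h x y ∧ h • u = v

/-- `(a, a', n, n', b, b')` is the ortho-end of the ordered pair `A`, `B`: the line `[n, n']` is the
common perpendicular of the axes of `A` and `B`, and `A`, `B` are the products of the half-turns
about `[a, a']`, respectively `[b, b']`, with the half-turn about `[n, n']`. -/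
structure IsOrthoEnd (A B : PSL2C) (a a' n n' b b' : Sphere) : Prop where
  perp_left : ∃ u v, IsAxis A u v ∧ IsPerp n n' u v
  perp_right : ∃ u v, IsAxis B u v ∧ IsPerp n n' u v
  factor : ∃ hA hN hB : PSL2C, IsHalfTurn hA a a' ∧ IsHalfTurn hN n n' ∧ IsHalfTurn hB b b' ∧
    A = hA * hN ∧ B = hB * hN

/-! ### Non-separating disjoint circles -/

/-- A circle on the Riemann sphere: a Euclidean circle of positive radius, or a Euclidean line
together with `∞`. -/
def IsCircle (C : Set Sphere) : Prop :=
  (∃ (c : ℂ) (r : ℝ), 0 < r ∧ C = (fun z : ℂ => (z : Sphere)) '' Metric.sphere c r) ∨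
  (∃ p v : ℂ, v ≠ 0 ∧
    C = insert OnePoint.infty ((fun z : ℂ => (z : Sphere)) '' {z | ∃ t : ℝ, z = p + t * v}))

/-- Two circles on the sphere are disjoint or tangent if they have at most one common point
(so a circle is not tangent to itself). -/
def DisjointOrTangent (C D : Set Sphere) : Prop := (C ∩ D).Subsingleton

/-- The circle `C` separates `D` from `E`: no connected subset of its complement meets both. -/
def Separates (C D E : Set Sphere) : Prop :=
  ¬ ∃ P : Set Sphere, IsPreconnected P ∧ P ⊆ Cᶜ ∧ (P ∩ D).Nonempty ∧ (P ∩ E).Nonempty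

/-- The non-separating disjoint circle property of six points on the sphere. -/
def HasNSDCProperty (a a' n n' b b' : Sphere) : Prop :=
  a ≠ a' ∧ n ≠ n' ∧ b ≠ b' ∧
  ∃ CA CN CB : Set Sphere, IsCircle CA ∧ IsCircle CN ∧ IsCircle CB ∧
    a ∈ CA ∧ a' ∈ CA ∧ n ∈ CN ∧ n' ∈ CN ∧ b ∈ CB ∧ b' ∈ CB ∧
    DisjointOrTangent CA CN ∧ DisjointOrTangent CN CB ∧ DisjointOrTangent CA CB ∧
    ¬ Separates CA CN CB ∧ ¬ Separates CN CA CB ∧ ¬ Separates CB CA CN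

/-- The ordered pair `A`, `B` generates a marked non-separating disjoint circle group. -/
def IsMarkedNSDC (A B : PSL2C) : Prop :=
  ¬ IsElementary (Subgroup.closure {A, B}) ∧
  ∃ a a' n n' b b' : Sphere, IsOrthoEnd A B a a' n n' b b' ∧ HasNSDCProperty a a' n n' b b'

/-- `G` is a non-separating disjoint circle group: it is one for some pair of generators. -/
def IsNSDC (G : Subgroup PSL2C) : Prop :=
  ∃ A B : PSL2C, Subgroup.closure {A, B} = G ∧ IsMarkedNSDC A B

/-! ### Groups with two parabolic generators -/

def matS : SL2C := ⟨!![1, 0; 1, 1], by simp [Matrix.det_fin_two]⟩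

def matT (lam : ℂ) : SL2C := ⟨!![1, 2 * lam; 0, 1], by simp [Matrix.det_fin_two]⟩

/-- The subgroup of `PSL(2, ℂ)` generated by the classes of two matrices. -/
def generatedBy (S T : SL2C) : Subgroup PSL2C := Subgroup.closure {toPSL S, toPSL T}

/-- The group `G_λ = ⟨S, T_λ⟩`. -/
def groupG (lam : ℂ) : Subgroup PSL2C := generatedBy matS (matT lam)

end TwoParabolic

end

noncomputable section

namespace TwoParabolic

open Complex Matrix
open scoped ComplexConjugate

/-! ### Hermitian forms on `ℂ²` -/

/-! A circle on the sphere is the zero set of a Hermitian form on `ℂ²` with positive `disc`, its two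
sides are the two signs of the form, and the half-turn about a line with both ends on the circle
changes the sign of the form (`IsHalfTurn.exists_matrix`). As none of three nsdc circles separates
the other two, the signs can be normalised so that the negative sides are pairwise disjoint discs
(`exists_signs`). A marked pair thus becomes a `HalfTurnSystem`. Ping-pong with the three discs,
from a base point outside all of them, shows that the half-turns generate the free product `W` of
three groups of order two and that the group is discrete; `⟨A, B⟩` is the image of `W.even`.

Sufficiency. Two matrices of trace 2 with `tr(ST) ≠ 2` are simultaneously conjugate to the standard
pair with `2λ = tr(ST) - 2`, whose ortho-end is `(0, 2, 0, ∞, λ, ∞)`. If `|λ| + Re λ ≥ 4`, two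
parallel lines and a circle tangent to one of them do the job (`hasNSDCProperty_standard`).
Replacing `T` by `T⁻¹` changes the sign of `λ`, which accounts for `|Re λ|`.

Necessity. The circles are given for some generators `A`, `B`, while the inequality is about the
parabolic generators `S`, `T`; the bulk of the proof relates the two pairs. A parabolic element of
the group is conjugate to a cyclically reduced word whose fixed point is the tangency point of the
circles of its first and last letters (`Closed.mem_circles`). Read letter by letter, the word moves
this point among the at most three tangency points. Because `x` and `y` generate `W.even`, a weight
with values in `ℤ/2` shows that no half-turn exchanges two tangency points (`not_passes`); hence
each word alternates between two letters, and `x`, `y` are conjugates of powers of products of two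
letters. A quotient of `W` onto the infinite dihedral group forces the exponents to be `±1`, and a
second ping-pong makes the two conjugating elements agree (`exists_normal_form`). So, up to
inversion and a common conjugation, `S` and `T` are `h_a h_n` and `h_b h_n` for the three half-turns
of the system. In standard position their circles pass through `0, 2`, through `0, ∞` and through
`λ, ∞`, and disjointness of the discs yields `|λ| + Re λ ≥ 4` (`four_le_of_forms`). -/

/-- The Hermitian form `a |x|² + 2 Re (b x ȳ) + c |y|²` on `ℂ²`. -/
structure HForm where
  a : ℝ
  c : ℝ
  b : ℂ

namespace HForm

/-- The value of the form at a vector. -/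
def ev (Q : HForm) (v : Fin 2 → ℂ) : ℝ :=
  Q.a * normSq (v 0) + 2 * (Q.b * v 0 * conj (v 1)).re + Q.c * normSq (v 1)

/-- The polarisation of the form. -/
def pol (Q : HForm) (v w : Fin 2 → ℂ) : ℂ :=
  Q.a * v 0 * conj (w 0) + Q.b * v 0 * conj (w 1) + conj Q.b * v 1 * conj (w 0)
    + Q.c * v 1 * conj (w 1)

/-- Minus the determinant of the form; the form is indefinite when this is positive. -/
def disc (Q : HForm) : ℝ := normSq Q.b - Q.a * Q.c

/-- The form multiplied by a real number. -/
def scale (t : ℝ) (Q : HForm) : HForm := ⟨t * Q.a, t * Q.c, t * Q.b⟩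

end HForm

theorem mulVec_zero_apply (g : SL2C) (v : Fin 2 → ℂ) :
    (g.1 *ᵥ v) 0 = g 0 0 * v 0 + g 0 1 * v 1 := by
  simp [Matrix.mulVec, dotProduct, Fin.sum_univ_two]

theorem mulVec_one_apply (g : SL2C) (v : Fin 2 → ℂ) :
    (g.1 *ᵥ v) 1 = g 1 0 * v 0 + g 1 1 * v 1 := by
  simp [Matrix.mulVec, dotProduct, Fin.sum_univ_two]

theorem sl_det (g : SL2C) : g 0 0 * g 1 1 - g 0 1 * g 1 0 = 1 := by
  have := g.2
  rwa [Matrix.det_fin_two] at this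

namespace HForm

/-- The pull-back of the form by a matrix. -/
def comap (g : SL2C) (Q : HForm) : HForm :=
  ⟨Q.ev ![g 0 0, g 1 0], Q.ev ![g 0 1, g 1 1], Q.pol ![g 0 0, g 1 0] ![g 0 1, g 1 1]⟩

theorem ev_comb (Q : HForm) (x y : ℂ) (e f : Fin 2 → ℂ) :
    Q.ev (x • e + y • f) =
      normSq x * Q.ev e + normSq y * Q.ev f + 2 * (x * conj y * Q.pol e f).re := by
  simp only [ev, pol, Pi.add_apply, Pi.smul_apply, smul_eq_mul, normSq_apply, mul_re, mul_im,
    add_re, add_im, conj_re, conj_im, ofReal_re, ofReal_im]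
  ring

theorem ev_smul (Q : HForm) (x : ℂ) (e : Fin 2 → ℂ) : Q.ev (x • e) = normSq x * Q.ev e := by
  have := Q.ev_comb x 0 e e
  simpa using this

theorem ev_add_smul (Q : HForm) (t : ℝ) (e f : Fin 2 → ℂ) :
    Q.ev (e + (t : ℂ) • f) = Q.ev e + t ^ 2 * Q.ev f + 2 * t * (Q.pol e f).re := by
  have := Q.ev_comb 1 t e f
  simp only [one_smul, map_one, normSq_ofReal, one_mul, conj_ofReal, re_ofReal_mul] at this
  rw [this]; ring

theorem ev_scale (Q : HForm) (t : ℝ) (e : Fin 2 → ℂ) : (Q.scale t).ev e = t * Q.ev e := by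
  simp only [ev, scale, mul_re, mul_im, conj_re, conj_im, ofReal_re, ofReal_im]
  ring

theorem disc_scale (Q : HForm) (t : ℝ) : (Q.scale t).disc = t ^ 2 * Q.disc := by
  simp only [disc, scale, normSq_apply, mul_re, mul_im, ofReal_re, ofReal_im]
  ring

theorem ev_comap (g : SL2C) (Q : HForm) (v : Fin 2 → ℂ) :
    (Q.comap g).ev v = Q.ev (g.1 *ᵥ v) := by
  have : g.1 *ᵥ v = v 0 • ![g 0 0, g 1 0] + v 1 • ![g 0 1, g 1 1] := by
    ext i
    fin_cases i
    · simp [mulVec_zero_apply]; ring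
    · simp [mulVec_one_apply]; ring
  rw [this, ev_comb]
  have e : v 0 * conj (v 1) * Q.pol ![g 0 0, g 1 0] ![g 0 1, g 1 1] =
    Q.pol ![g 0 0, g 1 0] ![g 0 1, g 1 1] * v 0 * conj (v 1) := by ring
  rw [e]
  simp only [comap, ev]
  ring

theorem disc_comap (g : SL2C) (Q : HForm) : (Q.comap g).disc = Q.disc := by
  have h1 : (Q.comap g).disc = Q.disc * normSq (g 0 0 * g 1 1 - g 0 1 * g 1 0) := by
    simp only [disc, comap, ev, pol, normSq_apply, mul_re, mul_im,
      add_re, add_im, sub_re, sub_im, conj_re, conj_im, ofReal_re, ofReal_im, Matrix.cons_val_zero,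
      Matrix.cons_val_one]
    ring
  rw [h1, sl_det]; simp

theorem continuous_ev (Q : HForm) : Continuous Q.ev := by
  unfold ev
  have h0 : Continuous fun v : Fin 2 → ℂ => v 0 := continuous_apply 0
  have h1 : Continuous fun v : Fin 2 → ℂ => v 1 := continuous_apply 1
  have := continuous_normSq
  have := Complex.continuous_re
  have := Complex.continuous_conj
  fun_prop

theorem eq_zero_disc (Q : HForm) (h : ∀ v, Q.ev v = 0) : Q.disc = 0 := by
  have ha := h ![1, 0]
  have hc := h ![0, 1]
  have hb := h ![conj Q.b, 1]
  simp [ev] at ha hc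
  simp [ev, ha, hc, mul_conj] at hb
  simp [disc, ha, hb]

end HForm

/-- The determinant of two vectors of `ℂ²`. -/
def cross (e f : Fin 2 → ℂ) : ℂ := e 0 * f 1 - e 1 * f 0

theorem exists_comb {e f : Fin 2 → ℂ} (h : cross e f ≠ 0) (v : Fin 2 → ℂ) :
    ∃ x y : ℂ, v = x • e + y • f := by
  refine ⟨cross v f / cross e f, cross e v / cross e f, ?_⟩
  have key : cross e f • v = cross v f • e + cross e v • f := by
    unfold cross
    ext i
    fin_cases i <;> simp <;> ring
  rw [div_eq_inv_mul, div_eq_inv_mul, mul_smul, mul_smul, ← smul_add, ← key, smul_smul,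
    inv_mul_cancel₀ h, one_smul]

theorem eq_smul_of_cross {e v : Fin 2 → ℂ} (he : e ≠ 0) (h : cross e v = 0) :
    ∃ x : ℂ, v = x • e := by
  unfold cross at h
  by_cases h0 : e 0 = 0
  · have h1 : e 1 ≠ 0 := by
      intro h1; apply he; ext i; fin_cases i <;> simp [h0, h1]
    refine ⟨v 1 / e 1, ?_⟩
    have : v 0 = 0 := by
      rw [h0] at h; simpa [h1] using h
    ext i; fin_cases i <;> simp [h0, h1, this]
  · refine ⟨v 0 / e 0, ?_⟩
    ext i
    fin_cases i
    · simp [h0]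
    · simp; field_simp; linear_combination h

theorem cross_smul_right (e f : Fin 2 → ℂ) (x : ℂ) : cross e (x • f) = x * cross e f := by
  simp [cross]; ring

theorem cross_self (e : Fin 2 → ℂ) : cross e e = 0 := by
  simp [cross]; ring

/-- In a basis of isotropic vectors the mixed coefficient is all that remains of the form, and the
zero form has `disc` zero. -/
theorem HForm.pol_ne_zero {Q : HForm} (hd : 0 < Q.disc) {e f : Fin 2 → ℂ} (h : cross e f ≠ 0)
    (he : Q.ev e = 0) (hf : Q.ev f = 0) : Q.pol e f ≠ 0 := by
  intro h0
  refine hd.ne' (Q.eq_zero_disc fun v => ?_)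
  obtain ⟨x, y, rfl⟩ := exists_comb h v
  rw [Q.ev_comb, he, hf, h0]; simp

/-! ### Points of the sphere and vectors -/

/-- A vector spanning the complex line of a point of the sphere. -/
def vec : Sphere → Fin 2 → ℂ
  | none => ![1, 0]
  | some z => ![z, 1]

@[simp] theorem vec_infty : vec OnePoint.infty = ![1, 0] := rfl
@[simp] theorem vec_coe (z : ℂ) : vec (z : Sphere) = ![z, 1] := rfl

theorem vec_ne_zero (z : Sphere) : vec z ≠ 0 := by
  induction z using OnePoint.rec with
  | infty => intro h; have := congrFun h 0; simp at this
  | coe z => intro h; have := congrFun h 1; simp at this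

theorem eq_of_cross_vec {z w : Sphere} (h : cross (vec z) (vec w) = 0) : z = w := by
  induction z using OnePoint.rec with
  | infty =>
    induction w using OnePoint.rec with
    | infty => rfl
    | coe w => simp [cross] at h
  | coe z =>
    induction w using OnePoint.rec with
    | infty => simp [cross] at h
    | coe w => simp [cross, sub_eq_zero] at h; rw [h]

theorem exists_point {v : Fin 2 → ℂ} (hv : v ≠ 0) :
    ∃ (z : Sphere) (c : ℂ), c ≠ 0 ∧ v = c • vec z := by
  by_cases h1 : v 1 = 0
  · refine ⟨OnePoint.infty, v 0, ?_, ?_⟩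
    · intro h0; apply hv; ext i; fin_cases i <;> simp [h0, h1]
    · ext i; fin_cases i <;> simp [h1]
  · refine ⟨((v 0 / v 1 : ℂ) : Sphere), v 1, h1, ?_⟩
    ext i; fin_cases i <;> simp; field_simp

theorem vec_smul (g : SL2C) (z : Sphere) :
    ∃ c : ℂ, c ≠ 0 ∧ g.1 *ᵥ vec z = c • vec (toPSL g • z) := by
  have hdet := sl_det g
  induction z using OnePoint.rec with
  | infty =>
    rw [toPSL_smul_infty]
    split_ifs with h
    · refine ⟨g 0 0, ?_, ?_⟩
      · intro h0; simp [h, h0] at hdet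
      · ext i; fin_cases i
        · simp [mulVec_zero_apply]
        · simp [mulVec_one_apply, h]
    · refine ⟨g 1 0, h, ?_⟩
      ext i; fin_cases i
      · simp [mulVec_zero_apply]; field_simp
      · simp [mulVec_one_apply]
  | coe z =>
    rw [toPSL_smul_coe]
    split_ifs with h
    · refine ⟨g 0 0 * z + g 0 1, ?_, ?_⟩
      · intro h0
        have : (1 : ℂ) = 0 := by
          linear_combination -hdet + g 0 0 * h - g 1 0 * h0
        exact one_ne_zero this
      · ext i; fin_cases i
        · simp [mulVec_zero_apply]
        · simp [mulVec_one_apply, h]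
    · refine ⟨g 1 0 * z + g 1 1, h, ?_⟩
      ext i; fin_cases i
      · simp [mulVec_zero_apply, mul_div_cancel₀ _ h]
      · simp [mulVec_one_apply]

theorem mul_mulVec (g h : SL2C) (v : Fin 2 → ℂ) : (g * h).1 *ᵥ v = g.1 *ᵥ (h.1 *ᵥ v) := by
  rw [Matrix.mulVec_mulVec, ← Matrix.SpecialLinearGroup.coe_mul]

theorem neg_mulVec_sl (g : SL2C) (v : Fin 2 → ℂ) : (-g).1 *ᵥ v = -(g.1 *ᵥ v) := by
  rw [Matrix.SpecialLinearGroup.coe_neg, Matrix.neg_mulVec]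

/-- A matrix fixes a point exactly when it has the vector of the point as an eigenvector. -/
theorem smul_eq_iff (g : SL2C) (z : Sphere) :
    toPSL g • z = z ↔ ∃ c : ℂ, g.1 *ᵥ vec z = c • vec z := by
  obtain ⟨c, hc, h⟩ := vec_smul g z
  constructor
  · intro hz; exact ⟨c, by rw [h, hz]⟩
  · rintro ⟨d, hd⟩
    apply eq_of_cross_vec
    have h2 : d • vec z = c • vec (toPSL g • z) := by rw [← hd, h]
    have h3 : cross (vec z) (c • vec (toPSL g • z)) = 0 := by
      rw [← h2, cross_smul_right, cross_self, mul_zero]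
    rw [cross_smul_right] at h3
    have h4 := (mul_eq_zero.1 h3).resolve_left hc
    unfold cross at *; linear_combination -h4

theorem toPSL_surjective : Function.Surjective toPSL := QuotientGroup.mk'_surjective _

theorem toPSL_eq_one_iff (g : SL2C) : toPSL g = 1 ↔ g = 1 ∨ g = -1 := by
  have : toPSL g = 1 ↔ g ∈ Subgroup.center SL2C := QuotientGroup.eq_one_iff g
  rw [this, Matrix.SpecialLinearGroup.mem_center_iff]
  constructor
  · rintro ⟨r, hr, h⟩
    simp only [Fintype.card_fin] at hr
    rcases sq_eq_one_iff.1 hr with rfl | rfl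
    · left; ext i j; rw [← h]; simp
    · right; ext i j; rw [← h]; fin_cases i <;> fin_cases j <;> simp
  · rintro (rfl | rfl)
    · exact ⟨1, by simp, by simp⟩
    · exact ⟨-1, by simp, by ext i j; fin_cases i <;> fin_cases j <;> simp⟩

theorem toPSL_eq_iff (g h : SL2C) : toPSL g = toPSL h ↔ g = h ∨ g = -h := by
  rw [← mul_inv_eq_one, ← map_inv, ← map_mul, toPSL_eq_one_iff, mul_inv_eq_one]
  constructor
  · rintro (h1 | h1)
    · exact Or.inl h1
    · right; rw [mul_inv_eq_iff_eq_mul] at h1; simpa using h1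
  · rintro (rfl | rfl) <;> simp

namespace HForm

/-- The value of a form at a point of the sphere; only its sign is meaningful. -/
def at' (Q : HForm) (z : Sphere) : ℝ := Q.ev (vec z)

theorem at_smul (Q : HForm) (g : SL2C) (z : Sphere) :
    ∃ r : ℝ, 0 < r ∧ Q.ev (g.1 *ᵥ vec z) = r * Q.at' (toPSL g • z) := by
  obtain ⟨c, hc, h⟩ := vec_smul g z
  exact ⟨normSq c, normSq_pos.2 hc, by rw [h, ev_smul]; rfl⟩

/-- The circle of a form. -/
def zeros (Q : HForm) : Set Sphere := {z | Q.at' z = 0}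

end HForm

/-! ### Circles as zero sets of Hermitian forms -/

theorem isCircle_exists_form {C : Set Sphere} (h : IsCircle C) :
    ∃ Q : HForm, 0 < Q.disc ∧ C = Q.zeros := by
  rcases h with ⟨c, r, hr, rfl⟩ | ⟨p, v, hv, rfl⟩
  -- The form is `|z - c|² - r²`, with `disc = r²`.
  · refine ⟨⟨1, normSq c - r ^ 2, -conj c⟩, ?_, ?_⟩
    · simp [HForm.disc]; positivity
    · ext z
      induction z using OnePoint.rec with
      | infty => simp [HForm.zeros, HForm.at', HForm.ev]
      | coe z =>
        have h1 : z ∈ Metric.sphere c r ↔ normSq (z - c) = r ^ 2 := by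
          rw [mem_sphere_iff_norm, normSq_eq_norm_sq, sq_eq_sq₀ (norm_nonneg _) hr.le]
        have h2 : ((z : Sphere) ∈ (fun z : ℂ => (z : Sphere)) '' Metric.sphere c r) ↔
            z ∈ Metric.sphere c r := by simp
        rw [h2, h1]
        simp only [HForm.zeros, HForm.at', HForm.ev, vec_coe, Set.mem_ofPred_eq, normSq_apply]
        simp
        constructor <;> intro h <;> linarith
  -- The form is `2 Re (i v̄ (z - p))`, which vanishes exactly when `z - p` is a real multiple of
  -- `v`.
  · refine ⟨⟨0, -2 * (I * conj v * p).re, I * conj v⟩, ?_, ?_⟩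
    · simp [HForm.disc, hv]
    · ext z
      induction z using OnePoint.rec with
      | infty => simp [HForm.zeros, HForm.at', HForm.ev]
      | coe z =>
        have h2 : ((z : Sphere) ∈ insert OnePoint.infty
            ((fun z : ℂ => (z : Sphere)) '' {z | ∃ t : ℝ, z = p + t * v})) ↔
            ∃ t : ℝ, z = p + t * v := by simp
        rw [h2]
        simp only [HForm.zeros, HForm.at', HForm.ev, vec_coe, Set.mem_ofPred_eq, normSq_apply]
        simp
        have hn : v.re ^ 2 + v.im ^ 2 ≠ 0 := by
          have := normSq_pos.2 hv; rw [normSq_apply] at this; nlinarith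
        constructor
        · rintro ⟨t, rfl⟩; simp; ring
        · intro h
          refine ⟨((z.re - p.re) * v.re + (z.im - p.im) * v.im) /
            (v.re ^ 2 + v.im ^ 2), ?_⟩
          apply Complex.ext <;>
          simp only [add_re, mul_re, ofReal_re, ofReal_im, add_im, mul_im] <;> field_simp
          · linear_combination (v.im / 2) * h
          · linear_combination (-v.re / 2) * h

/-- If `a ≠ 0`, completing the square gives the centre `-b̄ / a` and the radius `√disc / |a|`. If `a
= 0`, the equation is `Re (b z) = -c / 2`, a line in the direction `i b̄` through the foot of the
perpendicular from `0`. -/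
theorem isCircle_zeros {Q : HForm} (h : 0 < Q.disc) : IsCircle Q.zeros := by
  by_cases ha : Q.a = 0
  · have hb : Q.b ≠ 0 := by
      intro hb; simp [HForm.disc, ha, hb] at h
    have hn : Q.b.re ^ 2 + Q.b.im ^ 2 ≠ 0 := by
      have := normSq_pos.2 hb; rw [normSq_apply] at this; nlinarith
    have hN : normSq Q.b = Q.b.re ^ 2 + Q.b.im ^ 2 := by rw [normSq_apply]; ring
    right
    refine ⟨((-(Q.c / 2) / normSq Q.b : ℝ) : ℂ) * conj Q.b, I * conj Q.b, by simpa using hb, ?_⟩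
    ext z
    induction z using OnePoint.rec with
    | infty => simp [HForm.zeros, HForm.at', HForm.ev, ha]
    | coe z =>
      have h2 : ((z : Sphere) ∈ insert OnePoint.infty
          ((fun z : ℂ => (z : Sphere)) '' {z | ∃ t : ℝ,
            z = ((-(Q.c / 2) / normSq Q.b : ℝ) : ℂ) * conj Q.b + t * (I * conj Q.b)})) ↔
          ∃ t : ℝ, z = ((-(Q.c / 2) / normSq Q.b : ℝ) : ℂ) * conj Q.b + t * (I * conj Q.b) := by
        simp
      rw [h2]
      simp only [HForm.zeros, HForm.at', HForm.ev, vec_coe, Set.mem_ofPred_eq, ha, hN]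
      constructor
      · intro h3
        simp at h3
        refine ⟨(z.re * Q.b.im + z.im * Q.b.re) / (Q.b.re ^ 2 + Q.b.im ^ 2), ?_⟩
        apply Complex.ext
        · simp only [add_re, mul_re, ofReal_re, ofReal_im, conj_re, conj_im, I_re, I_im, mul_im]
          field_simp
          linear_combination Q.b.re * h3
        · simp only [add_im, mul_re, ofReal_re, ofReal_im, conj_re, conj_im, I_re, I_im, mul_im]
          field_simp
          linear_combination -Q.b.im * h3
      · rintro ⟨t, rfl⟩
        simp [-ofReal_div, -ofReal_mul]
        field_simp
        ring
  · left
    refine ⟨((1 / Q.a : ℝ) : ℂ) * (-conj Q.b), √(Q.disc) / |Q.a|, by positivity, ?_⟩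
    ext z
    induction z using OnePoint.rec with
    | infty => simp [HForm.zeros, HForm.at', HForm.ev, ha]
    | coe z =>
      have h1 : z ∈ Metric.sphere (((1 / Q.a : ℝ) : ℂ) * (-conj Q.b)) (√(Q.disc) / |Q.a|) ↔
          normSq (z - ((1 / Q.a : ℝ) : ℂ) * (-conj Q.b)) = Q.disc / Q.a ^ 2 := by
        rw [mem_sphere_iff_norm, normSq_eq_norm_sq, ← sq_eq_sq₀ (norm_nonneg _) (by positivity),
          div_pow, sq_abs, Real.sq_sqrt h.le]
      have h2 : ((z : Sphere) ∈ (fun z : ℂ => (z : Sphere)) ''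
          Metric.sphere (((1 / Q.a : ℝ) : ℂ) * (-conj Q.b)) (√(Q.disc) / |Q.a|)) ↔
          z ∈ Metric.sphere (((1 / Q.a : ℝ) : ℂ) * (-conj Q.b)) (√(Q.disc) / |Q.a|) := by simp
      have h4 : Q.a * (Q.at' z) =
          Q.a ^ 2 * (normSq (z - ((1 / Q.a : ℝ) : ℂ) * (-conj Q.b)) - Q.disc / Q.a ^ 2) := by
        simp only [HForm.at', HForm.ev, vec_coe, HForm.disc, normSq_apply]
        simp
        field_simp
        ring
      rw [h2, h1]
      simp only [HForm.zeros, Set.mem_ofPred_eq]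
      constructor
      · intro h3
        have : Q.a ^ 2 * (normSq (z - ((1 / Q.a : ℝ) : ℂ) * (-conj Q.b)) - Q.disc / Q.a ^ 2) = 0 := by
          rw [← h4, h3, mul_zero]
        have := (mul_eq_zero.1 this).resolve_left (by positivity)
        linarith
      · intro h3
        rw [h3, sub_self, mul_zero] at h4
        exact (mul_eq_zero.1 h4).resolve_left ha

end TwoParabolic
end

noncomputable section

namespace TwoParabolic

/-! ### Words in involutions -/

section Words

variable {G ι : Type*} [Group G]

/-- The product of a word. -/
def wprod (g : ι → G) (l : List ι) : G := (l.map g).prod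

@[simp] theorem wprod_nil (g : ι → G) : wprod g [] = 1 := rfl

@[simp] theorem wprod_cons (g : ι → G) (i : ι) (l : List ι) :
    wprod g (i :: l) = g i * wprod g l := by simp [wprod]

theorem wprod_append (g : ι → G) (l m : List ι) :
    wprod g (l ++ m) = wprod g l * wprod g m := by simp [wprod]

theorem map_wprod {H : Type*} [Group H] (f : G →* H) (g : ι → G) (l : List ι) :
    f (wprod g l) = wprod (fun i => f (g i)) l := by
  induction l with
  | nil => simp
  | cons i l ih => simp [ih]

theorem inv_of_mul_self {x : G} (h : x * x = 1) : x⁻¹ = x := inv_eq_of_mul_eq_one_left h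

theorem wprod_reverse {g : ι → G} (hg : ∀ i, g i * g i = 1) (l : List ι) :
    wprod g l.reverse = (wprod g l)⁻¹ := by
  induction l with
  | nil => simp
  | cons i l ih => simp [wprod_append, ih, inv_of_mul_self (hg i)]

theorem exists_reduced_of_word {g : ι → G} (hg : ∀ i, g i * g i = 1) (l : List ι) :
    ∃ m : List ι, m.IsChain (· ≠ ·) ∧ wprod g l = wprod g m := by
  classical
  induction l with
  | nil => exact ⟨[], by simp, rfl⟩
  | cons i l ih =>
    obtain ⟨m, hm, h⟩ := ih
    cases m with
    | nil => exact ⟨[i], by simp, by simp [h]⟩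
    | cons j m =>
      by_cases hij : i = j
      · subst hij
        refine ⟨m, (List.isChain_cons.1 hm).2, ?_⟩
        rw [wprod_cons, h, wprod_cons, ← mul_assoc, hg, one_mul]
      · exact ⟨i :: j :: m, List.isChain_cons_cons.2 ⟨hij, hm⟩, by simp [h]⟩

theorem exists_reduced {g : ι → G} (hg : ∀ i, g i * g i = 1) {x : G}
    (hx : x ∈ Subgroup.closure (Set.range g)) :
    ∃ m : List ι, m.IsChain (· ≠ ·) ∧ x = wprod g m := by
  suffices ∃ l : List ι, x = wprod g l by
    obtain ⟨l, rfl⟩ := this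
    exact exists_reduced_of_word hg l
  induction hx using Subgroup.closure_induction with
  | mem x hx => obtain ⟨i, rfl⟩ := hx; exact ⟨[i], by simp⟩
  | one => exact ⟨[], rfl⟩
  | mul x y _ _ hx hy =>
    obtain ⟨l, rfl⟩ := hx
    obtain ⟨m, rfl⟩ := hy
    exact ⟨l ++ m, (wprod_append _ _ _).symm⟩
  | inv x _ hx =>
    obtain ⟨l, rfl⟩ := hx
    exact ⟨l.reverse, (wprod_reverse hg l).symm⟩

theorem getLast_cons_concat {ι : Type*} (i k : ι) (l : List ι) :
    (i :: (l ++ [k])).getLast? = some k :=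
  List.getLast?_concat (l := i :: l)

/-- A reduced word is cyclically reduced if its last letter is not its first one. -/
def CycRed (l : List ι) : Prop :=
  l.IsChain (· ≠ ·) ∧ ∀ a ∈ l.getLast?, ∀ b ∈ l.head?, a ≠ b

/-- Equal first and last letters are stripped off by conjugation. A single letter is its own first
and last letter, so it is not `CycRed` and needs a separate case; the empty word is `CycRed`
vacuously. -/
theorem exists_cycRed {g : ι → G} (hg : ∀ i, g i * g i = 1) (l : List ι)
    (hl : l.IsChain (· ≠ ·)) :
    ∃ (u : G) (c : List ι), (CycRed c ∨ ∃ i, c = [i]) ∧ wprod g l = u * wprod g c * u⁻¹ := by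
  classical
  induction hn : l.length using Nat.strong_induction_on generalizing l with
  | _ n ih =>
    cases l with
    | nil => exact ⟨1, [], Or.inl ⟨by simp, by simp⟩, by simp⟩
    | cons i m =>
      rcases List.eq_nil_or_concat m with rfl | ⟨m', k, rfl⟩
      · exact ⟨1, [i], Or.inr ⟨i, rfl⟩, by simp⟩
      · by_cases hik : k = i
        · subst hik
          have h1 : m'.IsChain (· ≠ ·) := by
            have := (List.isChain_cons.1 hl).2
            rw [List.concat_eq_append] at this
            exact (List.isChain_append.1 this).1
          obtain ⟨u, c, hc, h⟩ := ih m'.length (by simp at hn; omega) m' h1 rfl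
          refine ⟨g k * u, c, hc, ?_⟩
          simp only [List.concat_eq_append, wprod_cons, wprod_append, h, mul_inv_rev, wprod_nil, inv_of_mul_self (hg k)]
          group
        · refine ⟨1, _, Or.inl ⟨hl, ?_⟩, by simp⟩
          simpa [getLast_cons_concat] using hik

theorem CycRed.rotate {i : ι} {l : List ι} (h : CycRed (i :: l)) : CycRed (l ++ [i]) := by
  obtain ⟨h1, h2⟩ := h
  rw [List.isChain_cons] at h1
  rcases List.eq_nil_or_concat l with rfl | ⟨l', k, rfl⟩
  · simp at h2
  · refine ⟨List.isChain_append.2 ⟨h1.2, by simp, ?_⟩, ?_⟩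
    · simpa [getLast_cons_concat] using h2
    · intro a ha b hb
      have : a = i := by simpa using ha.symm
      subst this
      apply h1.1
      cases l' <;> simpa using hb

end Words

/-! ### Ping-pong -/

section PingPong

variable {G ι X : Type*} [Group G] [MulAction G X] {g : ι → G} {D E : ι → Set X}

/-- The last letter sends `x` into its own `D`, which lies in the `E` of the letter before it, and
so on to the front of the word. Only the last letter restricts `x`. -/
theorem ping_pong (hE : ∀ i, ∀ x ∈ E i, g i • x ∈ D i) (hD : ∀ i j, i ≠ j → D j ⊆ E i)
    (l : List ι) : ∀ (i : ι) (x : X), (i :: l).IsChain (· ≠ ·) →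
      (∀ k ∈ (i :: l).getLast?, x ∈ E k) → wprod g (i :: l) • x ∈ D i := by
  induction l with
  | nil => intro i x _ hx; simpa using hE i x (hx i (by simp))
  | cons j l ih =>
    intro i x hl hx
    rw [List.isChain_cons_cons] at hl
    rw [wprod_cons, mul_smul]
    apply hE
    apply hD i j hl.1
    exact ih j x hl.2 (by simpa using hx)

theorem ping_pong_closure (hg : ∀ i, g i * g i = 1) (hE : ∀ i, ∀ x ∈ E i, g i • x ∈ D i)
    (hD : ∀ i j, i ≠ j → D j ⊆ E i) {z : X} (hz : ∀ i, z ∈ E i) {x : G}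
    (hx : x ∈ Subgroup.closure (Set.range g)) (h1 : x ≠ 1) : ∃ i, x • z ∈ D i := by
  obtain ⟨l, hl, rfl⟩ := exists_reduced hg hx
  cases l with
  | nil => simp at h1
  | cons i l => exact ⟨i, ping_pong hE hD l i z hl fun k _ => hz k⟩

/-- Four of the involutions conjugate to the given ones generate a group without another one. -/
theorem not_mem_closure_conj {h : Fin 3 → G} {D E : Fin 3 → Set X} (hh : ∀ i, h i * h i = 1)
    (hE : ∀ i, ∀ x ∈ E i, h i • x ∈ D i) (hD : ∀ i j, i ≠ j → D j ⊆ E i)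
    (hDE : ∀ i, ∀ x ∈ D i, x ∉ E i) {z : X} (hz : ∀ i, z ∈ E i) {a n b : Fin 3}
    (han : a ≠ n) (hab : a ≠ b) (hnb : n ≠ b) {l : List (Fin 3)} (hl : l.IsChain (· ≠ ·))
    (hhead : l.head? = some b) (hlast : l.getLast? = some a) :
    h b ∉ Subgroup.closure
      {h a, h n, wprod h l * h b * (wprod h l)⁻¹, wprod h l * h n * (wprod h l)⁻¹} := by
  intro hmem
  obtain ⟨l', rfl⟩ : ∃ l', l = b :: l' := by
    cases l with
    | nil => simp at hhead
    | cons c l' => simp at hhead; exact ⟨l', by rw [hhead]⟩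
  obtain ⟨m, rfl⟩ : ∃ m, l' = m ++ [a] := by
    rcases List.eq_nil_or_concat l' with rfl | ⟨m, k, rfl⟩
    · simp at hlast; exact absurd hlast.symm hab
    · rw [List.concat_eq_append] at *
      have : k = a := by simpa [getLast_cons_concat] using hlast
      exact ⟨m, by rw [this]⟩
  set w := wprod h (b :: (m ++ [a])) with hw
  -- Since `w` begins with `b` and ends with `a`, it carries the exterior `E a`, with the discs of
  -- `b` and `n` in it, into `D b`.
  have fwd : ∀ x ∈ E a, w • x ∈ D b := fun x hx =>
    ping_pong hE hD _ _ _ hl (by simpa [getLast_cons_concat] using hx)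
  have hchain : (a :: m.reverse ++ [b]).IsChain (· ≠ ·) := by
    have : (b :: (m ++ [a])).reverse.IsChain (· ≠ ·) := by
      rw [List.isChain_reverse]
      exact hl.imp fun _ _ h => h.symm
    simpa using this
  have hinv : w⁻¹ = wprod h (a :: (m.reverse ++ [b])) := by
    rw [hw, ← wprod_reverse hh]; simp
  have bwd : ∀ x ∈ E b, w⁻¹ • x ∈ D a := fun x hx => by
    rw [hinv]
    exact ping_pong hE hD _ _ _ (by simpa using hchain)
      (by simpa [getLast_cons_concat] using hx)
  -- The final letter `b` of `w⁻¹` cancels against `h b`; what is left is a reduced word beginning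
  -- with `a`.
  have bz : w⁻¹ • h b • z ∈ D a := by
    have : w⁻¹ * h b = wprod h (a :: m.reverse) := by
      rw [hinv, ← List.cons_append, wprod_append]
      simp [mul_assoc, hh]
    rw [← mul_smul, this]
    apply ping_pong hE hD
    · exact (List.isChain_append.1 hchain).1
    · intro k _; exact hz k
  have hbz : h b • z ∈ D b := hE b z (hz b)
  -- The four involutions play ping-pong with `D a`, `D n` and the translates `w D b`, `w D n`, both
  -- of which lie inside `D b`.
  let D4 : Fin 4 → Set X := ![D a, D n, {x | w⁻¹ • x ∈ D b}, {x | w⁻¹ • x ∈ D n}]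
  let E4 : Fin 4 → Set X := ![E a, E n, {x | w⁻¹ • x ∈ E b}, {x | w⁻¹ • x ∈ E n}]
  let g4 : Fin 4 → G := ![h a, h n, w * h b * w⁻¹, w * h n * w⁻¹]
  have hr : Set.range g4 = {h a, h n, w * h b * w⁻¹, w * h n * w⁻¹} := by
    ext x
    simp only [Set.mem_range, Fin.exists_fin_succ, g4, Set.mem_insert_iff, Set.mem_singleton_iff]
    simp [eq_comm]
  -- The base point is `h b • z`, not `z`: were `h b` in the group, it would move this point to `z`,
  -- so `z` would lie in one of the four discs, and it lies in none of them.
  have key := ping_pong_closure (g := g4) (D := D4) (E := E4) (z := h b • z) (x := h b) ?_ ?_ ?_ ?_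
    (by rw [hr]; exact hmem) ?_
  · have hzz : h b • h b • z = z := by rw [← mul_smul, hh, one_smul]
    obtain ⟨i, hi⟩ := key
    rw [hzz] at hi
    have fw : ∀ c, c ≠ a → w⁻¹ • z ∈ D c → False := fun c hc hx =>
      hDE b z (by simpa using fwd _ (hD a c hc.symm hx)) (hz b)
    fin_cases i
    · exact hDE a z hi (hz a)
    · exact hDE n z hi (hz n)
    · exact fw b hab.symm hi
    · exact fw n han.symm hi
  · intro i
    fin_cases i
    · exact hh a
    · exact hh n
    · show w * h b * w⁻¹ * (w * h b * w⁻¹) = 1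
      have := hh b
      rw [show w * h b * w⁻¹ * (w * h b * w⁻¹) = w * (h b * h b) * w⁻¹ by group, this]; group
    · show w * h n * w⁻¹ * (w * h n * w⁻¹) = 1
      have := hh n
      rw [show w * h n * w⁻¹ * (w * h n * w⁻¹) = w * (h n * h n) * w⁻¹ by group, this]; group
  · intro i
    fin_cases i
    · exact hE a
    · exact hE n
    · intro x hx
      show w⁻¹ • (w * h b * w⁻¹) • x ∈ D b
      rw [← mul_smul, show w⁻¹ * (w * h b * w⁻¹) = h b * w⁻¹ by group, mul_smul]
      exact hE b _ hx
    · intro x hx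
      show w⁻¹ • (w * h n * w⁻¹) • x ∈ D n
      rw [← mul_smul, show w⁻¹ * (w * h n * w⁻¹) = h n * w⁻¹ by group, mul_smul]
      exact hE n _ hx
  · have fw : ∀ c, c ≠ a → ∀ d, d ≠ b → {x | w⁻¹ • x ∈ D c} ⊆ E d := fun c hc d hd x hx => by
      apply hD d b hd
      simpa using fwd _ (hD a c hc.symm hx)
    have bw : ∀ c, c ≠ b → ∀ d, d ≠ a → D c ⊆ {x | w⁻¹ • x ∈ E d} := fun c hc d hd x hx =>
      hD d a hd (bwd x (hD b c hc.symm hx))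
    intro i j hij
    fin_cases i <;> fin_cases j
    · exact absurd rfl hij
    · exact hD a n han
    · exact fw b hab.symm a hab
    · exact fw n han.symm a hab
    · exact hD n a han.symm
    · exact absurd rfl hij
    · exact fw b hab.symm n hnb
    · exact fw n han.symm n hnb
    · exact bw a hab b hab.symm
    · exact bw n hnb b hab.symm
    · exact absurd rfl hij
    · exact fun x hx => hD b n hnb.symm hx
    · exact bw a hab n han.symm
    · exact bw n hnb n han.symm
    · exact fun x hx => hD n b hnb hx
    · exact absurd rfl hij
  · intro i
    fin_cases i
    · exact hD a b hab hbz
    · exact hD n b hnb hbz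
    · exact hD b a hab.symm bz
    · exact hD n a han.symm bz
  · intro h1
    rw [h1, one_smul] at hbz
    exact hDE b z hbz (hz b)

end PingPong

/-! ### The free product of three groups of order two -/

/-- The free product of three groups of order two. -/
def W : Type := PresentedGroup (Set.range fun i : Fin 3 => FreeGroup.of i * FreeGroup.of i)

instance : Group W := inferInstanceAs (Group (PresentedGroup _))

namespace W

/-- The three generating involutions. -/
def s (i : Fin 3) : W := PresentedGroup.of i

theorem s_mul_s (i : Fin 3) : s i * s i = 1 :=
  PresentedGroup.one_of_mem (rels := Set.range fun i : Fin 3 => FreeGroup.of i * FreeGroup.of i)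
    ⟨i, rfl⟩

section lift

variable {G : Type*} [Group G] (h : Fin 3 → G) (hh : ∀ i, h i * h i = 1)

/-- The homomorphism with given images of the generators. -/
def lift : W →* G :=
  PresentedGroup.toGroup (f := h) (rels := Set.range fun i : Fin 3 => FreeGroup.of i * FreeGroup.of i)
    (by rintro _ ⟨i, rfl⟩; simpa using hh i)

@[simp] theorem lift_s (i : Fin 3) : lift h hh (s i) = h i := PresentedGroup.toGroup.of _

theorem lift_wprod (l : List (Fin 3)) : lift h hh (wprod s l) = wprod h l := by
  rw [map_wprod]; simp

end lift

theorem closure_range_s : Subgroup.closure (Set.range s) = ⊤ := PresentedGroup.closure_range_of _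

theorem exists_word (w : W) : ∃ l : List (Fin 3), l.IsChain (· ≠ ·) ∧ w = wprod s l :=
  exists_reduced s_mul_s (by rw [closure_range_s]; trivial)

/-- The subgroup of words of even length. -/
def even : Subgroup W := Subgroup.closure {s 0 * s 1, s 2 * s 1}

theorem s_inv (i : Fin 3) : (s i)⁻¹ = s i := inv_of_mul_self (s_mul_s i)

theorem s_mul_s_mem (i j : Fin 3) : s i * s j ∈ even := by
  have h1 : ∀ i, s i * s 1 ∈ even := by
    intro i
    fin_cases i
    · exact Subgroup.subset_closure (by simp)
    · show s 1 * s 1 ∈ even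
      rw [s_mul_s]; exact one_mem _
    · exact Subgroup.subset_closure (by simp)
  have := mul_mem (h1 i) (inv_mem (h1 j))
  simpa [mul_inv_rev, s_inv, mul_assoc, ← mul_assoc (s 1) (s 1), s_mul_s] using this

theorem conj_mem_even (w : W) {x : W} (hx : x ∈ even) : w * x * w⁻¹ ∈ even := by
  have h1 : ∀ i, ∀ x ∈ even, s i * x * (s i)⁻¹ ∈ even := by
    intro i x hx
    have : even ≤ even.comap (MulAut.conj (s i)).toMonoidHom := by
      rw [even, Subgroup.closure_le]
      have : ∀ a b, s a * s b ∈ even.comap (MulAut.conj (s i)).toMonoidHom := by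
        intro a b
        have := mul_mem (s_mul_s_mem i a) (s_mul_s_mem b i)
        simpa [s_inv, mul_assoc] using this
      rintro _ (rfl | rfl)
      · exact this _ _
      · exact this _ _
    exact this hx
  obtain ⟨l, -, rfl⟩ := exists_word w
  induction l with
  | nil => simpa using hx
  | cons i l ih =>
    have := h1 i _ ih
    simpa [mul_assoc] using this

end W

end TwoParabolic
end

noncomputable section

namespace TwoParabolic

namespace W

/-! ### Parity of letters -/

/-- The homomorphism to the group of order two counting letters with weights. -/
def weight (f : Fin 3 → ZMod 2) : W →* Multiplicative (ZMod 2) :=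
  lift (fun i => Multiplicative.ofAdd (f i)) fun i => by
    rw [← ofAdd_add, CharTwo.add_self_eq_zero, ofAdd_zero]

@[simp] theorem weight_s (f : Fin 3 → ZMod 2) (i : Fin 3) :
    weight f (s i) = Multiplicative.ofAdd (f i) := lift_s _ _ i

/-- A weight which is trivial on two generators of `even` is trivial on every `s i * s j`. This is
the obstruction used below: a nonconstant weight cannot vanish on a generating pair. -/
theorem weight_const_of_closure {f : Fin 3 → ZMod 2} {x y : W}
    (hxy : Subgroup.closure {x, y} = even) (hx : weight f x = 1) (hy : weight f y = 1)
    (i j : Fin 3) : f i = f j := by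
  have h1 : even ≤ (weight f).ker := by
    rw [← hxy, Subgroup.closure_le]
    rintro _ (rfl | rfl)
    · exact hx
    · exact hy
  have h2 := h1 (s_mul_s_mem i j)
  rw [MonoidHom.mem_ker, map_mul, weight_s, weight_s, ← ofAdd_add, ofAdd_eq_one] at h2
  exact CharTwo.add_eq_zero.1 h2

theorem weight_one_of_mem_even {x : W} (hx : x ∈ even) : weight (fun _ => 1) x = 1 := by
  have h1 : even ≤ (weight fun _ => 1).ker := by
    rw [even, Subgroup.closure_le]
    rintro _ (rfl | rfl) <;>
    · rw [SetLike.mem_coe, MonoidHom.mem_ker, map_mul, weight_s, weight_s, ← ofAdd_add]; rfl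
  exact h1 hx

theorem s_mul_zpow (i j : Fin 3) (m : ℤ) : s i * (s i * s j) ^ m = (s i * s j) ^ (-m) * s i := by
  have h : s i * (s i * s j) * (s i)⁻¹ = (s i * s j)⁻¹ := by
    rw [mul_inv_rev, s_inv, s_inv, ← mul_assoc, s_mul_s, one_mul]
  have := conj_zpow (i := m) (a := s i) (b := s i * s j)
  rw [h, inv_zpow, ← zpow_neg] at this
  rw [this]; simp [mul_assoc]

/-- The two letters generate a dihedral group, whose elements are rotations `(s i * s j) ^ m` or
reflections; the parity of the length tells which. -/
theorem wprod_two_letters {i j : Fin 3} (l : List (Fin 3)) (hl : ∀ x ∈ l, x = i ∨ x = j) :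
    ∃ m : ℤ, (wprod s l = (s i * s j) ^ m ∧ weight (fun _ => 1) (wprod s l) = 1) ∨
      (wprod s l = (s i * s j) ^ m * s i ∧ weight (fun _ => 1) (wprod s l) ≠ 1) := by
  have hw : Multiplicative.ofAdd (1 : ZMod 2) ≠ 1 := by decide
  have hz : weight (fun _ => 1) (s i * s j) = 1 := weight_one_of_mem_even (s_mul_s_mem i j)
  suffices ∃ m : ℤ, wprod s l = (s i * s j) ^ m ∨ wprod s l = (s i * s j) ^ m * s i by
    obtain ⟨m, h | h⟩ := this
    · exact ⟨m, Or.inl ⟨h, by rw [h, map_zpow, hz, one_zpow]⟩⟩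
    · exact ⟨m, Or.inr ⟨h, by rw [h, map_mul, map_zpow, hz, one_zpow, one_mul, weight_s]; exact hw⟩⟩
  induction l with
  | nil => exact ⟨0, Or.inl (by simp)⟩
  | cons x l ih =>
    obtain ⟨m, h⟩ := ih fun y hy => hl y (List.mem_cons_of_mem _ hy)
    have key : ∃ k : ℤ, s x * (s i * s j) ^ m = (s i * s j) ^ k * s i := by
      rcases hl x (by simp) with rfl | rfl
      · exact ⟨-m, s_mul_zpow _ _ _⟩
      · refine ⟨-(1 + m), ?_⟩
        rw [← s_mul_zpow, zpow_add, zpow_one]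
        simp only [← mul_assoc, s_mul_s, one_mul]
    obtain ⟨k, hk⟩ := key
    rcases h with h | h
    · exact ⟨k, Or.inr (by rw [wprod_cons, h, hk])⟩
    · refine ⟨k, Or.inl ?_⟩
      rw [wprod_cons, h, ← mul_assoc, hk, mul_assoc, s_mul_s, mul_one]

/-! ### Pairs of conjugates of powers which generate the even subgroup -/

/-- Identifying `s b` with `s n` maps `W` onto the infinite dihedral group (`DihedralGroup 0`).
There `y` becomes trivial and `x` a rotation by `±m`, while the image of `even` contains the
rotation by `-1`; so `m` divides `1`. -/
theorem exponent_eq {a n b : Fin 3} (han : a ≠ n) (hab : a ≠ b) {x y u v : W} {m k : ℤ}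
    (hx : x = u * (s a * s n) ^ m * u⁻¹) (hy : y = v * (s b * s n) ^ k * v⁻¹)
    (hxy : Subgroup.closure {x, y} = even) : m = 1 ∨ m = -1 := by
  let f : Fin 3 → DihedralGroup 0 := fun i => DihedralGroup.sr (if i = a then 1 else 0)
  let δ : W →* DihedralGroup 0 := lift f fun i => by simp [f]
  have ha : δ (s a * s n) = DihedralGroup.r (-1) := by
    simp [δ, f, han.symm]
  have hb : δ (s b * s n) = 1 := by
    simp [δ, f, han.symm, hab.symm]
  have hpow : ∀ k : ℤ, ((DihedralGroup.r (-1) : DihedralGroup 0)) ^ k =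
      DihedralGroup.r (-(Int.cast k : ZMod 0)) := by
    intro k
    rw [DihedralGroup.r_zpow]; simp
  have hdx : ∃ e : ℤ, (e = m ∨ e = -m) ∧ δ x = DihedralGroup.r (Int.cast e : ZMod 0) := by
    rw [hx, map_mul, map_mul, map_zpow, ha, map_inv, hpow]
    rcases δ u with c | c
    · refine ⟨-m, Or.inr rfl, ?_⟩
      simp only [DihedralGroup.inv_r, DihedralGroup.r_mul_r]
      congr 1; push_cast; ring
    · refine ⟨m, Or.inl rfl, ?_⟩
      simp only [DihedralGroup.inv_sr, DihedralGroup.sr_mul_r, DihedralGroup.sr_mul_sr]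
      congr 1; ring
  obtain ⟨e, he, hdx⟩ := hdx
  have hdy : δ y = 1 := by
    rw [hy, map_mul, map_mul, map_zpow, hb, map_inv]; simp
  have h1 : even ≤ (Subgroup.zpowers (DihedralGroup.r (Int.cast e : ZMod 0))).comap δ := by
    rw [← hxy, Subgroup.closure_le, Set.pair_subset_iff]
    constructor
    · rw [SetLike.mem_coe, Subgroup.mem_comap]
      rw [hdx]; exact Subgroup.mem_zpowers _
    · rw [SetLike.mem_coe, Subgroup.mem_comap]
      rw [hdy]; exact one_mem _
  have h2 : δ (s a * s n) ∈ Subgroup.zpowers (DihedralGroup.r (Int.cast e : ZMod 0)) :=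
    h1 (s_mul_s_mem a n)
  rw [ha, Subgroup.mem_zpowers_iff] at h2
  obtain ⟨j, hj⟩ := h2
  rw [DihedralGroup.r_zpow] at hj
  have h3 : e * j = -1 := by
    have := DihedralGroup.r.inj hj
    have h4 : (Int.cast (e * j) : ZMod 0) = Int.cast (-1) := by push_cast; exact this
    exact Int.cast_injective h4
  have h4 : m ∣ 1 := by
    rcases he with rfl | rfl
    · exact ⟨-j, by linarith⟩
    · exact ⟨j, by linarith⟩
  exact Int.isUnit_iff.1 (isUnit_of_dvd_one h4)

/-- Conjugation by `α` maps `z` to itself or to its inverse. -/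
def Preserves (z α : W) : Prop := α * z * α⁻¹ = z ∨ α * z * α⁻¹ = z⁻¹

theorem Preserves.mul {z α β : W} (hα : Preserves z α) (hβ : Preserves z β) :
    Preserves z (α * β) := by
  have h : α * β * z * (α * β)⁻¹ = α * (β * z * β⁻¹) * α⁻¹ := by group
  unfold Preserves
  rw [h]
  rcases hβ with hβ | hβ
  · rw [hβ]; exact hα
  · rw [hβ, show α * z⁻¹ * α⁻¹ = (α * z * α⁻¹)⁻¹ by group]
    rcases hα with hα | hα
    · rw [hα]; simp
    · rw [hα]; simp

theorem Preserves.conj {z α : W} (hα : Preserves z α) {w : W} (hw : w = z ∨ w = z⁻¹) :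
    α * w * α⁻¹ = z ∨ α * w * α⁻¹ = z⁻¹ := by
  rcases hw with rfl | rfl
  · exact hα
  · rw [show α * z⁻¹ * α⁻¹ = (α * z * α⁻¹)⁻¹ by group]
    rcases hα with hα | hα
    · rw [hα]; simp
    · rw [hα]; simp

theorem Preserves.inv {z α : W} (hα : Preserves z α) : Preserves z α⁻¹ := by
  rcases hα with h | h
  · left
    have : α⁻¹ * (α * z * α⁻¹) * α⁻¹⁻¹ = z := by group
    rwa [h] at this
  · right
    have : α⁻¹ * (α * z * α⁻¹)⁻¹ * α⁻¹⁻¹ = z⁻¹ := by group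
    rwa [h, inv_inv] at this

theorem preserves_left (i j : Fin 3) : Preserves (s i * s j) (s i) := by
  right
  rw [mul_inv_rev, s_inv, s_inv, ← mul_assoc, s_mul_s, one_mul]

theorem preserves_right (i j : Fin 3) : Preserves (s i * s j) (s j) := by
  right
  rw [mul_inv_rev, s_inv, s_inv, mul_assoc, mul_assoc, s_mul_s, mul_one]

theorem preserves_one (z : W) : Preserves z 1 := by left; simp

theorem fin_three {a n b : Fin 3} (han : a ≠ n) (hab : a ≠ b) (hnb : n ≠ b) (i : Fin 3) :
    i = a ∨ i = n ∨ i = b := by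
  revert a n b i; decide

/-- Letters `a`, `n` at the front normalise `⟨s a * s n⟩` and go into `α`; letters `b`, `n` at the
end normalise `⟨s b * s n⟩` and go into `β`. A word from which nothing more can be removed is empty
or runs from `b` to `a`. -/
theorem exists_double_coset {a n b : Fin 3} (han : a ≠ n) (hab : a ≠ b) (hnb : n ≠ b)
    (l : List (Fin 3)) (hl : l.IsChain (· ≠ ·)) :
    ∃ (α β : W) (m : List (Fin 3)), Preserves (s a * s n) α ∧ Preserves (s b * s n) β ∧
      wprod s l = α * wprod s m * β ∧ m.IsChain (· ≠ ·) ∧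
      (m = [] ∨ (m.head? = some b ∧ m.getLast? = some a)) := by
  induction hlen : l.length using Nat.strong_induction_on generalizing l with
  | _ N ih =>
    cases l with
    | nil => exact ⟨1, 1, [], preserves_one _, preserves_one _, by simp, by simp, Or.inl rfl⟩
    | cons i l =>
      by_cases hib : i = b
      · subst hib
        obtain ⟨l', k, hk⟩ : ∃ l' k, i :: l = l' ++ [k] := by
          rcases List.eq_nil_or_concat (i :: l) with h | ⟨l', k, h⟩
          · simp at h
          · exact ⟨l', k, by rw [h, List.concat_eq_append]⟩
        by_cases hka : k = a
        · refine ⟨1, 1, i :: l, preserves_one _, preserves_one _, by simp, hl, Or.inr ⟨rfl, ?_⟩⟩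
          rw [hk, hka]; simp
        · rw [hk] at hl hlen
          obtain ⟨α, β, m, hα, hβ, h, hm, hm'⟩ :=
            ih l'.length (by simp at hlen; omega) l' (List.isChain_append.1 hl).1 rfl
          refine ⟨α, β * s k, m, hα, hβ.mul ?_, ?_, hm, hm'⟩
          · rcases fin_three han hab hnb k with rfl | rfl | rfl
            · exact absurd rfl hka
            · exact preserves_right _ _
            · exact preserves_left _ _
          · rw [hk, wprod_append, h]; simp [mul_assoc]
      · obtain ⟨α, β, m, hα, hβ, h, hm, hm'⟩ :=
          ih l.length (by simp at hlen; omega) l (List.isChain_cons.1 hl).2 rfl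
        refine ⟨s i * α, β, m, Preserves.mul ?_ hα, hβ, ?_, hm, hm'⟩
        · rcases fin_three han hab hnb i with rfl | rfl | rfl
          · exact preserves_left _ _
          · exact preserves_right _ _
          · exact absurd rfl hib
        · rw [wprod_cons, h]; simp [mul_assoc]

/-- Only the double coset of `u⁻¹ * v` matters. If its reduced representative `w` is empty, one
element conjugates both generators into place. Otherwise, after conjugation, `x` and `y` lie in the
group generated by `s a`, `s n` and the conjugates by `w` of `s b`, `s n`; this group then contains
`even`, hence `s b * s n` and `s b`, against `hnot`. -/
theorem exists_simultaneous_conj {a n b : Fin 3} (han : a ≠ n) (hab : a ≠ b) (hnb : n ≠ b)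
    (hnot : ∀ l : List (Fin 3), l.IsChain (· ≠ ·) → l.head? = some b → l.getLast? = some a →
      s b ∉ Subgroup.closure
        {s a, s n, wprod s l * s b * (wprod s l)⁻¹, wprod s l * s n * (wprod s l)⁻¹})
    {x y u v : W} {m k : ℤ} (hx : x = u * (s a * s n) ^ m * u⁻¹)
    (hy : y = v * (s b * s n) ^ k * v⁻¹) (hxy : Subgroup.closure {x, y} = even) :
    ∃ g : W, (x = g * (s a * s n) * g⁻¹ ∨ x = g * (s a * s n)⁻¹ * g⁻¹) ∧
      (y = g * (s b * s n) * g⁻¹ ∨ y = g * (s b * s n)⁻¹ * g⁻¹) := by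
  have hm : (s a * s n) ^ m = s a * s n ∨ (s a * s n) ^ m = (s a * s n)⁻¹ := by
    rcases exponent_eq han hab hx hy hxy with rfl | rfl <;> simp
  have hk : (s b * s n) ^ k = s b * s n ∨ (s b * s n) ^ k = (s b * s n)⁻¹ := by
    rcases exponent_eq hnb.symm hab.symm hy hx (by rw [Set.pair_comm]; exact hxy) with rfl | rfl <;>
    simp
  obtain ⟨l, hl, huv⟩ := exists_word (u⁻¹ * v)
  obtain ⟨α, β, l', hα, hβ, h, hl', hcase⟩ := exists_double_coset han hab hnb l hl
  rw [← huv] at h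
  have hv : v = u * α * wprod s l' * β := by
    have : v = u * (u⁻¹ * v) := by group
    rw [this, h]; group
  have hα' := hα.inv.conj hm
  have hβ' := hβ.conj hk
  rw [inv_inv] at hα'
  have hx' : x = u * α * (α⁻¹ * (s a * s n) ^ m * α) * (u * α)⁻¹ := by rw [hx]; group
  have hy' : y = u * α * (wprod s l' * (β * (s b * s n) ^ k * β⁻¹) * (wprod s l')⁻¹) *
      (u * α)⁻¹ := by rw [hy, hv]; group
  rcases hcase with rfl | ⟨hb, ha⟩
  · refine ⟨u * α, ?_, ?_⟩
    · rw [hx']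
      rcases hα' with h | h <;> rw [h] <;> simp
    · rw [hy']
      rcases hβ' with h | h <;> rw [h] <;> simp
  · exfalso
    apply hnot l' hl' hb ha
    set w := wprod s l'
    set K := Subgroup.closure {s a, s n, w * s b * w⁻¹, w * s n * w⁻¹} with hK
    have ka : s a ∈ K := Subgroup.subset_closure (by simp)
    have kn : s n ∈ K := Subgroup.subset_closure (by simp)
    have kb' : w * s b * w⁻¹ ∈ K := Subgroup.subset_closure (by simp)
    have kn' : w * s n * w⁻¹ ∈ K := Subgroup.subset_closure (by simp)
    have h1 : even ≤ K.comap (MulAut.conj (u * α)⁻¹).toMonoidHom := by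
      rw [← hxy, Subgroup.closure_le]
      have e : ∀ r : W, (MulAut.conj (u * α)⁻¹).toMonoidHom (u * α * r * (u * α)⁻¹) = r := by
        intro r
        simp; group
      rintro _ (rfl | rfl)
      · show (MulAut.conj (u * α)⁻¹).toMonoidHom _ ∈ K
        rw [hx', e]
        rcases hα' with h | h <;> rw [h]
        · exact mul_mem ka kn
        · exact inv_mem (mul_mem ka kn)
      · show (MulAut.conj (u * α)⁻¹).toMonoidHom _ ∈ K
        rw [hy', e]
        have : w * (s b * s n) * w⁻¹ ∈ K := by
          have := mul_mem kb' kn'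
          rwa [show w * s b * w⁻¹ * (w * s n * w⁻¹) = w * (s b * s n) * w⁻¹ by group] at this
        rcases hβ' with h | h <;> rw [h]
        · exact this
        · have := inv_mem this
          rwa [show (w * (s b * s n) * w⁻¹)⁻¹ = w * (s b * s n)⁻¹ * w⁻¹ by group] at this
    -- Normality of `even` removes the conjugation by `u * α`.
    have h2 := h1 (conj_mem_even (u * α) (s_mul_s_mem b n))
    have h3 : s b * s n ∈ K := by
      have e : (MulAut.conj (u * α)⁻¹).toMonoidHom (u * α * (s b * s n) * (u * α)⁻¹) =
          s b * s n := by
        simp; group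
      rw [← e]; exact h2
    have := mul_mem h3 kn
    rwa [mul_assoc, s_mul_s, mul_one] at this

end W

end TwoParabolic
end

noncomputable section

namespace TwoParabolic

open Complex Matrix Filter Topology
open scoped ComplexConjugate

/-- The Gram determinant of two vectors is the determinant of the form times `|cross v w|²`; both
sides carry the sign of `disc`. -/
theorem HForm.gram (Q : HForm) (v w : Fin 2 → ℂ) :
    normSq (Q.pol v w) - Q.ev v * Q.ev w = Q.disc * normSq (cross v w) := by
  simp only [HForm.pol, HForm.ev, HForm.disc, cross, normSq_apply, mul_re, mul_im, sub_re, sub_im,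
    add_re, add_im, conj_re, conj_im, ofReal_re, ofReal_im]
  ring

/-! ### Parabolic transformations -/

theorem exists_cross_ne_zero {v : Fin 2 → ℂ} (hv : v ≠ 0) : ∃ r, cross v r ≠ 0 := by
  by_contra h
  push Not at h
  apply hv
  have h0 := h ![0, 1]
  have h1 := h ![1, 0]
  simp [cross] at h0 h1
  ext i; fin_cases i <;> simp [h0, h1]

theorem trace_sl (M : SL2C) : M.1.trace = M 0 0 + M 1 1 := Matrix.trace_fin_two _

/-- Cayley–Hamilton: trace 2 and determinant 1 give `(M - 1)² = 0`. -/
theorem mulVec_mulVec_of_trace_two {M : SL2C} (h : M.1.trace = 2) (v : Fin 2 → ℂ) :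
    M.1 *ᵥ (M.1 *ᵥ v - v) = M.1 *ᵥ v - v := by
  have hd := sl_det M
  rw [trace_sl] at h
  have h1 : M 1 1 = 2 - M 0 0 := by linear_combination h
  rw [h1] at hd
  rw [Matrix.mulVec_sub]
  ext i
  fin_cases i
  · simp [h1]
    linear_combination (-v 0) * hd
  · simp [h1]
    linear_combination (-v 1) * hd

theorem pow_mulVec_of_trace_two {M : SL2C} (h : M.1.trace = 2) (v : Fin 2 → ℂ) (n : ℕ) :
    (M ^ n).1 *ᵥ v = v + (n : ℂ) • (M.1 *ᵥ v - v) := by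
  induction n with
  | zero => simp
  | succ n ih =>
    rw [pow_succ', mul_mulVec, ih, Matrix.mulVec_add, Matrix.mulVec_smul,
      mulVec_mulVec_of_trace_two h]
    push_cast
    rw [add_smul, one_smul]
    abel

theorem eq_one_of_fix {M : SL2C} {u v : Fin 2 → ℂ} (hu : M.1 *ᵥ u = u) (hv : M.1 *ᵥ v = v)
    (h : cross u v ≠ 0) : M = 1 := by
  have : ∀ w, M.1 *ᵥ w = w := by
    intro w
    obtain ⟨x, y, rfl⟩ := exists_comb h w
    rw [Matrix.mulVec_add, Matrix.mulVec_smul, Matrix.mulVec_smul, hu, hv]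
  have h0 := this ![1, 0]
  have h1 := this ![0, 1]
  ext i j
  have a0 := congrFun h0 i
  have a1 := congrFun h1 i
  fin_cases i <;> fin_cases j <;>
    simp [Matrix.mulVec, dotProduct, Fin.sum_univ_two] at a0 a1 ⊢ <;> assumption

theorem fix_of_eigen {M : SL2C} (h : M.1.trace = 2) {v : Fin 2 → ℂ} (hv : v ≠ 0) {c : ℂ}
    (hc : M.1 *ᵥ v = c • v) : M.1 *ᵥ v = v := by
  have h1 := mulVec_mulVec_of_trace_two h v
  rw [hc] at h1 ⊢
  have h2 : c • v - v = (c - 1) • v := by rw [sub_smul, one_smul]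
  rw [h2, Matrix.mulVec_smul, hc, smul_smul] at h1
  have h3 : ((c - 1) * (c - 1)) • v = 0 := by
    rw [mul_sub, sub_smul, h1, mul_one, sub_self]
  have h4 : c - 1 = 0 := by simpa [hv] using h3
  rw [sub_eq_zero.1 h4, one_smul]

/-- `g` is parabolic with fixed point `p`. -/
def IsParab (g : PSL2C) (p : Sphere) : Prop :=
  ∃ M : SL2C, toPSL M = g ∧ M.1.trace = 2 ∧ M ≠ 1 ∧ g • p = p

theorem trace_conj (M g : SL2C) : (g * M * g⁻¹).1.trace = M.1.trace := by
  rw [Matrix.SpecialLinearGroup.coe_mul, Matrix.trace_mul_comm,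
    ← Matrix.SpecialLinearGroup.coe_mul]
  rw [inv_mul_cancel_left]

theorem trace_inv (M : SL2C) : (M⁻¹).1.trace = M.1.trace := by
  rw [trace_sl, trace_sl, Matrix.SpecialLinearGroup.SL2_inv_expl]
  simp [add_comm]

theorem IsParab.conj {g : PSL2C} {p : Sphere} (h : IsParab g p) (k : PSL2C) :
    IsParab (k * g * k⁻¹) (k • p) := by
  obtain ⟨M, rfl, ht, h1, hp⟩ := h
  obtain ⟨K, rfl⟩ := toPSL_surjective k
  refine ⟨K * M * K⁻¹, by simp, by rw [trace_conj, ht], ?_, ?_⟩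
  · rwa [Ne, conj_eq_one_iff]
  · rw [mul_smul, mul_smul, inv_smul_smul, hp]

theorem IsParab.inv {g : PSL2C} {p : Sphere} (h : IsParab g p) : IsParab g⁻¹ p := by
  obtain ⟨M, rfl, ht, h1, hp⟩ := h
  refine ⟨M⁻¹, by simp, by rw [trace_inv, ht], by simpa using h1, ?_⟩
  rw [inv_smul_eq_iff, hp]

theorem IsParab.ne_one {g : PSL2C} {p : Sphere} (h : IsParab g p) : g ≠ 1 := by
  obtain ⟨M, rfl, ht, h1, hp⟩ := h
  intro h
  rcases (toPSL_eq_one_iff M).1 h with rfl | rfl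
  · exact h1 rfl
  · simp at ht; norm_num at ht

theorem IsParab.of_trace {M : SL2C} (ht : M.1.trace = 2) (h1 : M ≠ 1) :
    ∃ p, IsParab (toPSL M) p := by
  obtain ⟨v, hv⟩ : ∃ v, M.1 *ᵥ v - v ≠ 0 := by
    by_contra h
    push Not at h
    exact h1 (eq_one_of_fix (sub_eq_zero.1 (h ![1, 0])) (sub_eq_zero.1 (h ![0, 1]))
      (by simp [cross]))
  obtain ⟨p, c, hc, h⟩ := exists_point hv
  refine ⟨p, M, rfl, ht, h1, (smul_eq_iff _ _).2 ⟨1, ?_⟩⟩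
  have := mulVec_mulVec_of_trace_two ht v
  rw [h, Matrix.mulVec_smul] at this
  rw [one_smul]
  exact smul_right_injective _ hc this

/-! ### Systems of half-turns with disjoint discs -/

/-- Three half-turns, each of which interchanges the two sides of a circle, such that the
negative sides of the three circles are disjoint and the circles are disjoint or tangent. -/
structure HalfTurnSystem where
  H : Fin 3 → SL2C
  Q : Fin 3 → HForm
  sq : ∀ i, H i * H i = -1
  anti : ∀ i v, (Q i).ev ((H i).1 *ᵥ v) = -(Q i).ev v
  disc_pos : ∀ i, 0 < (Q i).disc
  iso : ∀ i, ∃ e f, cross e f ≠ 0 ∧ (Q i).ev e = 0 ∧ (Q i).ev f = 0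
  disj : ∀ i j, i ≠ j → ∀ v, (Q i).ev v < 0 → 0 < (Q j).ev v
  tang : ∀ i j, i ≠ j → ∀ v w, (Q i).ev v = 0 → (Q j).ev v = 0 → (Q i).ev w = 0 →
    (Q j).ev w = 0 → cross v w = 0

namespace HalfTurnSystem

variable (S : HalfTurnSystem)

/-- The half-turns as elements of `PSL(2, ℂ)`. -/
def h (i : Fin 3) : PSL2C := toPSL (S.H i)

theorem h_mul_h (i : Fin 3) : S.h i * S.h i = 1 := by
  rw [h, ← map_mul, S.sq, toPSL_eq_one_iff]; right; rfl

/-- The disc of the `i`-th circle. -/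
def D (i : Fin 3) : Set Sphere := {z | (S.Q i).at' z < 0}

/-- The open exterior of the `i`-th circle. -/
def E (i : Fin 3) : Set Sphere := {z | 0 < (S.Q i).at' z}

theorem at_h_smul (i : Fin 3) (z : Sphere) :
    ∃ r : ℝ, 0 < r ∧ -(S.Q i).at' z = r * (S.Q i).at' (S.h i • z) := by
  obtain ⟨r, hr, h⟩ := (S.Q i).at_smul (S.H i) z
  rw [S.anti] at h
  exact ⟨r, hr, h⟩

theorem h_smul_mem_D (i : Fin 3) : ∀ x ∈ S.E i, S.h i • x ∈ S.D i := by
  intro x hx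
  obtain ⟨r, hr, h⟩ := S.at_h_smul i x
  simp only [E, D, Set.mem_ofPred_eq] at *
  by_contra hc
  push Not at hc
  have := mul_nonneg hr.le hc
  linarith

theorem D_subset_E (i j : Fin 3) (hij : i ≠ j) : S.D j ⊆ S.E i := fun _ hx =>
  S.disj j i hij.symm _ hx

theorem notMem_E (i : Fin 3) : ∀ x ∈ S.D i, x ∉ S.E i := fun _ hx hx' =>
  lt_asymm (show (S.Q i).at' _ < 0 from hx) hx'

theorem nonneg_of_zero {i j : Fin 3} (hij : i ≠ j) {v : Fin 2 → ℂ} (hv : (S.Q i).ev v = 0) :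
    0 ≤ (S.Q j).ev v := by
  by_contra h
  push Not at h
  exact (S.disj j i hij.symm v h).ne' hv

/-- A point of the circle `0` which is on neither of the other circles is strictly outside their
discs, and it stays so when pushed slightly to the positive side of its own circle. -/
theorem exists_base : ∃ z : Sphere, ∀ i, z ∈ S.E i := by
  obtain ⟨e, f, hef, he, hf⟩ := S.iso 0
  set m := (S.Q 0).pol e f with hm
  have hm0 : m ≠ 0 := HForm.pol_ne_zero (S.disc_pos 0) hef he hf
  -- The factor `m` turns the mixed term into a positive multiple of `t`: the points with `t = 0`
  -- run along the circle, and `t > 0` is its outer side.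
  let u : ℝ → ℝ → Fin 2 → ℂ := fun s t => e + ((s * I + t) * m) • f
  have hu : ∀ s t, (S.Q 0).ev (u s t) = 2 * t * normSq m := by
    intro s t
    have := (S.Q 0).ev_comb 1 ((s * I + t) * m) e f
    rw [one_smul] at this
    simp only [u]
    rw [this, he, hf, ← hm]
    simp [normSq_apply]
    ring
  have hcross : ∀ s s', cross (u s 0) (u s' 0) = (s' - s) * I * m * cross e f := by
    intro s s'
    simp [cross, u]; ring
  have hfin : ∀ j : Fin 3, 0 ≠ j → {s : ℝ | (S.Q j).ev (u s 0) = 0}.Finite := by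
    intro j hj
    apply Set.Subsingleton.finite
    intro s hs s' hs'
    have := S.tang 0 j hj (u s 0) (u s' 0) (by rw [hu]; simp) hs (by rw [hu]; simp) hs'
    rw [hcross] at this
    simp [hm0, hef, sub_eq_zero] at this
    exact_mod_cast this.symm
  obtain ⟨s, hs⟩ := ((hfin 1 (by decide)).union (hfin 2 (by decide))).infinite_compl.nonempty
  simp only [Set.mem_compl_iff, Set.mem_union, Set.mem_ofPred_eq, not_or] at hs
  have hpos : ∀ j : Fin 3, 0 ≠ j → (S.Q j).ev (u s 0) ≠ 0 → ∀ᶠ t in 𝓝[>] (0 : ℝ),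
      0 < (S.Q j).ev (u s t) := by
    intro j hj h0
    have h1 : 0 < (S.Q j).ev (u s 0) :=
      lt_of_le_of_ne (S.nonneg_of_zero hj (by rw [hu]; simp)) (Ne.symm h0)
    have hc : Continuous fun t : ℝ => (S.Q j).ev (u s t) := by
      apply (S.Q j).continuous_ev.comp
      simp only [u]
      fun_prop
    exact nhdsWithin_le_nhds (hc.continuousAt.eventually (lt_mem_nhds h1))
  obtain ⟨t, h1, h2, ht⟩ := ((hpos 1 (by decide) hs.1).and ((hpos 2 (by decide) hs.2).and
    self_mem_nhdsWithin)).exists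
  have h0 : 0 < (S.Q 0).ev (u s t) := by
    rw [hu]
    have := normSq_pos.2 hm0
    have : (0 : ℝ) < t := ht
    positivity
  have hne : u s t ≠ 0 := by
    intro h; rw [h] at h0; simp [HForm.ev] at h0
  obtain ⟨z, c, hc, hz⟩ := exists_point hne
  refine ⟨z, fun i => ?_⟩
  have : ∀ j, 0 < (S.Q j).ev (u s t) → z ∈ S.E j := by
    intro j hj
    rw [hz, HForm.ev_smul] at hj
    exact pos_of_mul_pos_right hj (normSq_nonneg c)
  fin_cases i
  · exact this 0 h0
  · exact this 1 h1
  · exact this 2 h2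

/-- Near a common point the three forms are nonzero real linear functions to first order. In a
generic real direction two of them have the same sign, so one of the two senses makes both negative
and their discs overlap. -/
theorem no_triple_point {v : Fin 2 → ℂ} (hv : v ≠ 0) (h : ∀ i, (S.Q i).ev v = 0) : False := by
  obtain ⟨r, hr⟩ := exists_cross_ne_zero hv
  have hpol : ∀ i, (S.Q i).pol v r ≠ 0 := by
    intro i h0
    have := (S.Q i).gram v r
    rw [h0, h i] at this
    have h2 := mul_pos (S.disc_pos i) (normSq_pos.2 hr)
    rw [← this] at h2
    simp at h2
  -- Half the derivative at `v` of the `i`-th form in the direction `(1 + t i) r`.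
  let c : Fin 3 → ℝ → ℝ := fun i t => ((S.Q i).pol v r).re + t * ((S.Q i).pol v r).im
  have hfin : ∀ i, {t : ℝ | c i t = 0}.Finite := by
    intro i
    apply Set.Subsingleton.finite
    intro t ht t' ht'
    simp only [c, Set.mem_ofPred_eq] at ht ht'
    have h1 : (t - t') * ((S.Q i).pol v r).im = 0 := by linarith
    rcases mul_eq_zero.1 h1 with h2 | h2
    · linarith
    · exfalso
      rw [h2] at ht
      exact hpol i (Complex.ext (by simpa using ht) (by simpa using h2))
  obtain ⟨t, ht⟩ := (Set.finite_iUnion hfin).infinite_compl.nonempty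
  simp only [Set.mem_compl_iff, Set.mem_iUnion, Set.mem_ofPred_eq, not_exists] at ht
  have hev : ∀ (i : Fin 3) (ε : ℝ), (S.Q i).ev (v + (ε * (1 + t * I)) • r) =
      ε * (2 * c i t + ε * ((1 + t ^ 2) * (S.Q i).ev r)) := by
    intro i ε
    have := (S.Q i).ev_comb 1 (ε * (1 + t * I)) v r
    rw [one_smul] at this
    rw [this, h i]
    simp [normSq_apply, c]
    ring
  -- Two of three nonzero real numbers have the same sign.
  have hpair : ∃ i j : Fin 3, i ≠ j ∧ ∃ σ : ℝ, σ * c i t < 0 ∧ σ * c j t < 0 := by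
    have neg : ∀ i j : Fin 3, i ≠ j → c i t < 0 → c j t < 0 →
        ∃ i j : Fin 3, i ≠ j ∧ ∃ σ : ℝ, σ * c i t < 0 ∧ σ * c j t < 0 := fun i j hij hi hj =>
      ⟨i, j, hij, 1, by linarith, by linarith⟩
    have pos : ∀ i j : Fin 3, i ≠ j → 0 < c i t → 0 < c j t →
        ∃ i j : Fin 3, i ≠ j ∧ ∃ σ : ℝ, σ * c i t < 0 ∧ σ * c j t < 0 := fun i j hij hi hj =>
      ⟨i, j, hij, -1, by linarith, by linarith⟩
    rcases lt_or_gt_of_ne (ht 0) with h0 | h0 <;> rcases lt_or_gt_of_ne (ht 1) with h1 | h1 <;>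
    rcases lt_or_gt_of_ne (ht 2) with h2 | h2
    · exact neg 0 1 (by decide) h0 h1
    · exact neg 0 1 (by decide) h0 h1
    · exact neg 0 2 (by decide) h0 h2
    · exact pos 1 2 (by decide) h1 h2
    · exact neg 1 2 (by decide) h1 h2
    · exact pos 0 2 (by decide) h0 h2
    · exact pos 0 1 (by decide) h0 h1
    · exact pos 0 1 (by decide) h0 h1
  obtain ⟨i, j, hij, σ, hi, hj⟩ := hpair
  have hsmall : ∀ i, σ * c i t < 0 → ∀ᶠ ε in 𝓝[>] (0 : ℝ),
      (S.Q i).ev (v + ((ε * σ : ℝ) * (1 + t * I)) • r) < 0 := by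
    intro i hi
    have hc : Continuous fun ε : ℝ => 2 * (σ * c i t) + ε * (σ ^ 2 * ((1 + t ^ 2) * (S.Q i).ev r)) := by
      fun_prop
    have h1 : ∀ᶠ ε in 𝓝 (0 : ℝ), 2 * (σ * c i t) + ε * (σ ^ 2 * ((1 + t ^ 2) * (S.Q i).ev r)) < 0 :=
      hc.continuousAt.eventually (gt_mem_nhds (by simp; linarith))
    filter_upwards [nhdsWithin_le_nhds h1, self_mem_nhdsWithin] with ε hε hpos
    rw [hev]
    have := mul_neg_of_pos_of_neg (show (0 : ℝ) < ε from hpos) hε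
    calc _ = ε * (2 * (σ * c i t) + ε * (σ ^ 2 * ((1 + t ^ 2) * (S.Q i).ev r))) := by ring
      _ < 0 := this
  obtain ⟨ε, h1, h2⟩ := ((hsmall i hi).and (hsmall j hj)).exists
  exact lt_asymm h2 (S.disj i j hij _ h1)

/-! ### Faithfulness and discreteness of the action of the free product -/

/-- The homomorphism from the free product which sends the generators to the half-turns. -/
def φ : W →* PSL2C := W.lift S.h S.h_mul_h

theorem φ_s (i : Fin 3) : S.φ (W.s i) = S.h i := W.lift_s _ _ i

theorem φ_wprod (l : List (Fin 3)) : S.φ (wprod W.s l) = wprod S.h l := W.lift_wprod _ _ l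

theorem φ_injective : Function.Injective S.φ := by
  rw [injective_iff_map_eq_one]
  intro w hw
  obtain ⟨z, hz⟩ := S.exists_base
  obtain ⟨l, hl, rfl⟩ := W.exists_word w
  cases l with
  | nil => rfl
  | cons i l =>
    exfalso
    have := ping_pong S.h_smul_mem_D S.D_subset_E l i z hl fun k _ => hz k
    rw [← φ_wprod, hw, one_smul] at this
    exact S.notMem_E i z this (hz i)

theorem s_notMem_closure (S : HalfTurnSystem) {a n b : Fin 3} (han : a ≠ n) (hab : a ≠ b) (hnb : n ≠ b)
    (l : List (Fin 3)) (hl : l.IsChain (· ≠ ·)) (hb : l.head? = some b)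
    (ha : l.getLast? = some a) :
    W.s b ∉ Subgroup.closure {W.s a, W.s n, wprod W.s l * W.s b * (wprod W.s l)⁻¹,
      wprod W.s l * W.s n * (wprod W.s l)⁻¹} := by
  intro hmem
  obtain ⟨z, hz⟩ := S.exists_base
  apply not_mem_closure_conj S.h_mul_h S.h_smul_mem_D S.D_subset_E S.notMem_E hz han hab hnb hl hb ha
  have := Subgroup.mem_map_of_mem S.φ hmem
  rw [MonoidHom.map_closure] at this
  simpa [Set.image_insert_eq, φ_s, φ_wprod] using this

/-- A neighbourhood of the identity meets the group of the system only in the identity. -/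
theorem discrete (G : Subgroup PSL2C) (hG : G ≤ S.φ.range) : DiscreteTopology G := by
  obtain ⟨z, hz⟩ := S.exists_base
  -- Matrices which keep the base point outside all three discs; ping-pong sends it into a disc
  -- under every nontrivial element.
  let U : Set SL2C := {g | ∀ i, 0 < (S.Q i).ev (g.1 *ᵥ vec z)}
  have hU : IsOpen U := by
    simp only [U, Set.ofPred_forall]
    refine isOpen_iInter_of_finite fun i => isOpen_lt continuous_const ?_
    apply (S.Q i).continuous_ev.comp
    exact (continuous_subtype_val : Continuous fun g : SL2C => g.1).matrix_mulVec continuous_const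
  have hV : IsOpen (toPSL '' U) := QuotientGroup.isOpenMap_coe U hU
  rw [discreteTopology_iff_isOpen_singleton_one]
  refine ⟨toPSL '' U, hV, ?_⟩
  ext ⟨g, hg⟩
  simp only [Set.mem_preimage, Set.mem_singleton_iff]
  constructor
  · rintro ⟨M, hM, rfl⟩
    obtain ⟨w, hw⟩ := hG hg
    obtain ⟨l, hl, rfl⟩ := W.exists_word w
    rw [φ_wprod] at hw
    cases l with
    | nil => exact Subtype.ext hw.symm
    | cons i l =>
      exfalso
      have := ping_pong S.h_smul_mem_D S.D_subset_E l i z hl fun k _ => hz k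
      rw [hw] at this
      obtain ⟨r, hr, h⟩ := (S.Q i).at_smul M z
      have h2 := hM i
      rw [h] at h2
      exact S.notMem_E i _ this (pos_of_mul_pos_right h2 hr.le)
  · intro h
    have h1 : toPSL 1 = g := by rw [map_one]; exact (congrArg Subtype.val h).symm
    exact ⟨1, fun i => by simpa using (show 0 < (S.Q i).ev (vec z) from hz i), h1⟩

end HalfTurnSystem

end TwoParabolic
end

noncomputable section

namespace TwoParabolic

open Complex Matrix Filter Topology
open scoped ComplexConjugate

theorem nonpos_of_forall_nat {A B C : ℝ} (h : ∀ n : ℕ, 1 ≤ n → C + n ^ 2 * A + 2 * n * B < 0) :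
    A ≤ 0 := by
  by_contra hA
  push Not at hA
  obtain ⟨n, hn⟩ := exists_nat_gt ((2 * |B| + |C|) / A + 1)
  have h1 : (1 : ℝ) ≤ n := by
    have : 0 ≤ (2 * |B| + |C|) / A := by positivity
    linarith
  have h2 := h n (by exact_mod_cast h1)
  have h3 : (2 * |B| + |C|) / A < n := by linarith
  rw [div_lt_iff₀ hA] at h3
  have h4 : (n : ℝ) * (2 * |B| + |C|) ≤ n * (n * A) :=
    mul_le_mul_of_nonneg_left h3.le (by linarith)
  have h5 : (n : ℝ) * B ≥ -(n * |B|) := by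
    have := mul_le_mul_of_nonneg_left (neg_abs_le B) (show (0 : ℝ) ≤ n by linarith)
    linarith
  have h6 : |C| ≤ n * |C| := le_mul_of_one_le_left (abs_nonneg C) h1
  have h7 := neg_abs_le C
  nlinarith

namespace HalfTurnSystem

variable (S : HalfTurnSystem)

/-! ### Parabolic words -/

/-- The points `g ^ n • z`, `n ≥ 1`, stay in the disc and tend to `p`. Algebraically, `M ^ n v = v +
n u` with `u = (M - 1) v` spanning the line of `p`, so the form along the orbit is a quadratic
polynomial in `n` with leading coefficient its value at `u`; being always negative, it has leading
coefficient at most `0`. -/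
theorem at_fixed_nonpos {g : PSL2C} {p : Sphere} (hg : IsParab g p) {i : Fin 3}
    {z : Sphere} (hz : z ∈ S.E i) (hgz : g • z ∈ S.D i)
    (hD : ∀ x ∈ S.D i, g • x ∈ S.D i) : (S.Q i).at' p ≤ 0 := by
  obtain ⟨M, rfl, ht, h1, hp⟩ := hg
  set v := vec z
  set u := M.1 *ᵥ v - v with hu
  have horb : ∀ n : ℕ, toPSL (M ^ (n + 1)) • z ∈ S.D i := by
    intro n
    induction n with
    | zero => simpa using hgz
    | succ n ih =>
      rw [pow_succ', map_mul, mul_smul]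
      exact hD _ ih
  have hev : ∀ n : ℕ, 1 ≤ n →
      (S.Q i).ev v + n ^ 2 * (S.Q i).ev u + 2 * n * ((S.Q i).pol v u).re < 0 := by
    intro n hn
    obtain ⟨n, rfl⟩ := Nat.exists_eq_add_of_le' hn
    obtain ⟨r, hr, h⟩ := (S.Q i).at_smul (M ^ (n + 1)) z
    have h2 : (S.Q i).at' (toPSL (M ^ (n + 1)) • z) < 0 := horb n
    have h3 := mul_neg_of_pos_of_neg hr h2
    rw [← h, pow_mulVec_of_trace_two ht] at h3
    have h4 := (S.Q i).ev_add_smul ((n + 1 : ℕ) : ℝ) v u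
    rw [ofReal_natCast] at h4
    rwa [h4] at h3
  have hle := nonpos_of_forall_nat hev
  have hu0 : u ≠ 0 := by
    intro h0
    have hfix : toPSL M • z = z := (smul_eq_iff M z).2 ⟨1, by
      rw [one_smul]; exact sub_eq_zero.1 (hu ▸ h0)⟩
    rw [hfix] at hgz
    exact S.notMem_E i z hgz hz
  obtain ⟨c, hc⟩ := (smul_eq_iff M p).1 hp
  have hMp := fix_of_eigen ht (vec_ne_zero p) hc
  have hMu : M.1 *ᵥ u = u := mulVec_mulVec_of_trace_two ht v
  have hcr : cross (vec p) u = 0 := by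
    by_contra hne
    exact h1 (eq_one_of_fix hMp hMu hne)
  obtain ⟨x, hx⟩ := eq_smul_of_cross (vec_ne_zero p) hcr
  rw [hx, HForm.ev_smul] at hle
  have hx0 : x ≠ 0 := by
    rintro rfl; exact hu0 (by rw [hx, zero_smul])
  exact nonpos_of_mul_nonpos_right hle (normSq_pos.2 hx0)

theorem at_fixed_head_nonpos {i k : Fin 3} (hik : i ≠ k) {l : List (Fin 3)}
    (hl : (i :: l).IsChain (· ≠ ·)) (hk : (i :: l).getLast? = some k) {p : Sphere}
    (hp : IsParab (wprod S.h (i :: l)) p) : (S.Q i).at' p ≤ 0 := by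
  have key : ∀ x ∈ S.E k, wprod S.h (i :: l) • x ∈ S.D i := fun x hx =>
    ping_pong S.h_smul_mem_D S.D_subset_E l i x hl fun j hj => by
      rw [hk] at hj; simp at hj; rwa [← hj]
  have hD : ∀ x ∈ S.D i, wprod S.h (i :: l) • x ∈ S.D i := fun x hx =>
    key x (S.D_subset_E k i hik.symm hx)
  obtain ⟨z, hz⟩ := S.exists_base
  obtain ⟨M, hM, ht, h1, hfix⟩ := hp
  exact S.at_fixed_nonpos ⟨M, hM, ht, h1, hfix⟩ (hz i) (key z (hz k)) hD

/-- A cyclically reduced word with parabolic product fixing `p`. -/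
def Closed (p : Sphere) (l : List (Fin 3)) : Prop := CycRed l ∧ IsParab (wprod S.h l) p

variable {S}

theorem Closed.ne_nil {p : Sphere} {l : List (Fin 3)} (hl : S.Closed p l) : l ≠ [] := by
  rintro rfl
  exact hl.2.ne_one rfl

theorem Closed.rotate {p : Sphere} {i : Fin 3} {l : List (Fin 3)} (hl : S.Closed p (i :: l)) :
    S.Closed (S.h i • p) (l ++ [i]) := by
  refine ⟨hl.1.rotate, ?_⟩
  have := hl.2.conj (S.h i)
  rw [wprod_cons, inv_of_mul_self (S.h_mul_h i), ← mul_assoc, S.h_mul_h, one_mul] at this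
  rwa [wprod_append, wprod_cons, wprod_nil, mul_one]

/-! ### Tangency points and their motion under the half-turns -/

variable (S)

/-- `p` lies on all the circles except possibly the circle `e`. -/
def OnEdge (p : Sphere) (e : Fin 3) : Prop := ∀ j, j ≠ e → (S.Q j).at' p = 0

variable {S}

/-- The fixed point is attracting for the word, hence in the closed disc of the first letter, and
for its inverse, hence in the closed disc of the last one. These discs have disjoint interiors, so
the point is on both circles. -/
theorem Closed.mem_circles {p : Sphere} {i k : Fin 3} {l : List (Fin 3)}
    (hl : S.Closed p (i :: l)) (hk : (i :: l).getLast? = some k) :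
    i ≠ k ∧ (S.Q i).at' p = 0 ∧ (S.Q k).at' p = 0 := by
  have hik : i ≠ k := (hl.1.2 k hk i rfl).symm
  have h1 := S.at_fixed_head_nonpos hik hl.1.1 hk hl.2
  have h2 : (S.Q k).at' p ≤ 0 := by
    obtain ⟨m, hm⟩ : ∃ m, (i :: l).reverse = k :: m := by
      rw [← List.head?_reverse] at hk
      cases h : (i :: l).reverse with
      | nil => simp at h
      | cons a m => rw [h] at hk; simp at hk; exact ⟨m, by rw [hk]⟩
    have hpar := hl.2.inv
    rw [← wprod_reverse S.h_mul_h, hm] at hpar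
    refine S.at_fixed_head_nonpos hik.symm ?_ ?_ hpar
    · rw [← hm, List.isChain_reverse]
      exact hl.1.1.imp fun _ _ h => h.symm
    · rw [← hm, List.getLast?_reverse]; rfl
  have h3 : ¬ (S.Q i).at' p < 0 := fun h => by
    have := S.disj i k hik _ h
    exact absurd this (not_lt.2 h2)
  have h4 : ¬ (S.Q k).at' p < 0 := fun h => by
    have := S.disj k i hik.symm _ h
    exact absurd this (not_lt.2 h1)
  exact ⟨hik, le_antisymm h1 (not_lt.1 h3), le_antisymm h2 (not_lt.1 h4)⟩

/-- The letter different from two given distinct letters. -/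
def third (i k : Fin 3) : Fin 3 := -(i + k)

theorem third_ne {i k : Fin 3} (h : i ≠ k) : third i k ≠ i ∧ third i k ≠ k := by
  revert i k; decide

theorem eq_of_third {i j k : Fin 3} (h : third j i = third i k) : j = k := by
  revert i j k; decide

theorem eq_or_of_ne_third {i k j : Fin 3} (h : i ≠ k) (hj : j ≠ third i k) : j = i ∨ j = k := by
  revert i k j; decide

theorem shift_ne (e : Fin 3) : e + 1 ≠ e ∧ e + 2 ≠ e ∧ e + 1 ≠ e + 2 := by
  revert e; decide

theorem eq_or_eq_of_ne {a b c u : Fin 3} (hab : a ≠ b) (ha : a ≠ u) (hb : b ≠ u) (hc : c ≠ u) :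
    c = a ∨ c = b := by
  revert a b c u; decide

theorem pair_eq_third {i j a : Fin 3} (hij : i ≠ j) (ha : a ≠ third i j) :
    (i = a ∧ j = third a (third i j)) ∨ (i = third a (third i j) ∧ j = a) := by
  revert i j a; decide

theorem third_comm (i j : Fin 3) : third i j = third j i := by
  rw [third, third, add_comm]

theorem Closed.onEdge {p : Sphere} {i k : Fin 3} {l : List (Fin 3)}
    (hl : S.Closed p (i :: l)) (hk : (i :: l).getLast? = some k) : S.OnEdge p (third i k) := by
  obtain ⟨hik, hi, hk⟩ := hl.mem_circles hk
  intro j hj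
  rcases eq_or_of_ne_third hik hj with rfl | rfl <;> assumption

theorem OnEdge.unique {p : Sphere} {e e' : Fin 3} (h : S.OnEdge p e) (h' : S.OnEdge p e') :
    e = e' := by
  by_contra hne
  refine S.no_triple_point (vec_ne_zero p) fun i => ?_
  by_cases hi : i = e
  · exact h' i (hi ▸ hne)
  · exact h i hi

theorem OnEdge.point_unique {p q : Sphere} {e : Fin 3} (h : S.OnEdge p e) (h' : S.OnEdge q e) :
    p = q := by
  obtain ⟨h1, h2, h3⟩ := shift_ne e
  exact eq_of_cross_vec (S.tang _ _ h3 _ _ (h _ h1) (h _ h2) (h' _ h1) (h' _ h2))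

variable (S)

/-- The `v`-th half-turn maps the tangency point `e` to the tangency point `e'`. -/
def Trans (v e e' : Fin 3) : Prop := ∃ p, S.OnEdge p e ∧ S.OnEdge (S.h v • p) e'

/-- The `v`-th half-turn exchanges two tangency points on its circle. -/
def Passes (v : Fin 3) : Prop := ∃ e e', e ≠ e' ∧ e ≠ v ∧ e' ≠ v ∧ S.Trans v e e'

variable {S}

theorem Trans.symm {v e e' : Fin 3} (h : S.Trans v e e') : S.Trans v e' e := by
  obtain ⟨p, h1, h2⟩ := h
  exact ⟨S.h v • p, h2, by rwa [← mul_smul, S.h_mul_h, one_smul]⟩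

theorem Trans.unique {v e e' e'' : Fin 3} (h : S.Trans v e e') (h' : S.Trans v e e'') :
    e' = e'' := by
  obtain ⟨p, h1, h2⟩ := h
  obtain ⟨q, h3, h4⟩ := h'
  rw [h1.point_unique h3] at h2
  exact h2.unique h4

theorem exists_head_last {l : List (Fin 3)} (hl : l ≠ []) :
    ∃ i k m, l = i :: m ∧ l.getLast? = some k := by
  cases l with
  | nil => exact absurd rfl hl
  | cons i m => exact ⟨i, (i :: m).getLast hl, m, rfl, List.getLast?_eq_some_getLast hl⟩

/-- `F` is a potential on tangency points, labelled by the circle they avoid, and letter `v` changes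
it by `f v`. Reading off a letter rotates the closed word and moves its fixed point to another
tangency point, so the changes add up to the weight. Once the whole word is read the point is back
at `p`, and the weight is trivial. -/
theorem potential_aux {F f : Fin 3 → ZMod 2}
    (hF : ∀ v e e', e ≠ v → e' ≠ v → S.Trans v e e' → F e' = F e + f v) (l m : List (Fin 3)) :
    ∀ (p : Sphere) (e e' : Fin 3), S.Closed p (l ++ m) → S.OnEdge p e →
      S.OnEdge ((wprod S.h l)⁻¹ • p) e' →
      F e' = F e + Multiplicative.toAdd (W.weight f (wprod W.s l)) := by
  induction l generalizing m with
  | nil =>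
    intro p e e' _ he he'
    rw [wprod_nil, inv_one, one_smul] at he'
    rw [he.unique he']; simp
  | cons i l ih =>
    intro p e e' hl he he'
    have hrot := hl.rotate
    obtain ⟨j, k, r, hjr, hk⟩ := exists_head_last hrot.ne_nil
    have hki : k = i := by simpa using hk.symm
    subst hki
    rw [hjr] at hk
    have he1 := (hjr ▸ hrot : S.Closed _ (j :: r)).onEdge hk
    have hjk := ((hjr ▸ hrot : S.Closed _ (j :: r)).mem_circles hk).1
    have hek : e ≠ k := by
      rintro rfl
      obtain ⟨q, hq⟩ : ∃ q, (e :: (l ++ m)).getLast? = some q :=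
        ⟨_, List.getLast?_eq_some_getLast (by simp)⟩
      have h1 := Closed.onEdge hl hq
      exact (third_ne (Closed.mem_circles hl hq).1).1 (h1.unique he)
    have h1 := hF k e _ hek (third_ne hjk).2 ⟨p, he, he1⟩
    have h2 := ih (m ++ [k]) (S.h k • p) (third j k) e' (by simpa using hrot) he1 (by
      rw [wprod_cons, _root_.mul_inv_rev, inv_of_mul_self (S.h_mul_h k), mul_smul] at he'
      exact he')
    rw [h2, h1, wprod_cons, map_mul, toAdd_mul, W.weight_s, toAdd_ofAdd, add_assoc]

theorem Closed.weight_eq_one {F f : Fin 3 → ZMod 2}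
    (hF : ∀ v e e', e ≠ v → e' ≠ v → S.Trans v e e' → F e' = F e + f v) {p : Sphere}
    {l : List (Fin 3)} (hl : S.Closed p l) : W.weight f (wprod W.s l) = 1 := by
  obtain ⟨i, k, m, rfl, hk⟩ := exists_head_last hl.ne_nil
  have he := hl.onEdge hk
  have hfix : (wprod S.h (i :: m))⁻¹ • p = p := by
    obtain ⟨_, _, _, _, hp⟩ := hl.2
    rw [inv_smul_eq_iff, hp]
  have := potential_aux hF (i :: m) [] p _ _ (by simpa using hl) he (by rwa [hfix])
  rw [left_eq_add] at this
  exact toAdd_eq_zero.1 this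

/-- If `i` is the first letter and `k` the last, `p` is on the circles `i` and `k`, and `h i • p` is
on the circle `i` and that of the next letter `j`. As `h i` does not exchange tangency points, `j =
k`. Repeating this on the rotated word, which is why a suffix `m` is carried along, the letters
alternate. -/
theorem Closed.two_letters (hS : ∀ v, ¬ S.Passes v) (l m : List (Fin 3)) :
    ∀ (p : Sphere) (i k : Fin 3), S.Closed p (l ++ m) → (l ++ m).head? = some i →
      (l ++ m).getLast? = some k → ∀ x ∈ l, x = i ∨ x = k := by
  induction l generalizing m with
  | nil => simp
  | cons a l ih =>
    intro p i k hl hi hk x hx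
    have : a = i := by simpa using hi
    subst this
    rcases List.mem_cons.1 hx with rfl | hxl
    · exact Or.inl rfl
    have hrot := hl.rotate
    obtain ⟨j, k', r, hjr, hk'⟩ := exists_head_last hrot.ne_nil
    have hka : k' = a := by simpa using hk'.symm
    subst hka
    have hjr' := hjr
    rw [hjr] at hk'
    have hrot' : S.Closed (S.h k' • p) (j :: r) := hjr ▸ hrot
    have he := Closed.onEdge hl hk
    have he1 := hrot'.onEdge hk'
    have hne1 := (Closed.mem_circles hl hk).1
    have hne2 := (hrot'.mem_circles hk').1
    have heq : third j k' = third k' k := by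
      by_contra hne
      exact hS k' ⟨_, _, Ne.symm hne, (third_ne hne1).1, (third_ne hne2).2, p, he, he1⟩
    have hjk := eq_of_third heq
    subst hjk
    have hassoc : l ++ m ++ [k'] = l ++ (m ++ [k']) := by simp
    have hjr2 : l ++ (m ++ [k']) = j :: r := by rw [← hassoc]; exact hjr
    have := ih (m ++ [k']) (S.h k' • p) j k' (by rw [hjr2]; exact hrot') (by rw [hjr2]; rfl)
      (by rw [hjr2]; exact hk') x hxl
    exact this.symm

/-! ### Parabolic generating pairs -/

theorem exists_closed {x : W} (hx : x ∈ W.even) {q : Sphere} (hq : IsParab (S.φ x) q) :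
    ∃ (u : W) (l : List (Fin 3)) (p : Sphere), x = u * wprod W.s l * u⁻¹ ∧ S.Closed p l := by
  obtain ⟨l, hl, rfl⟩ := W.exists_word x
  obtain ⟨u, c, hc, h⟩ := exists_cycRed W.s_mul_s l hl
  refine ⟨u, c, S.φ u⁻¹ • q, h, ?_⟩
  have hpar : IsParab (wprod S.h c) (S.φ u⁻¹ • q) := by
    have := hq.conj (S.φ u⁻¹)
    rwa [← map_inv, ← map_mul, ← map_mul, h,
      show u⁻¹ * (u * wprod W.s c * u⁻¹) * u⁻¹⁻¹ = wprod W.s c by group, S.φ_wprod] at this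
  rcases hc with hc | ⟨i, rfl⟩
  · exact ⟨hc, hpar⟩
  · exfalso
    have h1 := W.weight_one_of_mem_even hx
    rw [h] at h1
    simp only [wprod_cons, wprod_nil, mul_one, map_mul, map_inv, mul_inv_cancel_comm] at h1
    rw [W.weight_s] at h1
    exact absurd h1 (by decide)

theorem Closed.conj_weight_eq_one {F f : Fin 3 → ZMod 2}
    (hF : ∀ v e e', e ≠ v → e' ≠ v → S.Trans v e e' → F e' = F e + f v) {x : W}
    (hx : x ∈ W.even) {q : Sphere} (hq : IsParab (S.φ x) q) : W.weight f x = 1 := by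
  obtain ⟨u, l, p, rfl, hl⟩ := exists_closed hx hq
  rw [map_mul, map_mul, hl.weight_eq_one hF, map_inv]; simp

/-- A passing half-turn would allow a nonconstant weight that comes from a potential. Such a weight
is trivial on every parabolic element, in particular on both generators. -/
theorem not_passes {x y : W} (hxy : Subgroup.closure {x, y} = W.even) {p q : Sphere}
    (hx : IsParab (S.φ x) p) (hy : IsParab (S.φ y) q) (v : Fin 3) : ¬ S.Passes v := by
  classical
  intro hv
  obtain ⟨e, hev⟩ : ∃ e, e ≠ v := ⟨v + 1, (shift_ne v).1⟩
  -- A passing letter `u ≠ e` exchanges the tangency point `e` with another one and changes `F`; the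
  -- letter `e` only permutes points where `F` is `0`; a letter that does not pass fixes labels.
  -- Thus `f v = 1` and `f e = 0`.
  let F : Fin 3 → ZMod 2 := fun i => if i = e then 1 else 0
  let f : Fin 3 → ZMod 2 := fun i => if S.Passes i ∧ i ≠ e then 1 else 0
  have hF : ∀ v e e', e ≠ v → e' ≠ v → S.Trans v e e' → F e' = F e + f v := by
    intro u e1 e2 h1 h2 ht
    by_cases h12 : e1 = e2
    · subst h12
      have hnp : ¬ S.Passes u := by
        rintro ⟨a, b, hab, ha, hb, hab'⟩
        rcases eq_or_eq_of_ne hab ha hb h1 with rfl | rfl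
        · exact hab (ht.unique hab')
        · exact hab (hab'.symm.unique ht)
      simp [f, hnp]
    · have hp : S.Passes u := ⟨e1, e2, h12, h1, h2, ht⟩
      by_cases hu : u = e
      · subst hu
        simp [F, f, h1, h2]
      · rcases eq_or_eq_of_ne h12 h1 h2 (Ne.symm hu) with rfl | rfl
        · simp [F, f, hp, hu, Ne.symm h12]; rfl
        · simp [F, f, hp, hu, h12]
  have hmem : ∀ z ∈ ({x, y} : Set W), z ∈ W.even := fun z hz => hxy ▸ Subgroup.subset_closure hz
  have := W.weight_const_of_closure hxy (Closed.conj_weight_eq_one hF (hmem x (by simp)) hx)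
    (Closed.conj_weight_eq_one hF (hmem y (by simp)) hy) e v
  simp [f, hv, hev.symm] at this

theorem exists_conj_zpow {x y : W} (hxy : Subgroup.closure {x, y} = W.even) {p q : Sphere}
    (hx : IsParab (S.φ x) p) (hy : IsParab (S.φ y) q) {w : W} (hw : w = x ∨ w = y) :
    ∃ (i k : Fin 3) (u : W) (m : ℤ), i ≠ k ∧ w = u * (W.s i * W.s k) ^ m * u⁻¹ := by
  have hweven : w ∈ W.even := hxy ▸ Subgroup.subset_closure (by simpa using hw)
  obtain ⟨r, hr⟩ : ∃ r, IsParab (S.φ w) r := by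
    rcases hw with rfl | rfl
    exacts [⟨p, hx⟩, ⟨q, hy⟩]
  obtain ⟨u, l, p', h, hl⟩ := exists_closed hweven hr
  obtain ⟨i, k, m, hm, hk⟩ := exists_head_last hl.ne_nil
  have hlet := Closed.two_letters (not_passes hxy hx hy) l [] p' i k (by simpa using hl)
    (by simp [hm]) (by simpa using hk)
  have hik : i ≠ k := by
    subst hm
    exact (hl.mem_circles hk).1
  have hwt : W.weight (fun _ => 1) (wprod W.s l) = 1 := by
    have h1 := W.weight_one_of_mem_even hweven
    rw [h, map_mul, map_mul, map_inv] at h1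
    simpa [mul_comm] using h1
  obtain ⟨n, ⟨hn, -⟩ | ⟨-, hn⟩⟩ := W.wprod_two_letters l hlet
  · exact ⟨i, k, u, n, hik, by rw [h, hn]⟩
  · exact absurd hwt hn

/-- Parabolic generators of the group of a system are simultaneously conjugate to products of
two of the half-turns. -/
theorem exists_normal_form {x y : W} (hxy : Subgroup.closure {x, y} = W.even) {p q : Sphere}
    (hx : IsParab (S.φ x) p) (hy : IsParab (S.φ y) q) :
    ∃ (a n b : Fin 3) (g : W), a ≠ n ∧ a ≠ b ∧ n ≠ b ∧
      (x = g * (W.s a * W.s n) * g⁻¹ ∨ x = g * (W.s a * W.s n)⁻¹ * g⁻¹) ∧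
      (y = g * (W.s b * W.s n) * g⁻¹ ∨ y = g * (W.s b * W.s n)⁻¹ * g⁻¹) := by
  obtain ⟨i, j, u, m, hij, hxu⟩ := exists_conj_zpow hxy hx hy (Or.inl rfl)
  obtain ⟨i', j', v, k, hij', hyv⟩ := exists_conj_zpow hxy hx hy (Or.inr rfl)
  -- If both generators avoided the same letter, counting that letter would be a nonconstant weight
  -- trivial on both.
  have hne : third i' j' ≠ third i j := by
    intro heq
    let f : Fin 3 → ZMod 2 := fun c => if c = third i j then 1 else 0
    have hx1 : W.weight f x = 1 := by
      rw [hxu, map_mul, map_mul, map_inv, map_zpow, map_mul, W.weight_s, W.weight_s]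
      simp [f, (third_ne hij).1.symm, (third_ne hij).2.symm]
    have hy1 : W.weight f y = 1 := by
      rw [hyv, map_mul, map_mul, map_inv, map_zpow, map_mul, W.weight_s, W.weight_s]
      simp [f, ← heq, (third_ne hij').1.symm, (third_ne hij').2.symm]
    have := W.weight_const_of_closure hxy hx1 hy1 (third i j) i
    simp [f, (third_ne hij).1.symm] at this
  have hinv : ∀ (i j : Fin 3) (m : ℤ), (W.s i * W.s j) ^ m = (W.s j * W.s i) ^ (-m) := by
    intro i j m
    rw [_root_.zpow_neg, ← _root_.inv_zpow, _root_.mul_inv_rev, W.s_inv, W.s_inv]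
  set a := third i' j' with ha
  set b := third i j with hb
  set n := third a b with hn
  have han : a ≠ n := (third_ne hne).1.symm
  have hnb : n ≠ b := (third_ne hne).2
  have h1 : ∃ m' : ℤ, x = u * (W.s a * W.s n) ^ m' * u⁻¹ := by
    rcases pair_eq_third hij hne with ⟨hi, hj⟩ | ⟨hi, hj⟩
    · exact ⟨m, by rw [hxu, hn, ← hj, ← hi]⟩
    · exact ⟨-m, by rw [hxu, hinv, hn, ← hi, ← hj]⟩
  have h2 : ∃ k' : ℤ, y = v * (W.s b * W.s n) ^ k' * v⁻¹ := by
    rcases pair_eq_third hij' hne.symm with ⟨hi, hj⟩ | ⟨hi, hj⟩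
    · exact ⟨k, by rw [hyv, hn, third_comm, ← hj, ← hi]⟩
    · exact ⟨-k, by rw [hyv, hinv, hn, third_comm, ← hi, ← hj]⟩
  obtain ⟨m', hx'⟩ := h1
  obtain ⟨k', hy'⟩ := h2
  obtain ⟨g, hg⟩ := W.exists_simultaneous_conj han hne hnb
    (fun l hl hb ha => S.s_notMem_closure han hne hnb l hl hb ha) hx' hy' hxy
  exact ⟨a, n, b, g, han, hne, hnb, hg⟩

end HalfTurnSystem

end TwoParabolic
end

noncomputable section

namespace TwoParabolic

open Complex Matrix
open scoped ComplexConjugate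

/-! ### Half-turns as matrices -/

/-- A lift has eigenvectors at `x` and `y` with eigenvalues `c`, `d` where `c d = 1` and `c² = -1`,
so `d = -c` and `|c| = 1`. Both eigenvectors are isotropic for the form, whose only remaining term,
the mixed one, is multiplied by `c d̄ = -1`. -/
theorem IsHalfTurn.exists_matrix {h : PSL2C} {x y : Sphere} (hh : IsHalfTurn h x y) {Q : HForm}
    (hx : Q.at' x = 0) (hy : Q.at' y = 0) :
    ∃ H : SL2C, toPSL H = h ∧ H * H = -1 ∧ ∀ v, Q.ev (H.1 *ᵥ v) = -Q.ev v := by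
  obtain ⟨hxy, h1, hsq, hfx, hfy⟩ := hh
  obtain ⟨H, rfl⟩ := toPSL_surjective h
  have hcr : cross (vec x) (vec y) ≠ 0 := fun h0 => hxy (eq_of_cross_vec h0)
  obtain ⟨c, hc⟩ := (smul_eq_iff H x).1 hfx
  obtain ⟨d, hd⟩ := (smul_eq_iff H y).1 hfy
  have hcd : c * d = 1 := by
    have e1 : cross (H.1 *ᵥ vec x) (H.1 *ᵥ vec y) = cross (vec x) (vec y) := by
      simp only [cross, mulVec_zero_apply, mulVec_one_apply]
      linear_combination (vec x 0 * vec y 1 - vec x 1 * vec y 0) * sl_det H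
    rw [hc, hd] at e1
    have e2 : (c * d - 1) * cross (vec x) (vec y) = 0 := by
      simp only [cross, Pi.smul_apply, smul_eq_mul] at e1 ⊢
      linear_combination e1
    exact sub_eq_zero.1 ((mul_eq_zero.1 e2).resolve_right hcr)
  have hsq' : H * H = -1 := by
    rw [← map_mul, toPSL_eq_one_iff] at hsq
    refine hsq.resolve_left fun hs => ?_
    have hcc : c * c = 1 := by
      have e : (H * H).1 *ᵥ vec x = (c * c) • vec x := by
        rw [mul_mulVec, hc, Matrix.mulVec_smul, hc, smul_smul]
      rw [hs] at e
      have e2 : (c * c - 1) • vec x = 0 := by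
        rw [sub_smul, ← e]; simp
      exact sub_eq_zero.1 ((smul_eq_zero.1 e2).resolve_right (vec_ne_zero x))
    rcases mul_self_eq_one_iff.1 hcc with rfl | rfl
    · have hd1 : d = 1 := by simpa using hcd
      rw [hd1, one_smul] at hd
      rw [one_smul] at hc
      exact h1 ((toPSL_eq_one_iff H).2 (Or.inl (eq_one_of_fix hc hd hcr)))
    · have hd1 : d = -1 := by linear_combination -hcd
      rw [hd1] at hd
      have hc' : (-H).1 *ᵥ vec x = vec x := by rw [neg_mulVec_sl, hc]; simp
      have hd' : (-H).1 *ᵥ vec y = vec y := by rw [neg_mulVec_sl, hd]; simp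
      have := eq_one_of_fix hc' hd' hcr
      exact h1 ((toPSL_eq_one_iff H).2 (Or.inr (by rw [← this, neg_neg])))
  refine ⟨H, rfl, hsq', fun v => ?_⟩
  have hcc : c * c = -1 := by
    have e : (H * H).1 *ᵥ vec x = (c * c) • vec x := by
      rw [mul_mulVec, hc, Matrix.mulVec_smul, hc, smul_smul]
    rw [hsq', neg_mulVec_sl] at e
    have e2 : (c * c + 1) • vec x = 0 := by
      rw [add_smul, ← e]; simp
    exact eq_neg_of_add_eq_zero_left ((smul_eq_zero.1 e2).resolve_right (vec_ne_zero x))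
  have hdc : d = -c := by
    have : d * (c * c) = c := by linear_combination c * hcd
    rw [hcc] at this
    linear_combination -this
  have hn : normSq c = 1 := by
    have := congrArg normSq hcc
    rw [normSq_mul, normSq_neg, normSq_one] at this
    exact (mul_self_eq_one_iff.1 this).resolve_right fun h => by
      have := normSq_nonneg c; linarith
  have hn' : c * conj c = 1 := by rw [mul_conj, hn]; simp
  obtain ⟨a, b, rfl⟩ := exists_comb hcr v
  have e1 : H.1 *ᵥ (a • vec x + b • vec y) = (a * c) • vec x + (b * d) • vec y := by
    rw [Matrix.mulVec_add, Matrix.mulVec_smul, Matrix.mulVec_smul, hc, hd, smul_smul, smul_smul]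
  rw [e1, Q.ev_comb, Q.ev_comb]
  have hx' : Q.ev (vec x) = 0 := hx
  have hy' : Q.ev (vec y) = 0 := hy
  rw [hx', hy', hdc]
  have : a * c * conj (b * -c) * Q.pol (vec x) (vec y) =
      -(a * conj b * Q.pol (vec x) (vec y)) := by
    rw [map_mul, map_neg]
    linear_combination (-a * conj b * Q.pol (vec x) (vec y)) * hn'
  rw [this, neg_re]; ring

/-! ### The mutual position of two circles -/

theorem psd_real {A B C : ℝ} (hA : 0 ≤ A) (hC : 0 ≤ C) (h : B ^ 2 ≤ A * C) (x y : ℝ) :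
    0 ≤ A * x ^ 2 + 2 * B * x * y + C * y ^ 2 := by
  rcases hA.eq_or_lt with rfl | hA
  · have : B = 0 := by
      rw [zero_mul] at h
      exact pow_eq_zero_iff (two_ne_zero) |>.1 (le_antisymm h (sq_nonneg B))
    subst this
    have := mul_nonneg hC (sq_nonneg y)
    linarith
  · have h1 : 0 ≤ A * (A * x ^ 2 + 2 * B * x * y + C * y ^ 2) := by
      have : A * (A * x ^ 2 + 2 * B * x * y + C * y ^ 2) =
          (A * x + B * y) ^ 2 + (A * C - B ^ 2) * y ^ 2 := by ring
      rw [this]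
      have := mul_nonneg (sub_nonneg.2 h) (sq_nonneg y)
      positivity
    exact nonneg_of_mul_nonneg_right h1 hA

theorem HForm.exists_neg {Q : HForm} (hQ : 0 < Q.disc) {e f : Fin 2 → ℂ} (hef : cross e f ≠ 0)
    (he : Q.ev e = 0) (hf : Q.ev f = 0) : ∃ v, Q.ev v < 0 := by
  have hm := HForm.pol_ne_zero hQ hef he hf
  refine ⟨(-conj (Q.pol e f)) • e + (1 : ℂ) • f, ?_⟩
  rw [Q.ev_comb, he, hf]
  have := normSq_pos.2 hm
  have h2 : (-conj (Q.pol e f) * conj 1 * Q.pol e f).re = -normSq (Q.pol e f) := by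
    rw [normSq_apply]; simp
  rw [h2]; linarith

/-- For this `e`, `f` the form `R` is `2k Im (x ȳ)`, so its circle consists of the real
combinations, on which `Q` is a positive semidefinite real form. Splitting `x`, `y` into real and
imaginary parts bounds `Q` below by `-2 Im (x ȳ) Im (pol e f)`. The sign of `Im (pol e f)` picks the
side of `R` on which `Q` is positive; it is not `0`, as `Q` takes a negative value. -/
theorem HForm.sign_aux {Q R : HForm} (hQ : ∃ v, Q.ev v < 0) {e f : Fin 2 → ℂ}
    (hef : cross e f ≠ 0) (he : R.ev e = 0) (hf : R.ev f = 0) {k : ℝ} (hk : 0 < k)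
    (hpol : R.pol e f = -(k * I)) (hA : 0 ≤ Q.ev e) (hC : 0 ≤ Q.ev f)
    (hAC : (Q.pol e f).re ^ 2 ≤ Q.ev e * Q.ev f) :
    (∀ v, R.ev v = 0 → 0 ≤ Q.ev v) ∧
      ∃ δ : ℝ, (δ = 1 ∨ δ = -1) ∧ ∀ v, δ * R.ev v < 0 → 0 < Q.ev v := by
  have hR : ∀ x y : ℂ, R.ev (x • e + y • f) = 2 * k * (x * conj y).im := by
    intro x y
    rw [R.ev_comb, he, hf, hpol]
    simp; ring
  have hQ' : ∀ x y : ℂ, -2 * (x * conj y).im * (Q.pol e f).im ≤ Q.ev (x • e + y • f) := by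
    intro x y
    rw [Q.ev_comb]
    have h1 := psd_real hA hC hAC x.re y.re
    have h2 := psd_real hA hC hAC x.im y.im
    simp only [normSq_apply, mul_re, mul_im, conj_re, conj_im]
    nlinarith
  constructor
  · intro v hv
    obtain ⟨x, y, rfl⟩ := exists_comb hef v
    have h1 := hQ' x y
    rw [hR] at hv
    have h2 : (x * conj y).im = 0 := (mul_eq_zero.1 hv).resolve_left (by positivity)
    rw [h2] at h1
    simpa using h1
  · rcases lt_trichotomy (Q.pol e f).im 0 with hb | hb | hb
    · refine ⟨-1, Or.inr rfl, fun v hv => ?_⟩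
      obtain ⟨x, y, rfl⟩ := exists_comb hef v
      have h1 := hQ' x y
      rw [hR] at hv
      have h2 : 0 < (x * conj y).im := by
        by_contra hc
        have := mul_nonneg hk.le (neg_nonneg.2 (not_lt.1 hc))
        nlinarith
      have := mul_neg_of_pos_of_neg h2 hb
      linarith
    · exfalso
      obtain ⟨v, hv⟩ := hQ
      obtain ⟨x, y, rfl⟩ := exists_comb hef v
      have h1 := hQ' x y
      rw [hb] at h1
      linarith
    · refine ⟨1, Or.inl rfl, fun v hv => ?_⟩
      obtain ⟨x, y, rfl⟩ := exists_comb hef v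
      have h1 := hQ' x y
      rw [hR] at hv
      have h2 : (x * conj y).im < 0 := by
        by_contra hc
        have := mul_nonneg hk.le (not_lt.1 hc)
        nlinarith
      have := mul_neg_of_neg_of_pos h2 hb
      linarith

/-- On the circle of `R`, parametrised by real combinations, `Q` is a real binary quadratic form. A
positive discriminant would give two projective zeros, hence two common points of the circles. -/
theorem HForm.discr_le {Q R : HForm} {e f : Fin 2 → ℂ} (hef : cross e f ≠ 0)
    (he : R.ev e = 0) (hf : R.ev f = 0) {k : ℝ} (hpol : R.pol e f = -(k * I))
    (htang : ∀ v w, Q.ev v = 0 → R.ev v = 0 → Q.ev w = 0 → R.ev w = 0 → cross v w = 0) :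
    (Q.pol e f).re ^ 2 ≤ Q.ev e * Q.ev f := by
  by_contra hlt
  push Not at hlt
  have hR : ∀ x y : ℝ, R.ev ((x : ℂ) • e + (y : ℂ) • f) = 0 := by
    intro x y
    rw [R.ev_comb, he, hf, hpol]
    simp
  have hQ : ∀ x y : ℝ, Q.ev ((x : ℂ) • e + (y : ℂ) • f) =
      Q.ev e * x ^ 2 + 2 * (Q.pol e f).re * x * y + Q.ev f * y ^ 2 := by
    intro x y
    rw [Q.ev_comb]
    simp [normSq_apply]; ring
  have hcr : ∀ x y x' y' : ℝ, cross ((x : ℂ) • e + (y : ℂ) • f) ((x' : ℂ) • e + (y' : ℂ) • f) =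
      ((x * y' - y * x' : ℝ) : ℂ) * cross e f := by
    intro x y x' y'
    simp [cross]; ring
  have key : ∀ x y x' y' : ℝ,
      Q.ev e * x ^ 2 + 2 * (Q.pol e f).re * x * y + Q.ev f * y ^ 2 = 0 →
      Q.ev e * x' ^ 2 + 2 * (Q.pol e f).re * x' * y' + Q.ev f * y' ^ 2 = 0 →
      x * y' - y * x' = 0 := by
    intro x y x' y' h1 h2
    have := htang _ _ ((hQ x y).trans h1) (hR x y) ((hQ x' y').trans h2) (hR x' y')
    rw [hcr] at this
    exact_mod_cast (mul_eq_zero.1 this).resolve_right hef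
  set A := Q.ev e
  set B := (Q.pol e f).re
  set C := Q.ev f
  by_cases hA : A = 0
  · have := key 1 0 (-C) (2 * B) (by rw [hA]; ring) (by rw [hA]; ring)
    have hB : B = 0 := by linarith
    rw [hA, hB] at hlt; simp at hlt
  · have hD := Real.sq_sqrt (sub_nonneg.2 hlt.le)
    have hpos := Real.sqrt_pos.2 (sub_pos.2 hlt)
    set r := √(B ^ 2 - A * C)
    have := key (-B + r) A (-B - r) A (by linear_combination A * hD) (by linear_combination A * hD)
    have h2 : A * (2 * r) = 0 := by linarith
    rcases mul_eq_zero.1 h2 with h | h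
    · exact hA h
    · linarith

theorem HForm.exists_sign {Q R : HForm} (hQ : 0 < Q.disc) (hR : 0 < R.disc)
    (hQi : ∃ e f, cross e f ≠ 0 ∧ Q.ev e = 0 ∧ Q.ev f = 0)
    (hRi : ∃ e f, cross e f ≠ 0 ∧ R.ev e = 0 ∧ R.ev f = 0)
    (htang : ∀ v w, Q.ev v = 0 → R.ev v = 0 → Q.ev w = 0 → R.ev w = 0 → cross v w = 0) :
    ∃ ε : ℝ, (ε = 1 ∨ ε = -1) ∧ (∀ v, R.ev v = 0 → 0 ≤ ε * Q.ev v) ∧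
      ∃ δ : ℝ, (δ = 1 ∨ δ = -1) ∧ ∀ v, δ * R.ev v < 0 → 0 < ε * Q.ev v := by
  obtain ⟨e, f₀, hef₀, he, hf₀⟩ := hRi
  have hm := HForm.pol_ne_zero hR hef₀ he hf₀
  set m := R.pol e f₀
  -- Rescaling `f₀` makes the mixed coefficient `-i |m|²`, so that the circle is the set of real
  -- combinations.
  set f := (I * m) • f₀ with hfdef
  have hef : cross e f ≠ 0 := by
    rw [hfdef, cross_smul_right]
    exact mul_ne_zero (mul_ne_zero I_ne_zero hm) hef₀
  have hf : R.ev f = 0 := by rw [hfdef, ev_smul, hf₀, mul_zero]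
  have hpol : R.pol e f = -((normSq m : ℝ) * I) := by
    have : R.pol e f = conj (I * m) * m := by
      simp only [pol, hfdef, m, Pi.smul_apply, smul_eq_mul, map_mul]; ring
    rw [this, map_mul, conj_I, ← mul_conj]; ring
  have hk := normSq_pos.2 hm
  have hdisc := discr_le hef he hf hpol htang
  have hAC : 0 ≤ Q.ev e * Q.ev f := le_trans (sq_nonneg _) hdisc
  have hneg : ∃ v, Q.ev v < 0 := by
    obtain ⟨a, b, hab, ha, hb⟩ := hQi
    exact exists_neg hQ hab ha hb
  have hneg' : ∃ v, (Q.scale (-1)).ev v < 0 := by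
    obtain ⟨a, b, hab, ha, hb⟩ := hQi
    exact exists_neg (by rw [disc_scale]; simpa using hQ) hab (by rw [ev_scale, ha, mul_zero])
      (by rw [ev_scale, hb, mul_zero])
  have hcase : (0 ≤ Q.ev e ∧ 0 ≤ Q.ev f) ∨ (Q.ev e ≤ 0 ∧ Q.ev f ≤ 0) := mul_nonneg_iff.1 hAC
  rcases hcase with ⟨h1, h2⟩ | ⟨h1, h2⟩
  · exact ⟨1, Or.inl rfl, by simpa using sign_aux hneg hef he hf hk hpol h1 h2 hdisc⟩
  · have hp : ((Q.scale (-1)).pol e f).re = -(Q.pol e f).re := by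
      simp [pol, scale]; ring
    refine ⟨-1, Or.inr rfl, ?_⟩
    have := sign_aux hneg' hef he hf hk hpol (by rw [ev_scale]; linarith)
      (by rw [ev_scale]; linarith) (by rw [hp, ev_scale, ev_scale]; linarith)
    simpa only [ev_scale] using this

/-! ### Separation -/

theorem HForm.isOpen_pos (Q : HForm) : IsOpen {z : Sphere | 0 < Q.at' z} := by
  have hc : Continuous fun z : ℂ => Q.ev ![z, 1] := by
    apply Q.continuous_ev.comp
    refine continuous_pi fun i => ?_
    fin_cases i
    · exact continuous_id
    · exact continuous_const
  have hpre : (OnePoint.some ⁻¹' {z : Sphere | 0 < Q.at' z}) = {z : ℂ | 0 < Q.ev ![z, 1]} := rfl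
  have hinf : Q.at' OnePoint.infty = Q.a := by simp [at', ev]
  by_cases ha : 0 < Q.a
  · rw [OnePoint.isOpen_iff_of_mem (by rw [Set.mem_ofPred_eq, hinf]; exact ha), hpre]
    have hclosed : IsClosed {z : ℂ | 0 < Q.ev ![z, 1]}ᶜ :=
      (isOpen_lt continuous_const hc).isClosed_compl
    refine ⟨hclosed, Metric.isCompact_of_isClosed_isBounded hclosed ?_⟩
    -- Outside this ball `a |z|²` dominates the other terms, so the complement of the set is
    -- compact, as a neighbourhood of `∞` requires.
    refine (Metric.isBounded_closedBall (x := (0 : ℂ)) (r := (2 * ‖Q.b‖ + |Q.c|) / Q.a + 1)).subset ?_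
    intro z hz
    rw [mem_closedBall_zero_iff]
    by_contra hlt
    push Not at hlt
    apply hz
    have h1 : 1 ≤ ‖z‖ := by
      have : 0 ≤ (2 * ‖Q.b‖ + |Q.c|) / Q.a := by positivity
      linarith
    have h2 : 2 * ‖Q.b‖ + |Q.c| < ‖z‖ * Q.a := by
      rw [← div_lt_iff₀ ha]; linarith
    have h3 : -(‖Q.b‖ * ‖z‖) ≤ (Q.b * z).re := by
      rw [← norm_mul]; exact (abs_le.1 (Complex.abs_re_le_norm _)).1
    have h4 : Q.ev ![z, 1] = Q.a * ‖z‖ ^ 2 + 2 * (Q.b * z).re + Q.c := by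
      simp [ev, normSq_eq_norm_sq]
    show 0 < Q.ev ![z, 1]
    rw [h4]
    have h5 := neg_abs_le Q.c
    have h6 : |Q.c| ≤ |Q.c| * ‖z‖ := le_mul_of_one_le_right (abs_nonneg _) h1
    nlinarith
  · rw [OnePoint.isOpen_iff_of_notMem (by rw [Set.mem_ofPred_eq, hinf]; exact ha), hpre]
    exact isOpen_lt continuous_const hc

theorem HForm.pos_of_preconnected {Q : HForm} {P : Set Sphere} (hP : IsPreconnected P)
    (hQ : P ⊆ Q.zerosᶜ) {z w : Sphere} (hz : z ∈ P) (hw : w ∈ P) (h : 0 < Q.at' z) :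
    0 < Q.at' w := by
  have hneg : {z : Sphere | Q.at' z < 0} = {z : Sphere | 0 < (Q.scale (-1)).at' z} := by
    ext z
    simp [at', ev_scale]
  have ho2 : IsOpen {z : Sphere | Q.at' z < 0} := by rw [hneg]; exact isOpen_pos _
  rcases hP.subset_or_subset Q.isOpen_pos ho2 (by
      rw [Set.disjoint_left]; intro x h1 h2; exact lt_asymm (show 0 < Q.at' x from h1) h2) (fun x hx => by
      rcases lt_trichotomy (Q.at' x) 0 with h | h | h
      · exact Or.inr h
      · exact absurd h (hQ hx)
      · exact Or.inl h) with hs | hs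
  · exact hs hw
  · exact absurd (hs hz) (lt_asymm h)

/-- A connected set off the circle of `Q` lies strictly on one side of it, and here it meets both
other circles. -/
theorem sign_eq_of_not_separates {Q R T : HForm} (h : ¬ Separates Q.zeros R.zeros T.zeros)
    {ε ε' : ℝ} (hε : ε = 1 ∨ ε = -1) (hε' : ε' = 1 ∨ ε' = -1)
    (h1 : ∀ v, R.ev v = 0 → 0 ≤ ε * Q.ev v) (h2 : ∀ v, T.ev v = 0 → 0 ≤ ε' * Q.ev v) :
    ε = ε' := by
  unfold Separates at h
  push Not at h
  obtain ⟨P, hP, hPQ, ⟨z, hzP, hz⟩, ⟨w, hwP, hw⟩⟩ := h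
  have hz1 := h1 _ hz
  have hw1 := h2 _ hw
  have hz0 : Q.ev (vec z) ≠ 0 := hPQ hzP
  have hw0 : Q.ev (vec w) ≠ 0 := hPQ hwP
  have hzw : 0 < Q.ev (vec z) → 0 < Q.ev (vec w) := Q.pos_of_preconnected hP hPQ hzP hwP
  have hwz : 0 < Q.ev (vec w) → 0 < Q.ev (vec z) := Q.pos_of_preconnected hP hPQ hwP hzP
  rcases hε with rfl | rfl <;> rcases hε' with rfl | rfl
  · rfl
  · exfalso
    have := hzw (lt_of_le_of_ne (by linarith) hz0.symm)
    linarith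
  · exfalso
    have := hwz (lt_of_le_of_ne (by linarith) hw0.symm)
    linarith
  · rfl

theorem Separates.comm {C D E : Set Sphere} (h : Separates C D E) : Separates C E D := by
  rintro ⟨P, hP, hC, h1, h2⟩
  exact h ⟨P, hP, hC, h2, h1⟩

theorem tang_of_disjointOrTangent {Q R : HForm} (h : DisjointOrTangent Q.zeros R.zeros)
    (v w : Fin 2 → ℂ) (h1 : Q.ev v = 0) (h2 : R.ev v = 0) (h3 : Q.ev w = 0) (h4 : R.ev w = 0) :
    cross v w = 0 := by
  by_cases hv : v = 0
  · simp [cross, hv]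
  by_cases hw : w = 0
  · simp [cross, hw]
  obtain ⟨z, c, hc, rfl⟩ := exists_point hv
  obtain ⟨z', c', hc', rfl⟩ := exists_point hw
  rw [HForm.ev_smul, mul_eq_zero] at h1 h2 h3 h4
  have e := (normSq_pos.2 hc).ne'
  have e' := (normSq_pos.2 hc').ne'
  have : z = z' := h ⟨h1.resolve_left e, h2.resolve_left e⟩ ⟨h3.resolve_left e', h4.resolve_left e'⟩
  subst this
  simp [cross]; ring

/-- By non-separation the two other circles lie on the same closed side of each circle; this side is
declared positive. -/
theorem exists_signs {Q : Fin 3 → HForm} (hd : ∀ i, 0 < (Q i).disc)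
    (hiso : ∀ i, ∃ e f, cross e f ≠ 0 ∧ (Q i).ev e = 0 ∧ (Q i).ev f = 0)
    (htang : ∀ i j, i ≠ j → ∀ v w, (Q i).ev v = 0 → (Q j).ev v = 0 → (Q i).ev w = 0 →
      (Q j).ev w = 0 → cross v w = 0)
    (hsep : ∀ i j k, i ≠ j → i ≠ k → j ≠ k → ¬ Separates (Q i).zeros (Q j).zeros (Q k).zeros) :
    ∃ ε : Fin 3 → ℝ, (∀ i, ε i = 1 ∨ ε i = -1) ∧
      ∀ i j, i ≠ j → ∀ v, ε i * (Q i).ev v < 0 → 0 < ε j * (Q j).ev v := by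
  have hpair : ∀ i j, i ≠ j → ∃ ε : ℝ, (ε = 1 ∨ ε = -1) ∧
      (∀ v, (Q j).ev v = 0 → 0 ≤ ε * (Q i).ev v) ∧
      ∃ δ : ℝ, (δ = 1 ∨ δ = -1) ∧ ∀ v, δ * (Q j).ev v < 0 → 0 < ε * (Q i).ev v := fun i j hij =>
    HForm.exists_sign (hd i) (hd j) (hiso i) (hiso j) (htang i j hij)
  choose ε' hε' hnn hδ using hpair
  have hsh : ∀ i : Fin 3, i ≠ i + 1 := by decide
  let ε : Fin 3 → ℝ := fun i => ε' i (i + 1) (hsh i)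
  have heq : ∀ i j (hij : i ≠ j), ε' i j hij = ε i := by
    intro i j hij
    by_cases hj : j = i + 1
    · subst hj; rfl
    · exact sign_eq_of_not_separates (hsep i j (i + 1) hij (hsh i) hj) (hε' _ _ _) (hε' _ _ _)
        (hnn _ _ _) (hnn _ _ _)
  have hεs : ∀ i, ε i = 1 ∨ ε i = -1 := fun i => hε' _ _ _
  have hε0 : ∀ i, ε i ≠ 0 := fun i => by rcases hεs i with h | h <;> rw [h] <;> norm_num
  refine ⟨ε, hεs, fun i j hij v hv => ?_⟩
  obtain ⟨δ, hδs, hδ⟩ := hδ j i hij.symm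
  rw [heq] at hδ
  -- Some side of circle `i` is outside disc `j`. Were it the outer side, a point of circle `j` off
  -- circle `i` would be strictly outside disc `j`; so circle `j` would lie in circle `i`.
  by_cases hcase : δ = ε i
  · exact hδ v (by rw [hcase]; exact hv)
  · exfalso
    have hneg : δ = -ε i := by
      rcases hδs with h | h <;> rcases hεs i with h' | h' <;>
        first | exact absurd (h.trans h'.symm) hcase | simp [h, h']
    have hzero : ∀ u, (Q j).ev u = 0 → (Q i).ev u = 0 := by
      intro u hu
      have h1 := hnn i j hij u hu
      rw [heq] at h1
      by_contra h0
      have h2 : 0 < ε i * (Q i).ev u := lt_of_le_of_ne h1 (mul_ne_zero (hε0 i) h0).symm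
      have h3 := hδ u (by rw [hneg]; linarith)
      rw [hu, mul_zero] at h3
      exact lt_irrefl _ h3
    obtain ⟨e, f, hef, he, hf⟩ := hiso j
    exact hef (htang i j hij e f (hzero e he) he (hzero f hf) hf)

/-- A marked pair comes from a system of half-turns. -/
theorem IsMarkedNSDC.exists_system {A B : PSL2C} (h : IsMarkedNSDC A B) :
    ∃ S : HalfTurnSystem, A = S.h 0 * S.h 1 ∧ B = S.h 2 * S.h 1 := by
  obtain ⟨-, a, a', n, n', b, b', ⟨-, -, hA, hN, hB, tA, tN, tB, rfl, rfl⟩,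
    haa, hnn, hbb, CA, CN, CB, cA, cN, cB, ma, ma', mn, mn', mb, mb', dAN, dNB, dAB,
    sA, sN, sB⟩ := h
  obtain ⟨QA, dA, rfl⟩ := isCircle_exists_form cA
  obtain ⟨QN, dN, rfl⟩ := isCircle_exists_form cN
  obtain ⟨QB, dB, rfl⟩ := isCircle_exists_form cB
  let Q : Fin 3 → HForm := ![QA, QN, QB]
  have hd : ∀ i, 0 < (Q i).disc := by
    intro i; fin_cases i <;> assumption
  have mk : ∀ {x y : Sphere} {Q : HForm}, x ≠ y → x ∈ Q.zeros → y ∈ Q.zeros →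
      ∃ e f, cross e f ≠ 0 ∧ Q.ev e = 0 ∧ Q.ev f = 0 := fun {x y Q} hxy hx hy =>
    ⟨vec x, vec y, fun h => hxy (eq_of_cross_vec h), hx, hy⟩
  have hiso : ∀ i, ∃ e f, cross e f ≠ 0 ∧ (Q i).ev e = 0 ∧ (Q i).ev f = 0 := by
    intro i; fin_cases i
    · exact mk haa ma ma'
    · exact mk hnn mn mn'
    · exact mk hbb mb mb'
  have hdt : ∀ i j, i ≠ j → DisjointOrTangent (Q i).zeros (Q j).zeros := by
    have comm : ∀ {C D : Set Sphere}, DisjointOrTangent C D → DisjointOrTangent D C := by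
      intro C D h; rwa [DisjointOrTangent, Set.inter_comm]
    intro i j hij
    fin_cases i <;> fin_cases j
    · exact absurd rfl hij
    · exact dAN
    · exact dAB
    · exact comm dAN
    · exact absurd rfl hij
    · exact dNB
    · exact comm dAB
    · exact comm dNB
    · exact absurd rfl hij
  have htang : ∀ i j, i ≠ j → ∀ v w, (Q i).ev v = 0 → (Q j).ev v = 0 → (Q i).ev w = 0 →
      (Q j).ev w = 0 → cross v w = 0 := fun i j hij => tang_of_disjointOrTangent (hdt i j hij)
  have hsep : ∀ i j k, i ≠ j → i ≠ k → j ≠ k →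
      ¬ Separates (Q i).zeros (Q j).zeros (Q k).zeros := by
    intro i j k hij hik hjk
    fin_cases i <;> fin_cases j <;> first | exact absurd rfl hij | skip
    all_goals fin_cases k <;> first | exact absurd rfl hik | exact absurd rfl hjk | skip
    · exact sA
    · exact fun h => sA h.comm
    · exact sN
    · exact fun h => sN h.comm
    · exact sB
    · exact fun h => sB h.comm
  obtain ⟨ε, hε, hdisj⟩ := exists_signs hd hiso htang hsep
  obtain ⟨HA, rfl, sqA, antiA⟩ := tA.exists_matrix ma ma'
  obtain ⟨HN, rfl, sqN, antiN⟩ := tN.exists_matrix mn mn'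
  obtain ⟨HB, rfl, sqB, antiB⟩ := tB.exists_matrix mb mb'
  have hε2 : ∀ i, ε i ^ 2 = 1 := fun i => by rcases hε i with h | h <;> rw [h] <;> norm_num
  have hε0 : ∀ i, ε i ≠ 0 := fun i => by rcases hε i with h | h <;> rw [h] <;> norm_num
  have hz : ∀ i v, ((Q i).scale (ε i)).ev v = 0 ↔ (Q i).ev v = 0 := fun i v => by
    rw [HForm.ev_scale, mul_eq_zero, or_iff_right (hε0 i)]
  let S : HalfTurnSystem :=
    { H := ![HA, HN, HB]
      Q := fun i => (Q i).scale (ε i)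
      sq := by intro i; fin_cases i <;> assumption
      anti := by
        have : ∀ i v, (Q i).ev (((![HA, HN, HB] : Fin 3 → SL2C) i).1 *ᵥ v) = -(Q i).ev v := by
          intro i; fin_cases i <;> assumption
        intro i v
        rw [HForm.ev_scale, HForm.ev_scale, this]; ring
      disc_pos := fun i => by rw [HForm.disc_scale, hε2, one_mul]; exact hd i
      iso := fun i => by
        obtain ⟨e, f, hef, he, hf⟩ := hiso i
        exact ⟨e, f, hef, (hz i e).2 he, (hz i f).2 hf⟩
      disj := fun i j hij v hv => by
        rw [HForm.ev_scale] at hv ⊢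
        exact hdisj i j hij v hv
      tang := fun i j hij v w h1 h2 h3 h4 =>
        htang i j hij v w ((hz i v).1 h1) ((hz j v).1 h2) ((hz i w).1 h3) ((hz j w).1 h4) }
  exact ⟨S, rfl, rfl⟩

end TwoParabolic
end

noncomputable section

namespace TwoParabolic

open Complex Matrix
open scoped ComplexConjugate

/-! ### The inequality for three circles in normal position -/

theorem im_eq_zero_of_halfPlane {μ : ℂ} (h : ∀ w : ℂ, w.re < 0 → 0 ≤ (μ * w).re) :
    μ.im = 0 ∧ μ.re ≤ 0 := by
  have h1 : ∀ t : ℝ, 0 ≤ -μ.re - t * μ.im := by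
    intro t
    have := h ⟨-1, t⟩ (by norm_num)
    simp at this
    linarith
  refine ⟨?_, by have := h1 0; linarith⟩
  by_contra h0
  have := h1 ((-μ.re + 1) / μ.im)
  rw [div_mul_cancel₀ _ h0] at this
  linarith

/-- Unbounded `s` is impossible, so `Re ν > 0`; letting `s` tend to `2 / Re ν` gives `2 |ν|² ≤ Re ν
· Re (ν λ)`. Twice the right side is `Re (ν² λ) + |ν|² Re λ`, at most `|ν|² (|λ| + Re λ)`. -/
theorem norm_add_re_ge {ν lam : ℂ} (hν : ν ≠ 0)
    (h : ∀ s : ℝ, 0 < s → s * ν.re < 2 → s * normSq ν < (ν * lam).re) : 4 ≤ ‖lam‖ + lam.re := by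
  have hn := normSq_pos.2 hν
  have hre : 0 < ν.re := by
    by_contra hre
    push Not at hre
    have := h ((|(ν * lam).re| + 1) / normSq ν) (by positivity) (by
      have : (|(ν * lam).re| + 1) / normSq ν * ν.re ≤ 0 :=
        mul_nonpos_of_nonneg_of_nonpos (by positivity) hre
      linarith)
    rw [div_mul_cancel₀ _ hn.ne'] at this
    have := le_abs_self (ν * lam).re
    linarith
  have hmain : 2 * normSq ν ≤ ν.re * (ν * lam).re := by
    by_contra hlt
    push Not at hlt
    rcases le_or_gt (ν * lam).re 0 with h0 | h0
    · have := h (1 / ν.re) (by positivity) (by rw [div_mul_cancel₀ _ hre.ne']; norm_num)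
      have : 0 < 1 / ν.re * normSq ν := by positivity
      linarith
    · have := h ((ν * lam).re / normSq ν) (by positivity) (by
        rw [div_mul_eq_mul_div, div_lt_iff₀ hn]; linarith)
      rw [div_mul_cancel₀ _ hn.ne'] at this
      exact lt_irrefl _ this
  have h2 : 2 * (ν.re * (ν * lam).re) = (ν ^ 2 * lam).re + normSq ν * lam.re := by
    simp [normSq_apply, pow_two]; ring
  have h3 : (ν ^ 2 * lam).re ≤ normSq ν * ‖lam‖ := by
    refine (Complex.re_le_norm _).trans ?_
    rw [norm_mul, norm_pow, normSq_eq_norm_sq]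
  have h4 : normSq ν * 4 ≤ normSq ν * (‖lam‖ + lam.re) := by linarith
  exact le_of_mul_le_mul_left h4 hn

/-- `C_N` is the line `Re (ν z) = 0`. Disjointness makes `C_A` tangent to it at `0` and `C_B`
parallel to it, so the linear coefficients of both are negative multiples of `ν`. That the diameter
of disc `A` from `0` stays outside disc `B` is the hypothesis of `norm_add_re_ge`. -/
theorem four_le_of_forms {lam : ℂ} {QA QN QB : HForm} (dA : 0 < QA.disc) (dN : 0 < QN.disc)
    (dB : 0 < QB.disc) (hN1 : QN.ev ![1, 0] = 0) (hN2 : QN.ev ![0, 1] = 0)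
    (hA1 : QA.ev ![0, 1] = 0) (hA2 : QA.ev ![2, 1] = 0) (hB1 : QB.ev ![1, 0] = 0)
    (hB2 : QB.ev ![lam, 1] = 0) (hNA : ∀ v, QN.ev v < 0 → 0 < QA.ev v)
    (hNB : ∀ v, QN.ev v < 0 → 0 < QB.ev v) (hAB : ∀ v, QA.ev v < 0 → 0 < QB.ev v) :
    4 ≤ ‖lam‖ + lam.re := by
  obtain ⟨aA, cA, β⟩ := QA
  obtain ⟨aN, cN, ν⟩ := QN
  obtain ⟨aB, cB, γ⟩ := QB
  simp [HForm.ev] at hN1 hN2 hA1 hB1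
  subst hN1 hN2 hA1 hB1
  simp [HForm.disc] at dA dN dB
  have evA : ∀ z : ℂ, HForm.ev ⟨aA, 0, β⟩ ![z, 1] = aA * normSq z + 2 * (β * z).re := fun z => by
    simp [HForm.ev]
  have evN : ∀ z : ℂ, HForm.ev ⟨0, 0, ν⟩ ![z, 1] = 2 * (ν * z).re := fun z => by
    simp [HForm.ev]
  have evB : ∀ z : ℂ, HForm.ev ⟨0, cB, γ⟩ ![z, 1] = 2 * (γ * z).re + cB := fun z => by
    simp [HForm.ev]
  rw [evA] at hA2
  rw [evB] at hB2
  have hn := normSq_pos.2 dN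
  have hνz : ∀ (t : ℝ) (w : ℂ), (ν * (t * (conj ν * w))).re = t * normSq ν * w.re := by
    intro t w
    simp [normSq_apply]; ring
  have hNA' : ∀ z : ℂ, (ν * z).re < 0 → 0 < aA * normSq z + 2 * (β * z).re := by
    intro z hz
    rw [← evA]
    exact hNA _ (by rw [evN]; linarith)
  have hNB' : ∀ z : ℂ, (ν * z).re < 0 → 0 < 2 * (γ * z).re + cB := by
    intro z hz
    rw [← evB]
    exact hNB _ (by rw [evN]; linarith)
  have hβ : (β * conj ν).im = 0 ∧ (β * conj ν).re ≤ 0 := by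
    apply im_eq_zero_of_halfPlane
    intro w hw
    by_contra hX
    push Not at hX
    set X := (β * conj ν * w).re with hXdef
    set K := normSq (conj ν * w) with hK
    have hK0 : 0 ≤ K := normSq_nonneg _
    -- A point near `0`, where the linear term of the form decides its sign. The corresponding
    -- choice for `γ` is a point far away, where the constant term is negligible.
    set t := -X / (|aA| * K + 1) with ht
    have hden : 0 < |aA| * K + 1 := by positivity
    have ht0 : 0 < t := div_pos (by linarith) hden
    have h1 := hNA' (t * (conj ν * w)) (by
      rw [hνz]; exact mul_neg_of_pos_of_neg (by positivity) hw)
    have h2 : (β * (t * (conj ν * w))).re = t * X := by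
      rw [hXdef, ← re_ofReal_mul]; congr 1; ring
    rw [h2, normSq_mul, ← hK, normSq_ofReal] at h1
    have h3 : t * (|aA| * K + 1) = -X := div_mul_cancel₀ _ hden.ne'
    have h4 : aA * K ≤ |aA| * K := mul_le_mul_of_nonneg_right (le_abs_self _) hK0
    have h5 : 0 < t * (t * (aA * K) + 2 * X) := by linarith
    have h6 := pos_of_mul_pos_right h5 ht0.le
    have h7 := mul_le_mul_of_nonneg_left h4 ht0.le
    linarith
  have hγ : (γ * conj ν).im = 0 ∧ (γ * conj ν).re ≤ 0 := by
    apply im_eq_zero_of_halfPlane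
    intro w hw
    by_contra hX
    push Not at hX
    set X := (γ * conj ν * w).re with hXdef
    set t := (|cB| + 1) / (-2 * X) with ht
    have hden : 0 < -2 * X := by linarith
    have ht0 : 0 < t := by positivity
    have h1 := hNB' (t * (conj ν * w)) (by
      rw [hνz]; exact mul_neg_of_pos_of_neg (by positivity) hw)
    have h2 : (γ * (t * (conj ν * w))).re = t * X := by
      rw [hXdef, ← re_ofReal_mul]; congr 1; ring
    rw [h2] at h1
    have h3 : t * (-2 * X) = |cB| + 1 := div_mul_cancel₀ _ hden.ne'
    have := le_abs_self cB
    linarith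
  have hpos : ∀ {ζ : ℂ}, ζ ≠ 0 → (ζ * conj ν).im = 0 ∧ (ζ * conj ν).re ≤ 0 →
      ∃ k : ℝ, 0 < k ∧ ζ = -(k : ℂ) * ν := by
    intro ζ hζ ⟨him, hre⟩
    have hne : ζ * conj ν ≠ 0 := mul_ne_zero hζ (by simpa using dN)
    have hre' : (ζ * conj ν).re < 0 := lt_of_le_of_ne hre fun h => hne (Complex.ext h him)
    refine ⟨-(ζ * conj ν).re / normSq ν, div_pos (by linarith) hn, ?_⟩
    have h1 : ζ * conj ν = ((ζ * conj ν).re : ℂ) := Complex.ext (by simp) (by simpa using him)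
    have h2 : ζ * normSq ν = (ζ * conj ν).re * ν := by
      rw [← h1, ← mul_conj]; ring
    have h3 : (normSq ν : ℂ) ≠ 0 := by exact_mod_cast hn.ne'
    push_cast
    field_simp
    linear_combination h2
  obtain ⟨k, hk, rfl⟩ := hpos dA hβ
  obtain ⟨l, hl, rfl⟩ := hpos dB hγ
  refine norm_add_re_ge dN fun s hs hs2 => ?_
  have h1 : (-(k : ℂ) * ν * 2).re = -2 * k * ν.re := by simp; ring
  have h2 : (-(l : ℂ) * ν * lam).re = -l * (ν * lam).re := by
    rw [neg_mul, neg_mul, mul_assoc, neg_re, re_ofReal_mul]; ring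
  have h3 : aA = k * ν.re := by
    rw [h1] at hA2
    have : normSq (2 : ℂ) = 4 := by norm_num [normSq_apply]
    rw [this] at hA2
    linarith
  -- The points `s ν̄` with `0 < s` and `s Re ν < 2` lie on the diameter of disc `A` from `0`.
  have h4 := hAB ![(s : ℂ) * conj ν, 1] (by
    rw [evA, h3]
    have e1 : (-(k : ℂ) * ν * ((s : ℂ) * conj ν)).re = -k * s * normSq ν := by
      simp [normSq_apply]; ring
    rw [e1, normSq_mul, normSq_conj, normSq_ofReal]
    have : k * s * normSq ν * (s * ν.re - 2) < 0 :=
      mul_neg_of_pos_of_neg (by positivity) (by linarith)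
    linarith)
  have e2 : (-(l : ℂ) * ν * ((s : ℂ) * conj ν)).re = -l * s * normSq ν := by
    simp [normSq_apply]; ring
  rw [evB, e2] at h4
  rw [h2] at hB2
  have h5 : 0 < l * ((ν * lam).re - s * normSq ν) := by linarith
  have := pos_of_mul_pos_right h5 hl.le
  linarith

/-! ### Normal form of two parabolic matrices -/

/-- `S` is the transvection `x ↦ x + (cross v x) v`, and `v` spans its fixed line if `S ≠ 1`. Square
roots in `ℂ` absorb the scalar. -/
theorem exists_vector_of_trace_two {S : SL2C} (h : S.1.trace = 2) :
    ∃ v₁ v₂ : ℂ, S 0 0 = 1 - v₁ * v₂ ∧ S 0 1 = v₁ * v₁ ∧ S 1 0 = -(v₂ * v₂) ∧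
      S 1 1 = 1 + v₁ * v₂ := by
  rw [trace_sl] at h
  have hd := sl_det S
  have h11 : S 1 1 = 2 - S 0 0 := by linear_combination h
  rw [h11] at hd
  by_cases hb : S 0 1 = 0
  · obtain ⟨v, hv⟩ := IsAlgClosed.exists_eq_mul_self (-S 1 0)
    rw [hb] at hd
    have h0 : (S 0 0 - 1) ^ 2 = 0 := by linear_combination -hd
    have h1 : S 0 0 = 1 := sub_eq_zero.1 (pow_eq_zero_iff two_ne_zero |>.1 h0)
    exact ⟨0, v, by simp [h1], by simp [hb], by rw [← hv, neg_neg], by rw [h11, h1]; ring⟩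
  · obtain ⟨v, hv⟩ := IsAlgClosed.exists_eq_mul_self (S 0 1)
    have hv0 : v ≠ 0 := by rintro rfl; exact hb (by simpa using hv)
    refine ⟨v, (1 - S 0 0) / v, by field_simp; ring, hv, ?_, by rw [h11]; field_simp; ring⟩
    rw [hv] at hd
    field_simp
    linear_combination -hd

theorem mul_apply_sl (S T : SL2C) (i j : Fin 2) :
    (S * T) i j = S i 0 * T 0 j + S i 1 * T 1 j := by
  rw [Matrix.SpecialLinearGroup.coe_mul, Matrix.mul_apply, Fin.sum_univ_two]

theorem trace_mul_sl (S T : SL2C) : (S * T).1.trace =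
    S 0 0 * T 0 0 + S 0 1 * T 1 0 + (S 1 0 * T 0 1 + S 1 1 * T 1 1) := by
  rw [Matrix.SpecialLinearGroup.coe_mul, Matrix.trace_fin_two, Matrix.mul_apply, Matrix.mul_apply,
    Fin.sum_univ_two, Fin.sum_univ_two]

/-- Two parabolic matrices without common fixed point are simultaneously conjugate to the
standard ones. -/
theorem exists_conj_standard {S T : SL2C} (hS : S.1.trace = 2) (hT : T.1.trace = 2) {lam : ℂ}
    (h : (S * T).1.trace - 2 = 2 * lam) (hlam : lam ≠ 0) :
    ∃ P : SL2C, S = P * matS * P⁻¹ ∧ T = P * matT lam * P⁻¹ := by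
  obtain ⟨v₁, v₂, a1, a2, a3, a4⟩ := exists_vector_of_trace_two hS
  obtain ⟨w₁, w₂, b1, b2, b3, b4⟩ := exists_vector_of_trace_two hT
  have hω : (v₁ * w₂ - v₂ * w₁) ^ 2 = -(2 * lam) := by
    rw [trace_mul_sl, a1, a2, a3, a4, b1, b2, b3, b4] at h
    linear_combination -h
  set ω := v₁ * w₂ - v₂ * w₁ with hωdef
  have hω0 : ω ≠ 0 := by
    intro h0; rw [h0] at hω; apply hlam; linear_combination hω / 2
  have hI := I_mul_I
  have hIω : I * ω ≠ 0 := mul_ne_zero I_ne_zero hω0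
  -- `matS` and `matT lam` are the transvections along `(0, i)` and `(iω, 0)`, because `(iω)² = 2λ`;
  -- the columns make `P` carry these vectors to `v` and `w`.
  let P : SL2C := ⟨!![w₁ / (I * ω), -I * v₁; w₂ / (I * ω), -I * v₂], by
    rw [Matrix.det_fin_two_of]
    have : w₁ / (I * ω) * (-I * v₂) - -I * v₁ * (w₂ / (I * ω)) = (I * ω) / (I * ω) := by
      rw [hωdef]; ring
    rw [this, div_self hIω]⟩
  have key : ∀ {X : SL2C} {Y : SL2C}, X * P = P * Y → X = P * Y * P⁻¹ := fun h => by
    rw [← h]; simp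
  have hdiv : ∀ x : ℂ, x / (I * ω) * ω = -I * x := by
    intro x
    field_simp
    linear_combination x * hI
  refine ⟨P, key ?_, key ?_⟩
  · ext i j
    rw [Matrix.SpecialLinearGroup.coe_mul, Matrix.SpecialLinearGroup.coe_mul, Matrix.mul_apply,
      Matrix.mul_apply, Fin.sum_univ_two, Fin.sum_univ_two]
    fin_cases i <;> fin_cases j <;> simp [P, matS, a1, a2, a3, a4]
    · linear_combination v₁ * hdiv 1
    · ring
    · linear_combination v₂ * hdiv 1
    · ring
  · ext i j
    rw [Matrix.SpecialLinearGroup.coe_mul, Matrix.SpecialLinearGroup.coe_mul, Matrix.mul_apply,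
      Matrix.mul_apply, Fin.sum_univ_two, Fin.sum_univ_two]
    fin_cases i <;> fin_cases j <;> simp [P, matT, b1, b2, b3, b4]
    · ring
    · have := hdiv (w₁ * ω)
      linear_combination (-w₁ / (I * ω)) * hω + this
    · ring
    · have := hdiv (w₂ * ω)
      linear_combination (-w₂ / (I * ω)) * hω + this

/-! ### Necessity of the inequality -/

theorem HForm.ev_eq_zero_of_eigen {Q : HForm} {H : SL2C} (h : ∀ v, Q.ev (H.1 *ᵥ v) = -Q.ev v)
    {v : Fin 2 → ℂ} {c : ℂ} (hc : H.1 *ᵥ v = c • v) : Q.ev v = 0 := by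
  have h1 := h v
  rw [hc, ev_smul] at h1
  have h2 : (normSq c + 1) * Q.ev v = 0 := by linarith
  exact (mul_eq_zero.1 h2).resolve_left (by have := normSq_nonneg c; positivity)

theorem trace_eq_zero_of_sq {H : SL2C} (h : H * H = -1) : H 1 1 = -H 0 0 := by
  have hd := sl_det H
  have h1 : (H * H).1 = -1 := by rw [h]; simp
  rw [Matrix.SpecialLinearGroup.coe_mul] at h1
  have e00 := congrFun (congrFun h1 0) 0
  have e11 := congrFun (congrFun h1 1) 1
  rw [Matrix.mul_apply, Fin.sum_univ_two] at e00 e11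
  simp at e00 e11
  have : (H 0 0 + H 1 1) ^ 2 = 0 := by linear_combination e00 + e11 + 2 * hd
  have := pow_eq_zero_iff two_ne_zero |>.1 this
  linear_combination this

namespace HalfTurnSystem

/-- Once the parabolics are standard, the half-turns are determined: `N`, `matS * N` and `matT lam *
N` are half-turns up to sign, hence of trace zero, which makes `N` diagonal. The ends are therefore
`0, 2`, `0, ∞` and `λ, ∞`. -/
theorem four_le (S : HalfTurnSystem) {a n b : Fin 3} (han : a ≠ n) (hab : a ≠ b) (hnb : n ≠ b)
    (L : SL2C) {lam : ℂ} (hlam : lam ≠ 0)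
    (hs : toPSL matS = toPSL (L * (S.H a * S.H n) * L⁻¹))
    (ht : toPSL (matT lam) = toPSL (L * (S.H b * S.H n) * L⁻¹)) : 4 ≤ ‖lam‖ + lam.re := by
  let H' : Fin 3 → SL2C := fun i => L * S.H i * L⁻¹
  let Q' : Fin 3 → HForm := fun i => (S.Q i).comap L⁻¹
  have hsq : ∀ i, H' i * H' i = -1 := by
    intro i
    have : H' i * H' i = L * (S.H i * S.H i) * L⁻¹ := by simp only [H']; group
    rw [this, S.sq]; simp
  have hanti : ∀ i v, (Q' i).ev ((H' i).1 *ᵥ v) = -(Q' i).ev v := by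
    intro i v
    simp only [Q', H', HForm.ev_comap]
    rw [← S.anti, ← mul_mulVec, ← mul_mulVec,
      show L⁻¹ * (L * S.H i * L⁻¹) = S.H i * L⁻¹ by rw [mul_assoc, inv_mul_cancel_left]]
  have hdisj : ∀ i j, i ≠ j → ∀ v, (Q' i).ev v < 0 → 0 < (Q' j).ev v := by
    intro i j hij v hv
    simp only [Q', HForm.ev_comap] at hv ⊢
    exact S.disj i j hij _ hv
  have hdisc : ∀ i, 0 < (Q' i).disc := fun i => by
    simp only [Q', HForm.disc_comap]; exact S.disc_pos i
  have hconj : ∀ i, ∀ M : SL2C, toPSL M = toPSL (L * (S.H i * S.H n) * L⁻¹) →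
      H' i = M * H' n ∨ H' i = -(M * H' n) := by
    intro i M hM
    have e : L * (S.H i * S.H n) * L⁻¹ = H' i * H' n := by simp only [H']; group
    rw [e, toPSL_eq_iff] at hM
    rcases hM with rfl | rfl
    · right; rw [mul_assoc, hsq]; simp
    · left; rw [neg_mul, mul_assoc, hsq]; simp
  have htr := fun i => trace_eq_zero_of_sq (hsq i)
  set N := H' n with hN
  have hN11 : N 1 1 = -N 0 0 := htr n
  have eS : ∀ i, H' i = matS * N ∨ H' i = -(matS * N) → N 0 1 = 0 := by
    intro i hi
    have h1 := htr i
    rcases hi with hi | hi <;> rw [hi] at h1 <;>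
      simp only [mul_apply_sl, Matrix.SpecialLinearGroup.coe_neg, Matrix.neg_apply] at h1 <;> simp [matS, hN11] at h1 <;> exact h1
  have eT : ∀ i, H' i = matT lam * N ∨ H' i = -(matT lam * N) → N 1 0 = 0 := by
    intro i hi
    have h1 := htr i
    rcases hi with hi | hi <;> rw [hi] at h1 <;>
      simp only [mul_apply_sl, Matrix.SpecialLinearGroup.coe_neg, Matrix.neg_apply] at h1 <;> simp [matT, hN11] at h1 <;> exact h1.resolve_left hlam
  have hA := hconj a matS hs
  have hB := hconj b (matT lam) ht
  have h01 := eS a hA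
  have h10 := eT b hB
  have neg_case : ∀ {i : Fin 3} {X : SL2C} {v : Fin 2 → ℂ} {c : ℂ},
      H' i = X ∨ H' i = -X → X.1 *ᵥ v = c • v → (Q' i).ev v = 0 := by
    intro i X v c hi hc
    rcases hi with hi | hi
    · exact HForm.ev_eq_zero_of_eigen (hanti i) (hi ▸ hc)
    · refine HForm.ev_eq_zero_of_eigen (c := -c) (hanti i) ?_
      rw [hi, neg_mulVec_sl, hc, neg_smul]
  refine four_le_of_forms (hdisc a) (hdisc n) (hdisc b) (neg_case (c := N 0 0) (Or.inl hN.symm) ?_)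
    (neg_case (c := -N 0 0) (Or.inl hN.symm) ?_) (neg_case (c := -N 0 0) hA ?_)
    (neg_case (c := N 0 0) hA ?_) (neg_case (c := N 0 0) hB ?_) (neg_case (c := -N 0 0) hB ?_)
    (hdisj n a han.symm) (hdisj n b hnb) (hdisj a b hab)
  all_goals
    ext i
    fin_cases i <;> simp only [mulVec_zero_apply, mulVec_one_apply, mul_apply_sl, Fin.zero_eta,
      Fin.mk_one] <;> simp [matS, matT, h01, h10, hN11] <;> ring

end HalfTurnSystem

/-- By Cayley–Hamilton `S⁻¹ = 2 - S`, so the two traces add up to `2 tr T = 4`. -/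
theorem trace_mul_inv_left {S T : SL2C} (hS : S.1.trace = 2) (hT : T.1.trace = 2) :
    (S⁻¹ * T).1.trace - 2 = -((S * T).1.trace - 2) := by
  rw [trace_sl] at hS hT
  rw [trace_mul_sl, trace_mul_sl, Matrix.SpecialLinearGroup.SL2_inv_expl]
  simp
  have h1 : S 1 1 = 2 - S 0 0 := by linear_combination hS
  have h2 : T 1 1 = 2 - T 0 0 := by linear_combination hT
  rw [h1, h2]; ring

theorem trace_mul_inv_right {S T : SL2C} (hS : S.1.trace = 2) (hT : T.1.trace = 2) :
    (S * T⁻¹).1.trace - 2 = -((S * T).1.trace - 2) := by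
  have h1 := trace_mul_inv_left hT hS
  have h2 : ∀ X Y : SL2C, (X * Y).1.trace = (Y * X).1.trace := fun X Y => by
    rw [Matrix.SpecialLinearGroup.coe_mul, Matrix.trace_mul_comm, ← Matrix.SpecialLinearGroup.coe_mul]
  rw [h2 S, h2 S, h1]

theorem eight_le_of_isNSDC {S T : SL2C} (hS : S.1.trace = 2) (hT : T.1.trace = 2)
    (hST : (S * T).1.trace ≠ 2) (h : IsNSDC (generatedBy S T)) :
    8 ≤ ‖(S * T).1.trace - 2‖ + |((S * T).1.trace - 2).re| := by
  obtain ⟨A, B, hAB, hm⟩ := h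
  obtain ⟨Y, rfl, rfl⟩ := hm.exists_system
  have hmap : Subgroup.closure {Y.h 0 * Y.h 1, Y.h 2 * Y.h 1} = W.even.map Y.φ := by
    rw [W.even, MonoidHom.map_closure]
    simp [Set.image_insert_eq, Y.φ_s]
  rw [hmap] at hAB
  have hmemS : toPSL S ∈ W.even.map Y.φ := by
    rw [hAB]; exact Subgroup.subset_closure (by simp)
  have hmemT : toPSL T ∈ W.even.map Y.φ := by
    rw [hAB]; exact Subgroup.subset_closure (by simp)
  obtain ⟨x, hx, hxS⟩ := hmemS
  obtain ⟨y, hy, hyT⟩ := hmemT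
  have hxy : Subgroup.closure {x, y} = W.even := by
    apply Subgroup.map_injective Y.φ_injective
    rw [hAB, MonoidHom.map_closure, generatedBy, ← hxS, ← hyT]
    simp [Set.image_insert_eq]
  have hS1 : S ≠ 1 := by rintro rfl; rw [one_mul] at hST; exact hST hT
  have hT1 : T ≠ 1 := by rintro rfl; rw [mul_one] at hST; exact hST hS
  obtain ⟨p, hp⟩ := IsParab.of_trace hS hS1
  obtain ⟨q, hq⟩ := IsParab.of_trace hT hT1
  rw [← hxS] at hp
  rw [← hyT] at hq
  obtain ⟨a, n, b, g, han, hab, hnb, hxg, hyg⟩ :=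
    HalfTurnSystem.exists_normal_form hxy hp hq
  obtain ⟨G, hG⟩ := toPSL_surjective (Y.φ g)
  have hφ : ∀ i, Y.φ (g * (W.s i * W.s n) * g⁻¹) = toPSL (G * (Y.H i * Y.H n) * G⁻¹) := by
    intro i
    simp only [map_mul, map_inv, hG, Y.φ_s]; rfl
  have hφ' : ∀ i, Y.φ (g * (W.s i * W.s n)⁻¹ * g⁻¹) = (toPSL (G * (Y.H i * Y.H n) * G⁻¹))⁻¹ := by
    intro i
    rw [← hφ, ← map_inv]; congr 1; group
  -- The normal form determines `S` and `T` only up to inversion, which changes `tr - 2` at most by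
  -- a sign; the absolute value of the real part covers both signs.
  have main : ∀ S' T' : SL2C, S'.1.trace = 2 → T'.1.trace = 2 →
      toPSL S' = toPSL (G * (Y.H a * Y.H n) * G⁻¹) →
      toPSL T' = toPSL (G * (Y.H b * Y.H n) * G⁻¹) →
      ((S' * T').1.trace - 2 = (S * T).1.trace - 2 ∨
        (S' * T').1.trace - 2 = -((S * T).1.trace - 2)) →
      8 ≤ ‖(S * T).1.trace - 2‖ + |((S * T).1.trace - 2).re| := by
    intro S' T' hS' hT' hs ht htr
    set τ := (S * T).1.trace - 2
    have hτ : τ ≠ 0 := sub_ne_zero.2 hST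
    set τ' := (S' * T').1.trace - 2 with hτ'
    have hτ0 : τ' ≠ 0 := by
      rcases htr with h | h <;> rw [h]
      · exact hτ
      · exact neg_ne_zero.2 hτ
    obtain ⟨P, hPS, hPT⟩ := exists_conj_standard hS' hT' (lam := τ' / 2) (by rw [← hτ']; ring)
      (div_ne_zero hτ0 two_ne_zero)
    have h4 := Y.four_le han hab hnb (P⁻¹ * G) (lam := τ' / 2) (div_ne_zero hτ0 two_ne_zero)
      (by
        have : P⁻¹ * G * (Y.H a * Y.H n) * (P⁻¹ * G)⁻¹ =
          P⁻¹ * (G * (Y.H a * Y.H n) * G⁻¹) * P := by group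
        rw [this, map_mul, map_mul, ← hs, ← map_mul, ← map_mul, hPS]
        congr 1; group)
      (by
        have : P⁻¹ * G * (Y.H b * Y.H n) * (P⁻¹ * G)⁻¹ =
          P⁻¹ * (G * (Y.H b * Y.H n) * G⁻¹) * P := by group
        rw [this, map_mul, map_mul, ← ht, ← map_mul, ← map_mul, hPT]
        congr 1; group)
    rw [norm_div, Complex.norm_ofNat, Complex.div_ofNat_re] at h4
    have h5 : 8 ≤ ‖τ'‖ + |τ'.re| := by
      have := le_abs_self τ'.re
      linarith
    rcases htr with h | h <;> rw [h] at h5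
    · exact h5
    · rwa [norm_neg, neg_re, abs_neg] at h5
  rcases hxg with hxg | hxg <;> rcases hyg with hyg | hyg
  · exact main S T hS hT (by rw [← hxS, hxg, hφ]) (by rw [← hyT, hyg, hφ]) (Or.inl rfl)
  · exact main S T⁻¹ hS (by rw [trace_inv, hT]) (by rw [← hxS, hxg, hφ])
      (by rw [map_inv, ← hyT, hyg, hφ', inv_inv]) (Or.inr (trace_mul_inv_right hS hT))
  · exact main S⁻¹ T (by rw [trace_inv, hS]) hT (by rw [map_inv, ← hxS, hxg, hφ', inv_inv])
      (by rw [← hyT, hyg, hφ]) (Or.inr (trace_mul_inv_left hS hT))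
  · refine main S⁻¹ T⁻¹ (by rw [trace_inv, hS]) (by rw [trace_inv, hT])
      (by rw [map_inv, ← hxS, hxg, hφ', inv_inv]) (by rw [map_inv, ← hyT, hyg, hφ', inv_inv])
      (Or.inl ?_)
    rw [trace_mul_inv_left hS (by rw [trace_inv, hT]), trace_mul_inv_right hS hT, neg_neg]

end TwoParabolic
end

noncomputable section

namespace TwoParabolic

open Complex Matrix
open scoped ComplexConjugate

/-! ### Möbius transformations preserve circles and connectedness -/

theorem HForm.at_smul_pos_iff (Q : HForm) (g : SL2C) (z : Sphere) :
    0 < Q.at' (toPSL g • z) ↔ 0 < (Q.comap g).at' z := by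
  obtain ⟨r, hr, h⟩ := Q.at_smul g z
  rw [HForm.at', HForm.at', HForm.ev_comap, h, mul_pos_iff_of_pos_left hr, HForm.at']

/-- The positive sides of forms are a basis of the topology, and pull-back along a Möbius
transformation permutes them; continuity of the action follows. -/
theorem exists_form_nhds {U : Set Sphere} (hU : IsOpen U) {x : Sphere} (hx : x ∈ U) :
    ∃ Q : HForm, 0 < Q.at' x ∧ ∀ z, 0 < Q.at' z → z ∈ U := by
  induction x using OnePoint.rec with
  | infty =>
    obtain ⟨-, hK⟩ := (OnePoint.isOpen_iff_of_mem hx).1 hU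
    obtain ⟨R, hR⟩ := hK.isBounded.subset_closedBall 0
    refine ⟨⟨1, -R ^ 2, 0⟩, by simp [HForm.at', HForm.ev], fun z hz => ?_⟩
    induction z using OnePoint.rec with
    | infty => exact hx
    | coe z =>
      by_contra hzU
      have h1 := hR (show z ∈ _ from hzU)
      rw [mem_closedBall_zero_iff] at h1
      simp [HForm.at', HForm.ev, normSq_eq_norm_sq] at hz
      have := norm_nonneg z
      nlinarith
  | coe x =>
    obtain ⟨r, hr, hb⟩ := Metric.isOpen_iff.1 (hU.preimage OnePoint.continuous_coe) x hx
    have key : ∀ z : ℂ, HForm.at' ⟨-1, r ^ 2 - normSq x, conj x⟩ z = r ^ 2 - ‖z - x‖ ^ 2 := by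
      intro z
      simp [HForm.at', HForm.ev, ← normSq_eq_norm_sq, normSq_apply]
      ring
    refine ⟨⟨-1, r ^ 2 - normSq x, conj x⟩, by rw [key]; simp; positivity, fun z hz => ?_⟩
    induction z using OnePoint.rec with
    | infty => simp [HForm.at', HForm.ev] at hz; linarith
    | coe z =>
      rw [key] at hz
      apply hb
      rw [mem_ball_iff_norm]
      exact lt_of_pow_lt_pow_left₀ 2 hr.le (by linarith)

theorem continuous_smul_sphere (g : PSL2C) : Continuous fun z : Sphere => g • z := by
  obtain ⟨g, rfl⟩ := toPSL_surjective g
  rw [continuous_def]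
  intro U hU
  rw [isOpen_iff_forall_mem_open]
  intro x hx
  obtain ⟨Q, hQx, hQ⟩ := exists_form_nhds hU hx
  refine ⟨{z | 0 < (Q.comap g).at' z}, fun z hz => ?_, HForm.isOpen_pos _,
    (Q.at_smul_pos_iff g x).1 hQx⟩
  exact hQ _ ((Q.at_smul_pos_iff g z).2 hz)

theorem HForm.image_zeros (Q : HForm) (g : SL2C) :
    (fun z => toPSL g • z) '' Q.zeros = (Q.comap g⁻¹).zeros := by
  ext z
  obtain ⟨r, hr, h⟩ := Q.at_smul g⁻¹ z
  have h1 : z ∈ (Q.comap g⁻¹).zeros ↔ toPSL g⁻¹ • z ∈ Q.zeros := by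
    rw [HForm.zeros, HForm.zeros, Set.mem_ofPred_eq, Set.mem_ofPred_eq, HForm.at', HForm.ev_comap,
      h, mul_eq_zero, or_iff_right hr.ne']
  rw [h1, map_inv]
  constructor
  · rintro ⟨w, hw, rfl⟩
    simpa using hw
  · intro hz
    exact ⟨_, hz, by simp⟩

theorem IsCircle.image {C : Set Sphere} (h : IsCircle C) (g : PSL2C) :
    IsCircle ((fun z => g • z) '' C) := by
  obtain ⟨g, rfl⟩ := toPSL_surjective g
  obtain ⟨Q, hQ, rfl⟩ := isCircle_exists_form h
  rw [HForm.image_zeros]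
  exact isCircle_zeros (by rwa [HForm.disc_comap])

theorem DisjointOrTangent.image {C D : Set Sphere} (h : DisjointOrTangent C D) (g : PSL2C) :
    DisjointOrTangent ((fun z => g • z) '' C) ((fun z => g • z) '' D) := by
  rw [DisjointOrTangent, ← Set.image_inter (MulAction.injective g)]
  exact Set.Subsingleton.image h _

theorem not_separates_image {C D E : Set Sphere} (h : ¬ Separates C D E) (g : PSL2C) :
    ¬ Separates ((fun z => g • z) '' C) ((fun z => g • z) '' D) ((fun z => g • z) '' E) := by
  rw [Separates, not_not] at h ⊢
  obtain ⟨P, hP, hPC, ⟨x, hxP, hxD⟩, ⟨y, hyP, hyE⟩⟩ := h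
  refine ⟨(fun z => g • z) '' P, hP.image _ (continuous_smul_sphere g).continuousOn, ?_,
    ⟨_, ⟨x, hxP, rfl⟩, ⟨x, hxD, rfl⟩⟩, ⟨_, ⟨y, hyP, rfl⟩, ⟨y, hyE, rfl⟩⟩⟩
  rintro _ ⟨z, hz, rfl⟩ ⟨w, hw, hwz⟩
  exact hPC hz (MulAction.injective g hwz ▸ hw)

theorem HasNSDCProperty.smul {a a' n n' b b' : Sphere} (h : HasNSDCProperty a a' n n' b b')
    (g : PSL2C) : HasNSDCProperty (g • a) (g • a') (g • n) (g • n') (g • b) (g • b') := by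
  obtain ⟨ha, hn, hb, CA, CN, CB, cA, cN, cB, h1, h2, h3, h4, h5, h6, d1, d2, d3, s1, s2, s3⟩ := h
  have hinj := MulAction.injective (β := Sphere) g
  have hmem : ∀ {x : Sphere} {C : Set Sphere}, x ∈ C → g • x ∈ (fun z => g • z) '' C :=
    fun hx => ⟨_, hx, rfl⟩
  exact ⟨hinj.ne ha, hinj.ne hn, hinj.ne hb, _, _, _, cA.image g, cN.image g, cB.image g,
    hmem h1, hmem h2, hmem h3, hmem h4, hmem h5, hmem h6, d1.image g, d2.image g, d3.image g,
    not_separates_image s1 g, not_separates_image s2 g, not_separates_image s3 g⟩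

/-! ### Conjugation of half-turns, axes and ortho-ends -/

theorem conj_smul_smul (g h : PSL2C) (z : Sphere) : (g * h * g⁻¹) • g • z = g • h • z := by
  rw [← mul_smul, ← mul_smul, inv_mul_cancel_right]

theorem IsHalfTurn.conj {h : PSL2C} {x y : Sphere} (H : IsHalfTurn h x y) (g : PSL2C) :
    IsHalfTurn (g * h * g⁻¹) (g • x) (g • y) := by
  obtain ⟨h1, h2, h3, h4, h5⟩ := H
  refine ⟨(MulAction.injective g).ne h1, ?_, ?_, ?_, ?_⟩
  · rwa [Ne, conj_eq_one_iff]
  · rw [conj_mul, h3]; simp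
  · rw [conj_smul_smul, h4]
  · rw [conj_smul_smul, h5]

theorem IsAxis.conj {A : PSL2C} {u v : Sphere} (h : IsAxis A u v) (g : PSL2C) :
    IsAxis (g * A * g⁻¹) (g • u) (g • v) := by
  rw [IsAxis] at h ⊢
  ext z
  have hz : (g * A * g⁻¹) • z = z ↔ g⁻¹ • z ∈ {w : Sphere | A • w = w} := by
    rw [Set.mem_ofPred_eq, eq_inv_smul_iff, ← mul_smul, ← mul_smul, mul_assoc]
  rw [Set.mem_ofPred_eq, hz, h]
  simp [inv_smul_eq_iff]

theorem IsPerp.conj {x y u v : Sphere} (h : IsPerp x y u v) (g : PSL2C) :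
    IsPerp (g • x) (g • y) (g • u) (g • v) := by
  obtain ⟨t, ht, huv⟩ := h
  exact ⟨g * t * g⁻¹, ht.conj g, by rw [conj_smul_smul, huv]⟩

theorem IsOrthoEnd.conj {A B : PSL2C} {a a' n n' b b' : Sphere}
    (h : IsOrthoEnd A B a a' n n' b b') (g : PSL2C) :
    IsOrthoEnd (g * A * g⁻¹) (g * B * g⁻¹) (g • a) (g • a') (g • n) (g • n') (g • b) (g • b') := by
  obtain ⟨⟨u, v, h1, h2⟩, ⟨u', v', h3, h4⟩, ⟨hA, hN, hB, h5, h6, h7, rfl, rfl⟩⟩ := h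
  exact ⟨⟨_, _, h1.conj g, h2.conj g⟩, ⟨_, _, h3.conj g, h4.conj g⟩,
    ⟨_, _, _, h5.conj g, h6.conj g, h7.conj g, by rw [conj_mul], by rw [conj_mul]⟩⟩

/-! ### Elementary groups with two parabolic generators -/

/-- For transvections along `v` and `w`, `tr(ST) - 2 = -(cross v w)²`; if this vanishes, there is a
common fixed point. -/
theorem isElementary_of_trace_eq_two {S T : SL2C} (hS : S.1.trace = 2) (hT : T.1.trace = 2)
    (h : (S * T).1.trace = 2) : IsElementary (generatedBy S T) := by
  obtain ⟨v₁, v₂, a1, a2, a3, a4⟩ := exists_vector_of_trace_two hS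
  obtain ⟨w₁, w₂, b1, b2, b3, b4⟩ := exists_vector_of_trace_two hT
  have hω : v₁ * w₂ - v₂ * w₁ = 0 := by
    rw [trace_mul_sl, a1, a2, a3, a4, b1, b2, b3, b4] at h
    have : (v₁ * w₂ - v₂ * w₁) ^ 2 = 0 := by linear_combination -h
    exact pow_eq_zero_iff two_ne_zero |>.1 this
  obtain ⟨u, hu, hv, hw⟩ : ∃ u : Fin 2 → ℂ, u ≠ 0 ∧ v₁ * u 1 - v₂ * u 0 = 0 ∧
      w₁ * u 1 - w₂ * u 0 = 0 := by
    by_cases hv : v₁ = 0 ∧ v₂ = 0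
    · by_cases hw : w₁ = 0 ∧ w₂ = 0
      · exact ⟨![1, 0], by simp, by simp [hv], by simp [hw]⟩
      · refine ⟨![w₁, w₂], fun h0 => hw ⟨?_, ?_⟩, by simp [hv], by simp; ring⟩
        · simpa using congrFun h0 0
        · simpa using congrFun h0 1
    · refine ⟨![v₁, v₂], fun h0 => hv ⟨?_, ?_⟩, by simp; ring, by simp; linear_combination -hω⟩
      · simpa using congrFun h0 0
      · simpa using congrFun h0 1
  obtain ⟨z, c, hc, hz⟩ := exists_point hu
  have hSu : S.1 *ᵥ u = u := by
    ext i; fin_cases i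
    · simp only [Fin.zero_eta, mulVec_zero_apply, a1, a2]; linear_combination v₁ * hv
    · simp only [Fin.mk_one, mulVec_one_apply, a3, a4]; linear_combination v₂ * hv
  have hTu : T.1 *ᵥ u = u := by
    ext i; fin_cases i
    · simp only [Fin.zero_eta, mulVec_zero_apply, b1, b2]; linear_combination w₁ * hw
    · simp only [Fin.mk_one, mulVec_one_apply, b3, b4]; linear_combination w₂ * hw
  have hfix : ∀ X : SL2C, X.1 *ᵥ u = u → toPSL X • z = z := by
    intro X hX
    rw [smul_eq_iff]
    refine ⟨1, ?_⟩
    have : vec z = c⁻¹ • u := by rw [hz, smul_smul, inv_mul_cancel₀ hc, one_smul]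
    rw [one_smul, this, Matrix.mulVec_smul, hX]
  have hle : generatedBy S T ≤ MulAction.stabilizer PSL2C z := by
    rw [generatedBy, Subgroup.closure_le]
    rintro g (rfl | rfl)
    · exact hfix S hSu
    · exact hfix T hTu
  refine Or.inl ⟨z, (Set.finite_singleton z).subset ?_⟩
  rintro w ⟨g, hg, rfl⟩
  exact hle hg

/-- Some power `X ^ d = 1 + d (X - 1)` with `d ≠ 0` fixes the point, and its eigenvectors are those
of `X`. -/
theorem fix_of_finite_orbit {X : SL2C} (hX : X.1.trace = 2) {z : Sphere}
    (h : (Set.range fun n : ℕ => toPSL (X ^ n) • z).Finite) : X.1 *ᵥ vec z = vec z := by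
  have hni : ¬ Function.Injective fun n : ℕ => toPSL (X ^ n) • z := fun hinj =>
    Set.infinite_range_of_injective hinj h
  obtain ⟨d, hd, hfix⟩ : ∃ d : ℕ, d ≠ 0 ∧ toPSL (X ^ d) • z = z := by
    simp only [Function.Injective, not_forall] at hni
    obtain ⟨m, n, hmn, hne⟩ := hni
    wlog hlt : m < n generalizing m n
    · exact this n m hmn.symm (Ne.symm hne) (by omega)
    refine ⟨n - m, by omega, ?_⟩
    have e : X ^ n = X ^ m * X ^ (n - m) := by rw [← pow_add]; congr 1; omega
    simp only [e] at hmn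
    rw [map_mul, mul_smul] at hmn
    exact (MulAction.injective _ hmn).symm
  rw [smul_eq_iff] at hfix
  obtain ⟨c, hc⟩ := hfix
  rw [pow_mulVec_of_trace_two hX] at hc
  have hd' : (d : ℂ) ≠ 0 := by exact_mod_cast hd
  refine fix_of_eigen hX (vec_ne_zero z) (c := 1 + (c - 1) / d) ?_
  have h1 : X.1 *ᵥ vec z - vec z = ((c - 1) / d) • vec z := by
    rw [div_eq_inv_mul, mul_smul, sub_smul, one_smul, ← hc, add_sub_cancel_left, smul_smul,
      inv_mul_cancel₀ hd', one_smul]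
  rw [add_smul, one_smul, ← h1, add_sub_cancel]

theorem pow_apply_of_trace_two {X : SL2C} (hX : X.1.trace = 2) (n : ℕ) :
    (X ^ n) 0 0 = 1 + n * (X 0 0 - 1) ∧ (X ^ n) 0 1 = n * X 0 1 ∧ (X ^ n) 1 0 = n * X 1 0 ∧
      (X ^ n) 1 1 = 1 + n * (X 1 1 - 1) := by
  have h0 := pow_mulVec_of_trace_two hX ![1, 0] n
  have h1 := pow_mulVec_of_trace_two hX ![0, 1] n
  have e00 := congrFun h0 0
  have e01 := congrFun h0 1
  have e10 := congrFun h1 0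
  have e11 := congrFun h1 1
  simp only [Pi.add_apply, Pi.smul_apply, Pi.sub_apply, mulVec_zero_apply, mulVec_one_apply]
    at e00 e01 e10 e11
  simp [-Matrix.SpecialLinearGroup.coe_pow] at e00 e01 e10 e11
  exact ⟨e00, e10, e01, e11⟩

/-- If `X` fixes `∞` it is a nonzero translation. Otherwise the denominators grow at least like
`n²`, so the heights along the orbit tend to `0` without reaching it. -/
theorem infinite_halfSpace_orbit {X : SL2C} (hX : X.1.trace = 2) (h1 : X ≠ 1) {p : ℂ × ℝ}
    (hp : 0 < p.2) : ¬ (Set.range fun n : ℕ => halfSpaceMap (X ^ n) p).Finite := by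
  intro hfin
  have hpow := fun n : ℕ => pow_apply_of_trace_two hX n
  by_cases hc : X 1 0 = 0
  · have hd := sl_det X
    rw [trace_sl] at hX
    rw [hc] at hd
    have h00 : X 0 0 = 1 := by
      have : (X 0 0 - 1) ^ 2 = 0 := by linear_combination X 0 0 * hX - hd
      exact sub_eq_zero.1 (pow_eq_zero_iff two_ne_zero |>.1 this)
    have h11 : X 1 1 = 1 := by linear_combination hX - h00
    have hb : X 0 1 ≠ 0 := by
      intro hb
      apply h1
      ext i j
      fin_cases i <;> fin_cases j <;> simp [h00, h11, hb, hc]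
    refine Set.infinite_range_of_injective (fun m n hmn => ?_) hfin
    have := congrArg Prod.fst hmn
    simp only [halfSpaceMap, hpow, h00, h11, hc] at this
    simpa [hb] using this
  · obtain ⟨M, hM⟩ := (hfin.image fun q : ℂ × ℝ => p.2 / q.2).bddAbove
    have hcn : 0 < ‖X 1 0‖ ^ 2 * p.2 ^ 2 := by positivity
    have hbound : ∀ n : ℕ, (n : ℝ) ^ 2 * (‖X 1 0‖ ^ 2 * p.2 ^ 2) ≤ M := by
      intro n
      refine le_trans ?_ (hM ⟨_, ⟨n, rfl⟩, rfl⟩)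
      simp only [halfSpaceMap]
      rw [div_div_cancel₀ hp.ne', (hpow n).2.2.1, norm_mul, Complex.norm_natCast]
      have : 0 ≤ ‖(n : ℂ) * X 1 0 * p.1 + (X ^ n) 1 1‖ ^ 2 := by positivity
      linarith
    obtain ⟨n, hn⟩ := exists_nat_gt (M / (‖X 1 0‖ ^ 2 * p.2 ^ 2) + 1)
    have hM0 : 0 ≤ M := by simpa using hbound 0
    have h2 : 0 ≤ M / (‖X 1 0‖ ^ 2 * p.2 ^ 2) := by positivity
    have h3 := hbound n
    rw [← le_div_iff₀ hcn] at h3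
    nlinarith

theorem not_isElementary {S T : SL2C} (hS : S.1.trace = 2) (hT : T.1.trace = 2)
    (h : (S * T).1.trace ≠ 2) : ¬ IsElementary (generatedBy S T) := by
  have hmS : ∀ n : ℕ, toPSL (S ^ n) ∈ generatedBy S T := fun n => by
    rw [map_pow]; exact Subgroup.pow_mem _ (Subgroup.subset_closure (by simp)) n
  have hmT : ∀ n : ℕ, toPSL (T ^ n) ∈ generatedBy S T := fun n => by
    rw [map_pow]; exact Subgroup.pow_mem _ (Subgroup.subset_closure (by simp)) n
  rintro (⟨z, hz⟩ | ⟨p, hp, hfin⟩)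
  · have fS := fix_of_finite_orbit hS (hz.subset (by rintro _ ⟨n, rfl⟩; exact ⟨_, hmS n, rfl⟩))
    have fT := fix_of_finite_orbit hT (hz.subset (by rintro _ ⟨n, rfl⟩; exact ⟨_, hmT n, rfl⟩))
    have fST : (S * T).1 *ᵥ vec z = vec z := by rw [mul_mulVec, fT, fS]
    apply h
    have e0 := congrFun fST 0
    have e1 := congrFun fST 1
    rw [mulVec_zero_apply] at e0
    rw [mulVec_one_apply] at e1
    have hd := sl_det (S * T)
    rw [trace_sl]
    -- `det (ST - 1) = 2 - tr(ST)` would be nonzero, so `ST` would fix no nonzero vector.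
    by_contra hne
    have h0 : vec z 0 = 0 := by
      have : ((S * T) 0 0 + (S * T) 1 1 - 2) * vec z 0 = 0 := by
        linear_combination -((S * T) 1 1 - 1) * e0 + (S * T) 0 1 * e1 + vec z 0 * hd
      exact (mul_eq_zero.1 this).resolve_left (sub_ne_zero.2 hne)
    have h1 : vec z 1 = 0 := by
      have : ((S * T) 0 0 + (S * T) 1 1 - 2) * vec z 1 = 0 := by
        linear_combination -((S * T) 0 0 - 1) * e1 + (S * T) 1 0 * e0 + vec z 1 * hd
      exact (mul_eq_zero.1 this).resolve_left (sub_ne_zero.2 hne)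
    exact vec_ne_zero z (by ext i; fin_cases i <;> assumption)
  · refine infinite_halfSpace_orbit hS (fun h1 => ?_) hp
      (hfin.subset (by rintro _ ⟨n, rfl⟩; exact ⟨_, hmS n, rfl⟩))
    rw [h1, one_mul] at h
    exact h hT

end TwoParabolic
end

noncomputable section

namespace TwoParabolic

open Complex Matrix
open scoped ComplexConjugate

/-! ### The standard configuration of circles -/

theorem isHalfTurn_of_sq {X : SL2C} (h : X * X = -1) {x y : Sphere} (hxy : x ≠ y)
    (hx : toPSL X • x = x) (hy : toPSL X • y = y) : IsHalfTurn (toPSL X) x y := by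
  have h1 : (1 : SL2C) ≠ -1 := by
    intro h
    have := congrArg (fun M : SL2C => M 0 0) h
    norm_num at this
  refine ⟨hxy, ?_, ?_, hx, hy⟩
  · rw [Ne, toPSL_eq_one_iff]
    rintro (rfl | rfl)
    · exact h1 (by simpa using h)
    · exact h1 (by simpa using h)
  · rw [← map_mul, h, toPSL_eq_one_iff]
    exact Or.inr rfl

/-- The half-turn about the line from `0` to `∞`. -/
def matN : SL2C := ⟨!![I, 0; 0, -I], by simp [Matrix.det_fin_two]⟩

theorem matN_sq : matN * matN = -1 := by
  ext i j
  fin_cases i <;> fin_cases j <;> simp only [mul_apply_sl] <;> simp [matN]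

theorem matS_mul_matN_sq : (matS * matN) * (matS * matN) = -1 := by
  ext i j
  fin_cases i <;> fin_cases j <;> simp only [mul_apply_sl] <;> simp [matN, matS]

theorem matT_mul_matN_sq (lam : ℂ) : (matT lam * matN) * (matT lam * matN) = -1 := by
  ext i j
  fin_cases i <;> fin_cases j <;> simp only [mul_apply_sl] <;> simp [matN, matT]
  ring

theorem isHalfTurn_matN : IsHalfTurn (toPSL matN) ((0 : ℂ) : Sphere) OnePoint.infty := by
  refine isHalfTurn_of_sq matN_sq (OnePoint.coe_ne_infty _) ?_ ?_
  · rw [toPSL_smul_coe]; simp [matN]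
  · rw [toPSL_smul_infty]; simp [matN]

theorem isHalfTurn_matS_mul_matN :
    IsHalfTurn (toPSL (matS * matN)) ((0 : ℂ) : Sphere) ((2 : ℂ) : Sphere) := by
  refine isHalfTurn_of_sq matS_mul_matN_sq (by simp) ?_ ?_
  · rw [toPSL_smul_coe]; simp only [mul_apply_sl]; simp [matN, matS]
  · rw [toPSL_smul_coe]
    have h1 : (matS * matN) 1 0 * 2 + (matS * matN) 1 1 = I := by
      simp only [mul_apply_sl]; simp [matN, matS]; ring
    have h2 : (matS * matN) 0 0 * 2 + (matS * matN) 0 1 = I * 2 := by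
      simp only [mul_apply_sl]; simp [matN, matS]
    rw [h1, h2, if_neg I_ne_zero, mul_div_cancel_left₀ _ I_ne_zero]

theorem isHalfTurn_matT_mul_matN (lam : ℂ) :
    IsHalfTurn (toPSL (matT lam * matN)) (lam : Sphere) OnePoint.infty := by
  refine isHalfTurn_of_sq (matT_mul_matN_sq lam) (OnePoint.coe_ne_infty _) ?_ ?_
  · rw [toPSL_smul_coe]
    have h1 : (matT lam * matN) 1 0 * lam + (matT lam * matN) 1 1 = -I := by
      simp only [mul_apply_sl]; simp [matN, matT]
    have h2 : (matT lam * matN) 0 0 * lam + (matT lam * matN) 0 1 = -I * lam := by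
      simp only [mul_apply_sl]; simp [matN, matT]; ring
    have h3 : (-I : ℂ) ≠ 0 := neg_ne_zero.2 I_ne_zero
    rw [h1, h2, if_neg h3, mul_div_cancel_left₀ _ h3]
  · rw [toPSL_smul_infty]; simp only [mul_apply_sl]; simp [matN, matT]

theorem isAxis_matS : IsAxis (toPSL matS) ((0 : ℂ) : Sphere) ((0 : ℂ) : Sphere) := by
  ext z
  induction z using OnePoint.rec with
  | infty =>
    simp only [Set.mem_ofPred_eq, toPSL_smul_infty]
    simp [matS]
  | coe z =>
    simp only [Set.mem_ofPred_eq, toPSL_smul_coe]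
    have e1 : matS 1 0 * z + matS 1 1 = z + 1 := by simp [matS]
    have e2 : matS 0 0 * z + matS 0 1 = z := by simp [matS]
    rw [e1, e2]
    split_ifs with h
    · have : z ≠ 0 := by rintro rfl; simp at h
      simp [this]
    · simp only [OnePoint.coe_eq_coe, Set.mem_insert_iff, Set.mem_singleton_iff, or_self]
      rw [div_eq_iff h]
      constructor
      · intro h1
        have : z ^ 2 = 0 := by linear_combination -h1
        exact pow_eq_zero_iff two_ne_zero |>.1 this
      · rintro rfl; simp

theorem isAxis_matT {lam : ℂ} (h : lam ≠ 0) :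
    IsAxis (toPSL (matT lam)) OnePoint.infty OnePoint.infty := by
  ext z
  induction z using OnePoint.rec with
  | infty =>
    simp only [Set.mem_ofPred_eq, toPSL_smul_infty]
    simp [matT]
  | coe z =>
    simp only [Set.mem_ofPred_eq, toPSL_smul_coe]
    simp [matT, h]

theorem isOrthoEnd_standard {lam : ℂ} (h : lam ≠ 0) :
    IsOrthoEnd (toPSL matS) (toPSL (matT lam)) ((0 : ℂ) : Sphere) ((2 : ℂ) : Sphere)
      ((0 : ℂ) : Sphere) OnePoint.infty (lam : Sphere) OnePoint.infty := by
  have hN := isHalfTurn_matN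
  have hfac : ∀ X : SL2C, toPSL X = toPSL (X * matN) * toPSL matN := by
    intro X
    rw [← map_mul, mul_assoc, matN_sq, toPSL_eq_iff]
    right; simp
  exact ⟨⟨_, _, isAxis_matS, _, hN, hN.2.2.2.1⟩, ⟨_, _, isAxis_matT h, _, hN, hN.2.2.2.2⟩,
    ⟨_, _, _, isHalfTurn_matS_mul_matN, hN, isHalfTurn_matT_mul_matN lam, hfac _, hfac _⟩⟩

theorem hasNSDCProperty_standard {lam : ℂ} (h : 4 ≤ ‖lam‖ + lam.re) :
    HasNSDCProperty ((0 : ℂ) : Sphere) ((2 : ℂ) : Sphere) ((0 : ℂ) : Sphere) OnePoint.infty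
      (lam : Sphere) OnePoint.infty := by
  -- The equality case of `norm_add_re_ge`: `ν̄` bisects the angle between `λ` and the positive
  -- axis, so `ν² λ` is positive. The circles are `Re (ν z) = 0`, `k |z|² = 2 Re (ν z)` and `Re (ν
  -- z) = |λ| k`; the second contains `2` because `Re ν = k`.
  set ν : ℂ := conj lam + ‖lam‖ with hν
  set k : ℝ := ‖lam‖ + lam.re with hk
  have hlam : 0 < ‖lam‖ := by have := re_le_norm lam; linarith
  have hsq : lam.re ^ 2 + lam.im ^ 2 = ‖lam‖ ^ 2 := by
    rw [← normSq_eq_norm_sq, normSq_apply]; ring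
  have hre : ν.re = k := by simp [hν, hk]; ring
  have him : ν.im = -lam.im := by simp [hν]
  have hns : ν.re * ν.re + ν.im * ν.im = 2 * ‖lam‖ * k := by
    rw [him, hre, hk]; linear_combination hsq
  have hνlam : ν.re * lam.re - ν.im * lam.im = ‖lam‖ * k := by
    rw [him, hre, hk]; linear_combination hsq
  have hd : 0 < normSq ν := by rw [normSq_apply, hns]; positivity
  let QA : HForm := ⟨k, 0, -ν⟩
  let QN : HForm := ⟨0, 0, ν⟩
  let QB : HForm := ⟨0, -2 * (‖lam‖ * k), ν⟩
  have dA : 0 < QA.disc := by simpa [QA, HForm.disc] using hd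
  have dN : 0 < QN.disc := by simpa [QN, HForm.disc] using hd
  have dB : 0 < QB.disc := by simpa [QB, HForm.disc] using hd
  have mA : ∀ z : ℂ, (z : Sphere) ∈ QA.zeros ↔
      k * (z.re * z.re + z.im * z.im) - 2 * (ν.re * z.re - ν.im * z.im) = 0 := fun z => by
    simp [QA, HForm.zeros, HForm.at', HForm.ev, normSq_apply]
    constructor <;> intro h <;> linarith
  have mN : ∀ z : ℂ, (z : Sphere) ∈ QN.zeros ↔ ν.re * z.re - ν.im * z.im = 0 := fun z => by
    simp [QN, HForm.zeros, HForm.at', HForm.ev]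
  have mB : ∀ z : ℂ, (z : Sphere) ∈ QB.zeros ↔ ν.re * z.re - ν.im * z.im = ‖lam‖ * k := fun z => by
    simp [QB, HForm.zeros, HForm.at', HForm.ev]
    constructor <;> intro h <;> linarith
  have iA : (OnePoint.infty : Sphere) ∉ QA.zeros := by
    simp [QA, HForm.zeros, HForm.at', HForm.ev]; linarith
  have iN : (OnePoint.infty : Sphere) ∈ QN.zeros := by
    simp [QN, HForm.zeros, HForm.at', HForm.ev]
  have iB : (OnePoint.infty : Sphere) ∈ QB.zeros := by
    simp [QB, HForm.zeros, HForm.at', HForm.ev]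
  have hk0 : 0 < k := by linarith
  have hpos : 0 < ‖lam‖ * k := by positivity
  have zA : ((0 : ℂ) : Sphere) ∈ QA.zeros := by rw [mA]; simp
  have zN : ((0 : ℂ) : Sphere) ∈ QN.zeros := by rw [mN]; simp
  have zB : ((0 : ℂ) : Sphere) ∉ QB.zeros := by rw [mB]; simpa using hpos.ne
  have tA : ((2 : ℂ) : Sphere) ∈ QA.zeros := by rw [mA, hre]; simp; ring
  have lB : (lam : Sphere) ∈ QB.zeros := by rw [mB, hνlam]
  refine ⟨by simp, OnePoint.coe_ne_infty _, OnePoint.coe_ne_infty _,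
    QA.zeros, QN.zeros, QB.zeros, isCircle_zeros dA, isCircle_zeros dN, isCircle_zeros dB,
    zA, tA, zN, iN, lB, iB, ?_, ?_, ?_, ?_, ?_, ?_⟩
  · refine (Set.subsingleton_singleton (a := ((0 : ℂ) : Sphere))).anti ?_
    rintro z ⟨h1, h2⟩
    induction z using OnePoint.rec with
    | infty => exact absurd h1 iA
    | coe z =>
      rw [mA] at h1
      rw [mN] at h2
      rw [h2, mul_zero, sub_zero, mul_eq_zero, or_iff_right hk0.ne', ← normSq_apply,
        normSq_eq_zero] at h1
      rw [h1]; rfl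
  · refine (Set.subsingleton_singleton (a := (OnePoint.infty : Sphere))).anti ?_
    rintro z ⟨h1, h2⟩
    induction z using OnePoint.rec with
    | infty => rfl
    | coe z =>
      rw [mN] at h1
      rw [mB, h1] at h2
      exact absurd h2 hpos.ne
  -- A common point has squared distance `|λ| (4 - k) / 2` from `ν̄ / 2`, so it exists only for `k =
  -- 4`, when the circles touch there.
  · refine (Set.subsingleton_singleton (a := ((conj ν / 2 : ℂ) : Sphere))).anti ?_
    rintro z ⟨h1, h2⟩
    induction z using OnePoint.rec with
    | infty => exact absurd h1 iA
    | coe z =>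
      rw [mA] at h1
      rw [mB] at h2
      have h3 : z.re * z.re + z.im * z.im = 2 * ‖lam‖ := by
        rw [h2] at h1
        apply mul_left_cancel₀ hk0.ne'
        linarith
      have h4 : normSq (z - conj ν / 2) ≤ 0 := by
        have e : normSq (z - conj ν / 2) = ‖lam‖ * (4 - k) / 2 := by
          rw [normSq_apply]
          simp
          linear_combination h3 - h2 + hns / 4
        have : ‖lam‖ * (4 - k) ≤ 0 := mul_nonpos_of_nonneg_of_nonpos hlam.le (by linarith)
        rw [e]; linarith
      have h5 := normSq_eq_zero.1 (le_antisymm h4 (normSq_nonneg _))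
      rw [sub_eq_zero.1 h5]; rfl
  -- `C_N` and `C_B` meet at `∞`, off `C_A`; `C_A` and `C_B` are joined by the half-plane `Re (ν z)
  -- > 0`, off `C_N`; `C_A` and `C_N` meet at `0`, off `C_B`.
  · rw [Separates, not_not]
    exact ⟨{OnePoint.infty}, isPreconnected_singleton, Set.singleton_subset_iff.2 iA,
      ⟨_, rfl, iN⟩, ⟨_, rfl, iB⟩⟩
  · rw [Separates, not_not]
    have hconv : Convex ℝ {z : ℂ | 0 < ν.re * z.re - ν.im * z.im} := by
      have : IsLinearMap ℝ fun z : ℂ => ν.re * z.re - ν.im * z.im :=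
        ⟨fun x y => by simp; ring, fun c x => by simp; ring⟩
      exact convex_halfSpace_gt this 0
    refine ⟨(fun z : ℂ => (z : Sphere)) '' {z : ℂ | 0 < ν.re * z.re - ν.im * z.im},
      hconv.isPreconnected.image _ OnePoint.continuous_coe.continuousOn, ?_,
      ⟨_, ⟨2, ?_, rfl⟩, tA⟩, ⟨_, ⟨lam, ?_, rfl⟩, lB⟩⟩
    · rintro _ ⟨z, hz, rfl⟩ hz'
      rw [mN] at hz'
      exact hz.ne' hz'
    · simp [hre, hk0]
    · rw [Set.mem_ofPred_eq, hνlam]; exact hpos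
  · rw [Separates, not_not]
    exact ⟨{((0 : ℂ) : Sphere)}, isPreconnected_singleton, Set.singleton_subset_iff.2 zB,
      ⟨_, rfl, zA⟩, ⟨_, rfl, zN⟩⟩

/-! ### The criterion -/

theorem isMarkedNSDC_of_le {S T : SL2C} (hS : S.1.trace = 2) (hT : T.1.trace = 2)
    (h : 8 ≤ ‖(S * T).1.trace - 2‖ + ((S * T).1.trace - 2).re) :
    IsMarkedNSDC (toPSL S) (toPSL T) := by
  have hne : (S * T).1.trace ≠ 2 := by
    intro h0
    rw [h0] at h
    norm_num at h
  set lam : ℂ := ((S * T).1.trace - 2) / 2 with hlam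
  have hlam0 : lam ≠ 0 := div_ne_zero (sub_ne_zero.2 hne) two_ne_zero
  obtain ⟨P, hPS, hPT⟩ := exists_conj_standard hS hT (lam := lam) (by rw [hlam]; ring) hlam0
  have h4 : 4 ≤ ‖lam‖ + lam.re := by
    rw [hlam, norm_div, Complex.norm_ofNat, Complex.div_ofNat_re]; linarith
  refine ⟨not_isElementary hS hT hne, _, _, _, _, _, _, ?_,
    (hasNSDCProperty_standard h4).smul (toPSL P)⟩
  rw [hPS, hPT]
  simpa only [map_mul, map_inv] using (isOrthoEnd_standard hlam0).conj (toPSL P)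

theorem generatedBy_inv (S T : SL2C) : generatedBy S T⁻¹ = generatedBy S T := by
  apply le_antisymm <;> rw [generatedBy, generatedBy, Subgroup.closure_le] <;>
    rintro g (rfl | rfl)
  · exact Subgroup.subset_closure (by simp)
  · rw [map_inv]
    exact Subgroup.inv_mem _ (Subgroup.subset_closure (by simp))
  · exact Subgroup.subset_closure (by simp)
  · rw [map_inv]
    exact inv_mem_iff.1 (Subgroup.subset_closure (by simp))

theorem isNSDC_of_eight_le {S T : SL2C} (hS : S.1.trace = 2) (hT : T.1.trace = 2)
    (h : 8 ≤ ‖(S * T).1.trace - 2‖ + |((S * T).1.trace - 2).re|) :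
    IsNSDC (generatedBy S T) := by
  rcases abs_choice ((S * T).1.trace - 2).re with habs | habs <;> rw [habs] at h
  · exact ⟨_, _, rfl, isMarkedNSDC_of_le hS hT h⟩
  · rw [← generatedBy_inv]
    refine ⟨_, _, rfl, isMarkedNSDC_of_le hS (by rw [trace_inv, hT]) ?_⟩
    rwa [trace_mul_inv_right hS hT, norm_neg, neg_re]

theorem isNSDC_iff {S T : SL2C} (hS : S.1.trace = 2) (hT : T.1.trace = 2) :
    IsNSDC (generatedBy S T) ↔ 8 ≤ ‖(S * T).1.trace - 2‖ + |((S * T).1.trace - 2).re| := by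
  refine ⟨fun h => eight_le_of_isNSDC hS hT (fun h2 => ?_) h, isNSDC_of_eight_le hS hT⟩
  obtain ⟨A, B, hAB, hne, -⟩ := h
  rw [hAB] at hne
  exact hne (isElementary_of_trace_eq_two hS hT h2)

theorem discreteTopology_of_isNSDC {G : Subgroup PSL2C} (h : IsNSDC G) : DiscreteTopology G := by
  obtain ⟨A, B, rfl, hm⟩ := h
  obtain ⟨Y, rfl, rfl⟩ := hm.exists_system
  refine Y.discrete _ ?_
  rw [Subgroup.closure_le]
  rintro g (rfl | rfl)
  · exact ⟨W.s 0 * W.s 1, by rw [map_mul, Y.φ_s, Y.φ_s]⟩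
  · exact ⟨W.s 2 * W.s 1, by rw [map_mul, Y.φ_s, Y.φ_s]⟩

theorem isNSDC_groupG_iff (lam : ℂ) : IsNSDC (groupG lam) ↔ 4 ≤ ‖lam‖ + |lam.re| := by
  have hS : matS.1.trace = 2 := by rw [trace_sl]; norm_num [matS]
  have hT : (matT lam).1.trace = 2 := by rw [trace_sl]; norm_num [matT]
  have hST : (matS * matT lam).1.trace - 2 = 2 * lam := by
    rw [trace_mul_sl]; simp [matS, matT]; ring
  rw [groupG, isNSDC_iff hS hT, hST, norm_mul, Complex.norm_ofNat]
  simp only [mul_re, re_ofNat, im_ofNat, zero_mul, sub_zero, abs_mul, Nat.abs_ofNat]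
  constructor <;> intro h <;> linarith

/-! ### Polar coordinates and the boundary -/

theorem norm_add_abs_re_polar {lam : ℂ} {ω : ℝ} (h : lam = (‖lam‖ : ℂ) * exp ((ω : ℂ) * I)) :
    ‖lam‖ * (1 + |Real.cos ω|) = ‖lam‖ + |lam.re| := by
  have : lam.re = ‖lam‖ * Real.cos ω := by
    conv_lhs => rw [h]
    rw [re_ofReal_mul, exp_ofReal_mul_I_re]
  rw [this, abs_mul, abs_norm]; ring

/-- The function `|λ| + |Re λ|` is homogeneous of degree one, so on its level set the points `t λ`
with `t < 1` approach `λ` from outside the set. -/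
theorem frontier_isNSDC :
    frontier {lam : ℂ | IsNSDC (groupG lam)} = {lam : ℂ | ‖lam‖ + |lam.re| = 4} := by
  have hset : {lam : ℂ | IsNSDC (groupG lam)} = {lam : ℂ | 4 ≤ ‖lam‖ + |lam.re|} := by
    ext lam; exact isNSDC_groupG_iff lam
  have hc : Continuous fun lam : ℂ => ‖lam‖ + |lam.re| :=
    continuous_norm.add (continuous_re.abs)
  rw [hset]
  apply Set.Subset.antisymm
  · exact (frontier_le_subset_eq continuous_const hc).trans fun lam h => Eq.symm h
  · intro lam hlam
    rw [Set.mem_ofPred_eq] at hlam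
    rw [frontier_eq_closure_inter_closure]
    refine ⟨subset_closure hlam.ge, ?_⟩
    have ht : Filter.Tendsto (fun t : ℝ => (t : ℂ) * lam) (nhdsWithin 1 (Set.Ioo 0 1))
        (nhds lam) := by
      have : Continuous fun t : ℝ => (t : ℂ) * lam := by fun_prop
      simpa using (this.tendsto 1).mono_left nhdsWithin_le_nhds
    have : (nhdsWithin (1 : ℝ) (Set.Ioo 0 1)).NeBot := right_nhdsWithin_Ioo_neBot zero_lt_one
    refine mem_closure_of_tendsto ht ?_
    filter_upwards [self_mem_nhdsWithin] with t ⟨h0, h1⟩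
    rw [Set.mem_compl_iff, Set.mem_ofPred_eq, not_le, re_ofReal_mul, norm_mul, abs_mul,
      Complex.norm_real, Real.norm_eq_abs, ← mul_add, hlam, abs_of_pos h0]
    linarith

theorem norm_add_abs_re_eq_four_iff (lam : ℂ) :
    ‖lam‖ + |lam.re| = 4 ↔ lam.im ^ 2 = 16 - 8 * |lam.re| := by
  have hsq : |lam.re| ^ 2 + lam.im ^ 2 = ‖lam‖ ^ 2 := by
    rw [sq_abs, ← normSq_eq_norm_sq, normSq_apply]; ring
  constructor
  · intro h
    have : ‖lam‖ = 4 - |lam.re| := by linarith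
    rw [this] at hsq
    linarith
  · intro h
    have h1 : 0 ≤ 4 - |lam.re| := by have := sq_nonneg lam.im; linarith
    have h2 : ‖lam‖ ^ 2 = (4 - |lam.re|) ^ 2 := by rw [← hsq, h]; ring
    rw [sq_eq_sq₀ (norm_nonneg _) h1] at h2
    linarith

end TwoParabolic
end

/-! ### The theorem -/

theorem corollary5p13 :
    -- the criterion in polar coordinates
    (∀ (lam : ℂ) (ω : ℝ), lam = (‖lam‖ : ℂ) * Complex.exp ((ω : ℂ) * Complex.I) →
      (TwoParabolic.IsNSDC (TwoParabolic.groupG lam) ↔ 4 ≤ ‖lam‖ * (1 + |Real.cos ω|))) ∧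
    -- the boundary of the space of such groups, in polar and in Euclidean coordinates
    (frontier {lam : ℂ | TwoParabolic.IsNSDC (TwoParabolic.groupG lam)} =
      {lam : ℂ | ∃ ω : ℝ, lam = (‖lam‖ : ℂ) * Complex.exp ((ω : ℂ) * Complex.I) ∧
        ‖lam‖ * (1 + |Real.cos ω|) = 4}) ∧
    (frontier {lam : ℂ | TwoParabolic.IsNSDC (TwoParabolic.groupG lam)} =
      {lam : ℂ | lam.im ^ 2 = 16 - 8 * |lam.re|}) ∧
    -- the conjugation invariant form, and the discreteness criterion
    (∀ S T : TwoParabolic.SL2C,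
      Matrix.trace (S : Matrix (Fin 2) (Fin 2) ℂ) = 2 →
      Matrix.trace (T : Matrix (Fin 2) (Fin 2) ℂ) = 2 →
      (TwoParabolic.IsNSDC (TwoParabolic.generatedBy S T) ↔
        8 ≤ ‖Matrix.trace ((S * T : TwoParabolic.SL2C) : Matrix (Fin 2) (Fin 2) ℂ) - 2‖ +
          |(Matrix.trace ((S * T : TwoParabolic.SL2C) : Matrix (Fin 2) (Fin 2) ℂ) - 2).re|) ∧
      (8 ≤ ‖Matrix.trace ((S * T : TwoParabolic.SL2C) : Matrix (Fin 2) (Fin 2) ℂ) - 2‖ +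
          |(Matrix.trace ((S * T : TwoParabolic.SL2C) : Matrix (Fin 2) (Fin 2) ℂ) - 2).re| →
        DiscreteTopology (TwoParabolic.generatedBy S T))) := by 
  have hf := TwoParabolic.frontier_isNSDC
  refine ⟨fun lam ω h => ?_, ?_, ?_, fun S T hS hT => ⟨TwoParabolic.isNSDC_iff hS hT, fun h =>
    TwoParabolic.discreteTopology_of_isNSDC (TwoParabolic.isNSDC_of_eight_le hS hT h)⟩⟩
  · rw [TwoParabolic.isNSDC_groupG_iff, TwoParabolic.norm_add_abs_re_polar h]
  · rw [hf]
    ext lam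
    constructor
    · intro h
      have hlam : lam = (‖lam‖ : ℂ) * Complex.exp ((lam.arg : ℂ) * Complex.I) :=
        (Complex.norm_mul_exp_arg_mul_I lam).symm
      exact ⟨lam.arg, hlam, by rw [TwoParabolic.norm_add_abs_re_polar hlam]; exact h⟩
    · rintro ⟨ω, hlam, h⟩
      rwa [TwoParabolic.norm_add_abs_re_polar hlam] at h
  · rw [hf]
    ext lam
    exact TwoParabolic.norm_add_abs_re_eq_four_iff lam
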